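/- **Theorem 1.1.** Let $K\ge 2$ and let $X$ be the rooted $K$-regular tree with root $0$ (every vertex has exactly $K$ children), each edge being an isometric copy of the unit interval; $|x|$ is the length of the geodesic from $0$ to $x\in X$ and $d|x|$ is the measure on $X$ giving Lebesgue measure to every edge. Let $\epsilon>0$, $\beta,\lambda_1,\lambda_2\in\mathbb R$, and let $$d_X(x,y)=\int_{[x,y]}e^{-\epsilon|z|}\,d|z|,\qquad d\mu_{\lambda_2}(x)=e^{-\beta|x|}(|x|+C)^{\lambda_2}\,d|x|,$$ where $C\ge\max\{2|\lambda_2|/(\beta-\log K),\,2(\log 4)/\epsilon\}$. Let $\Phi(t)=t^p\log^{\lambda_1}(e+t)$, where either $p>1$ and $\lambda_1\in\mathbb R$, or $p=1$ and $\lambda_1\ge 0$. Assume $$p>(\beta-\log K)/\epsilon>0,\qquad\text{and put}\qquad \theta=1-\frac{\beta-\log K}{\epsilon p}.$$ The boundary $\partial X$ is the set of infinite geodesics $\xi$ from $0$, with $d_X(\xi,\zeta)=\frac2\epsilon e^{-\epsilon k}$ for $\xi\ne\zeta$, where $k$ is the level of the last common vertex of $\xi$ and $\zeta$. Let $\nu$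 be a Borel measure on $\partial X$ that is Ahlfors regular of exponent $Q=\log K/\epsilon$: there is $c>0$ with $c^{-1}r^Q\le\nu(B(\xi,r))\le c\,r^Q$ for all $\xi\in\partial X$ and $0<r\le\operatorname{diam}\partial X$. For a vertex $x$ let $I_x$ be the set of $\xi\in\partial X$ passing through $x$; let $\mathscr Q_n=\{I_x:|x|=n\}$, let $\widehat I\in\mathscr Q_{n-1}$ be the parent of $I\in\mathscr Q_n$ (that is, $\widehat I = I_y$ with $y$ the mother of $x$ if $I=I_x$), and let $f_I=\nu(I)^{-1}\int_I f\,d\nu$. For a measure $\mu$ put $\|g\|_{L^\Phi(\mu)}=\inf\{k>0:\int\Phi(|g|/k)\,d\mu\le1\}$ (with $\Phi(\infty)=\infty$ and $\inf\emptyset=\infty$). A Borel function $g:X\to[0,\infty]$ is an upper gradient of $u:X\to\mathbb R$ if $|u(x)-u(y)|\le\int_{[x,y]}g\,ds_X$ for all $x,y\in X$, with $ds_X=e^{-\epsilon|z|}d|z|$. Let $N^{1,\Phi}(X,\mu_{\lambda_2})$ be the space of measurable $u:X\to\mathbb R$ for which $$\|u\|_{N^{1,\Phi}}=\|u\|_{L^\Phi(\mu_{\lambda_2})}+\inf_g\|g\|_{L^\Phi(\mu_{\lambda_2})}$$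 is finite, the infimum being over all upper gradients $g$ of $u$. Let $\mathcal B^{\theta,\lambda_2}_\Phi(\partial X)$ be the space of ($\nu$-a.e. classes of) $f\in L^\Phi(\nu)$ for which $$\|f\|_{\mathcal B}=\|f\|_{L^\Phi(\nu)}+\inf\{k>0:|f/k|_{\dot{\mathcal B}}\le1\},\qquad |g|_{\dot{\mathcal B}}=\sum_{n=1}^\infty e^{\epsilon n(\theta-1)p}n^{\lambda_2}\sum_{I\in\mathscr Q_n}\nu(I)\,\Phi\!\left(\frac{|g_I-g_{\widehat I}|}{e^{-\epsilon n}}\right),$$ is finite. Then $\mathcal B^{\theta,\lambda_2}_\Phi(\partial X)$ is the trace space of $N^{1,\Phi}(X,\mu_{\lambda_2})$: there are linear operators $$T:N^{1,\Phi}(X,\mu_{\lambda_2})\to\mathcal B^{\theta,\lambda_2}_\Phi(\partial X),\qquad E:\mathcal B^{\theta,\lambda_2}_\Phi(\partial X)\to N^{1,\Phi}(X,\mu_{\lambda_2})$$ and a constant $M<\infty$ with $\|Tf\|_{\mathcal B}\le M\|f\|_{N^{1,\Phi}}$ and $\|Eu\|_{N^{1,\Phi}}\le M\|u\|_{\mathcal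 B}$ for all $f$ and $u$, such that $T\circ E=\mathrm{Id}$. Moreover, for every $f\in N^{1,\Phi}(X,\mu_{\lambda_2})$ and $\nu$-a.e. $\xi\in\partial X$, the limit of $f(x)$ as $x\to\xi$ along the geodesic ray $[0,\xi)$ exists and equals $Tf(\xi)$; and for every $u\in\mathcal B^{\theta,\lambda_2}_\Phi(\partial X)$, $Eu(x)=u_{I_x}$ at every vertex $x$, and $Eu$ is affine with respect to $d_X$ on every edge. -/

import Mathlib

open MeasureTheory Filter Topology
open scoped ENNReal NNReal

namespace RegularTree

/-! ### The `K`-regular tree as a metric space -/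

/-- A point of the rooted `K`-regular tree `X` (vertices together with the points of the edges,
each edge being a copy of the unit interval).  Vertices are the finite words over `Fin K`; the
children of the word `w` are the words `w ++ [i]`.  A point at distance `level = |x|` from the root
is given by that distance and the word of length `⌈|x|⌉` that labels the edges traversed by the
geodesic from the root to the point; the vertices are the points of integer level.
The parameter `ε` is the exponent of the metric put on `X` below. -/
@[ext]
structure Tree (K : ℕ) (ε : ℝ) where
  level : ℝ
  word : List (Fin K)
  level_nonneg : 0 ≤ level
  length_word : word.length = ⌈level⌉₊

/-- Length of the longest common prefix of two words. -/
def commonPrefix {K : ℕ} : List (Fin K) → List (Fin K) → ℕ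
  | a :: v, b :: w => if a = b then commonPrefix v w + 1 else 0
  | _, _ => 0

theorem commonPrefix_comm {K : ℕ} (v w : List (Fin K)) :
    commonPrefix v w = commonPrefix w v := by
  induction v generalizing w with
  | nil => cases w <;> simp [commonPrefix]
  | cons a v ih =>
    cases w with
    | nil => simp [commonPrefix]
    | cons b w => simp [commonPrefix, ih w, eq_comm]

theorem commonPrefix_self {K : ℕ} (v : List (Fin K)) : commonPrefix v v = v.length := by
  induction v with
  | nil => simp [commonPrefix]
  | cons a v ih => simp [commonPrefix, ih]

theorem commonPrefix_ultra {K : ℕ} (u v w : List (Fin K)) :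
    min (commonPrefix u v) (commonPrefix v w) ≤ commonPrefix u w := by
  induction v generalizing u w with
  | nil => cases u <;> simp [commonPrefix]
  | cons b v ih =>
    cases u with
    | nil => simp [commonPrefix]
    | cons a u =>
      cases w with
      | nil => simp [commonPrefix]
      | cons c w =>
        have := ih u w
        simp only [commonPrefix]
        by_cases h1 : a = b <;> by_cases h2 : b = c <;> simp_all

theorem commonPrefix_eq {K : ℕ} {v w : List (Fin K)} (h1 : v.length ≤ commonPrefix v w)
    (h2 : w.length ≤ commonPrefix v w) : v = w := by
  induction v generalizing w with
  | nil => cases w <;> simp_all [commonPrefix]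
  | cons a v ih =>
    cases w with
    | nil => simp [commonPrefix] at h1
    | cons b w =>
      by_cases h : a = b
      · simp only [commonPrefix, h, if_true, List.length_cons, Nat.add_le_add_iff_right] at h1 h2
        rw [h, ih h1 h2]
      · simp [commonPrefix, h] at h1

theorem commonPrefix_take {K : ℕ} (v : List (Fin K)) (m n : ℕ) :
    commonPrefix (v.take m) (v.take n) = min (min m n) v.length := by
  induction v generalizing m n with
  | nil => simp [commonPrefix]
  | cons a v ih =>
    cases m with
    | zero => simp [commonPrefix]
    | succ m =>
      cases n with
      | zero => simp [commonPrefix]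
      | succ n => simp only [List.take_succ_cons, commonPrefix, if_true, ih, List.length_cons]; omega

section
variable {K : ℕ} {ε : ℝ}

/-- The level at which the geodesics from the root to `x` and to `y` separate; the geodesic
`[x, y]` descends from `x` to this level and then ascends to `y`. -/
noncomputable def meet (x y : Tree K ε) : ℝ :=
  min (min x.level y.level) (commonPrefix x.word y.word)

theorem meet_comm (x y : Tree K ε) : meet x y = meet y x := by
  simp [meet, commonPrefix_comm x.word y.word, min_comm x.level]

theorem meet_le_left (x y : Tree K ε) : meet x y ≤ x.level :=
  (min_le_left _ _).trans (min_le_left _ _)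

theorem meet_le_right (x y : Tree K ε) : meet x y ≤ y.level :=
  (min_le_left _ _).trans (min_le_right _ _)

theorem meet_self (x : Tree K ε) : meet x x = x.level := by
  simp [meet, commonPrefix_self, x.length_word, Nat.le_ceil]

theorem meet_ultra (x y z : Tree K ε) : min (meet x y) (meet y z) ≤ meet x z := by
  have h := commonPrefix_ultra x.word y.word z.word
  have h' : min (commonPrefix x.word y.word : ℝ) (commonPrefix y.word z.word)
      ≤ commonPrefix x.word z.word := by exact_mod_cast h
  simp only [meet] at *
  grind

/-- The distance of a point at level `t` from the root, `∫₀ᵗ e^{-εs} ds`. -/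
noncomputable def radial (ε t : ℝ) : ℝ := ∫ s in (0 : ℝ)..t, Real.exp (-ε * s)

theorem intervalIntegrable_exp (ε a b : ℝ) :
    IntervalIntegrable (fun s => Real.exp (-ε * s)) volume a b :=
  (by fun_prop : Continuous fun s : ℝ => Real.exp (-ε * s)).intervalIntegrable _ _

theorem integral_exp_eq (ε a b : ℝ) :
    ∫ s in a..b, Real.exp (-ε * s) = radial ε b - radial ε a :=
  (intervalIntegral.integral_interval_sub_left (intervalIntegrable_exp ε 0 b)
    (intervalIntegrable_exp ε 0 a)).symm

theorem radial_strictMono (ε : ℝ) : StrictMono (radial ε) := by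
  intro a b hab
  have : 0 < ∫ s in a..b, Real.exp (-ε * s) :=
    intervalIntegral.intervalIntegral_pos_of_pos (intervalIntegrable_exp ε a b)
      (fun _ => Real.exp_pos _) hab
  rw [integral_exp_eq] at this
  linarith

theorem radial_continuous (ε : ℝ) : Continuous (radial ε) :=
  intervalIntegral.continuous_primitive (fun a b => intervalIntegrable_exp ε a b) 0

/-- `d_X(x, y) = ∫_{[x, y]} e^{-ε|z|} d|z|`. -/
noncomputable instance : Dist (Tree K ε) :=
  ⟨fun x y => (∫ s in (meet x y)..x.level, Real.exp (-ε * s)) +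
    ∫ s in (meet x y)..y.level, Real.exp (-ε * s)⟩

theorem dist_def (x y : Tree K ε) :
    dist x y = (∫ s in (meet x y)..x.level, Real.exp (-ε * s)) +
      ∫ s in (meet x y)..y.level, Real.exp (-ε * s) := rfl

theorem dist_eq_radial (x y : Tree K ε) :
    dist x y = radial ε x.level + radial ε y.level - 2 * radial ε (meet x y) := by
  rw [dist_def, integral_exp_eq, integral_exp_eq]; ring

noncomputable instance : MetricSpace (Tree K ε) where
  dist_self x := by rw [dist_eq_radial, meet_self]; ring
  dist_comm x y := by rw [dist_eq_radial, dist_eq_radial, meet_comm]; ring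
  dist_triangle x y z := by
    simp only [dist_eq_radial]
    have hm := (radial_strictMono ε).monotone
    have h1 := hm (meet_le_right x y)
    have h2 := hm (meet_le_left y z)
    have h3 := hm (meet_ultra x y z)
    rcases le_total (meet x y) (meet y z) with h | h
    · rw [min_eq_left h] at h3; linarith
    · rw [min_eq_right h] at h3; linarith
  eq_of_dist_eq_zero := by
    intro x y h
    rw [dist_eq_radial] at h
    have hm := radial_strictMono ε
    have h1 := hm.monotone (meet_le_left x y)
    have h2 := hm.monotone (meet_le_right x y)
    have e1 : meet x y = x.level := hm.injective (by linarith)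
    have e2 : meet x y = y.level := hm.injective (by linarith)
    have h3 : meet x y ≤ commonPrefix x.word y.word := min_le_right _ _
    refine Tree.ext (e1.symm.trans e2) (commonPrefix_eq ?_ ?_)
    · rw [x.length_word]; exact Nat.ceil_le.2 (e1 ▸ h3)
    · rw [y.length_word]; exact Nat.ceil_le.2 (e2 ▸ h3)

noncomputable instance : MeasurableSpace (Tree K ε) := borel _
instance : BorelSpace (Tree K ε) := ⟨rfl⟩

/-- The point at level `s` of the geodesic from the root to `x`
(the root if `s ≤ 0`, and `x` if `s ≥ |x|`). -/
noncomputable def ancestor (x : Tree K ε) (s : ℝ) : Tree K ε where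
  level := min (max s 0) x.level
  word := x.word.take ⌈min (max s 0) x.level⌉₊
  level_nonneg := le_min (le_max_right _ _) x.level_nonneg
  length_word := by
    rw [List.length_take, x.length_word]
    exact min_eq_left (Nat.ceil_mono (min_le_right _ _))

theorem meet_ancestor (x : Tree K ε) (s t : ℝ) :
    meet (ancestor x s) (ancestor x t) = min (ancestor x s).level (ancestor x t).level := by
  refine min_eq_left ?_
  have h1 := Nat.le_ceil (ancestor x s).level
  have h2 := Nat.le_ceil (ancestor x t).level
  have h3 : (ancestor x s).level ≤ x.level := min_le_right _ _
  have h4 := Nat.le_ceil x.level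
  simp only [ancestor, commonPrefix_take, x.length_word, Nat.cast_min] at *
  refine le_min (le_min ?_ ?_) ?_
  · exact (min_le_left _ _).trans h1
  · exact (min_le_right _ _).trans h2
  · exact (min_le_left _ _).trans (h3.trans h4)

theorem ancestor_continuous (x : Tree K ε) : Continuous (ancestor x) := by
  rw [Metric.continuous_iff']
  intro s δ hδ
  have hc : Continuous fun t : ℝ => radial ε (min (max t 0) x.level) :=
    (radial_continuous ε).comp (by fun_prop)
  filter_upwards [Metric.continuous_iff'.1 hc s δ hδ] with t ht
  refine lt_of_eq_of_lt ?_ ht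
  rw [dist_eq_radial, meet_ancestor, (radial_strictMono ε).monotone.map_min, Real.dist_eq]
  simp only [ancestor]
  rcases le_total (radial ε (min (max t 0) x.level)) (radial ε (min (max s 0) x.level)) with h | h
  · rw [min_eq_left h, abs_of_nonpos (by linarith)]; ring
  · rw [min_eq_right h, abs_of_nonneg (by linarith)]; ring

theorem ancestor_measurable (x : Tree K ε) : Measurable (ancestor x) :=
  (ancestor_continuous x).measurable

/-- The vertex labelled by the word `w`. -/
def vertex (ε : ℝ) (w : List (Fin K)) : Tree K ε where
  level := w.length
  word := w
  level_nonneg := Nat.cast_nonneg _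
  length_word := (Nat.ceil_natCast _).symm

/-- The measure `d|x|` on `X`: Lebesgue measure on each edge `[w, w ++ [i]]`, which is parametrized
by the level `s ∈ (|w|, |w| + 1]`. -/
noncomputable def lengthMeasure (K : ℕ) (ε : ℝ) : Measure (Tree K ε) :=
  Measure.sum fun e : List (Fin K) × Fin K =>
    (volume.restrict (Set.Ioc (e.1.length : ℝ) (e.1.length + 1))).map
      (ancestor (vertex ε (e.1 ++ [e.2])))

/-- The weighted measure `dμ_l(x) = e^{-β|x|} (|x| + C)^l d|x|`. -/
noncomputable def treeMeasure (K : ℕ) (ε β C l : ℝ) : Measure (Tree K ε) :=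
  (lengthMeasure K ε).withDensity fun x =>
    ENNReal.ofReal (Real.exp (-β * x.level) * (x.level + C) ^ l)

/-- `∫_{[x, y]} g ds_X`, where `ds_X = e^{-ε|z|} d|z|` is the arc length of `d_X`. -/
noncomputable def geodesicIntegral (g : Tree K ε → ℝ≥0∞) (x y : Tree K ε) : ℝ≥0∞ :=
  (∫⁻ s in Set.Ioc (meet x y) x.level, g (ancestor x s) * ENNReal.ofReal (Real.exp (-ε * s))) +
    ∫⁻ s in Set.Ioc (meet x y) y.level, g (ancestor y s) * ENNReal.ofReal (Real.exp (-ε * s))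

/-- `g` is an upper gradient of `u`. -/
def IsUpperGradient (u : Tree K ε → ℝ) (g : Tree K ε → ℝ≥0∞) : Prop :=
  Measurable g ∧ ∀ x y, ENNReal.ofReal |u x - u y| ≤ geodesicIntegral g x y

theorem geodesicIntegral_add {g h : Tree K ε → ℝ≥0∞} (hg : Measurable g) (x y : Tree K ε) :
    geodesicIntegral (fun z => g z + h z) x y =
      geodesicIntegral g x y + geodesicIntegral h x y := by
  have key : ∀ z : Tree K ε, Measurable fun s =>
      g (ancestor z s) * ENNReal.ofReal (Real.exp (-ε * s)) := fun z =>
    (hg.comp (ancestor_measurable z)).mul (by fun_prop)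
  simp only [geodesicIntegral, add_mul]
  rw [lintegral_add_left (key x), lintegral_add_left (key y)]
  ring

theorem geodesicIntegral_smul (a : ℝ≥0∞) (ha : a ≠ ⊤) (g : Tree K ε → ℝ≥0∞) (x y : Tree K ε) :
    geodesicIntegral (fun z => a * g z) x y = a * geodesicIntegral g x y := by
  simp only [geodesicIntegral, mul_assoc]
  rw [lintegral_const_mul' _ _ ha, lintegral_const_mul' _ _ ha, mul_add]

end

/-! ### The function `Φ(t) = t^p log^l (e + t)` and Luxemburg norms -/

/-- The admissible exponents: `p > 1` and `l` arbitrary, or `p = 1` and `l ≥ 0`. -/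
def Admissible (p l : ℝ) : Prop := 1 < p ∨ (p = 1 ∧ 0 ≤ l)

theorem Admissible.one_le {p l : ℝ} (h : Admissible p l) : 1 ≤ p := by
  rcases h with h | h
  · exact h.le
  · exact h.1.ge

/-- `Φ(t) = t^p log^l (e + t)` on `[0, ∞]`, with `Φ(∞) = ∞`. -/
noncomputable def Phi (p l : ℝ) (t : ℝ≥0∞) : ℝ≥0∞ :=
  if t = ⊤ then ⊤
  else ENNReal.ofReal (t.toReal ^ p * Real.log (Real.exp 1 + t.toReal) ^ l)

/-- The Luxemburg norm `inf {k > 0 : ∫ Φ(g / k) dμ ≤ 1}` (equal to `∞` if there is no such `k`). -/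
noncomputable def luxemburg {α : Type*} [MeasurableSpace α] (p l : ℝ) (μ : Measure α)
    (g : α → ℝ≥0∞) : ℝ≥0∞ :=
  ⨅ (k : ℝ) (_ : 0 < k) (_ : ∫⁻ x, Phi p l (g x / ENNReal.ofReal k) ∂μ ≤ 1), ENNReal.ofReal k

theorem Phi_measurable (p l : ℝ) : Measurable (Phi p l) := by
  refine Measurable.ite (measurableSet_singleton _) measurable_const ?_
  fun_prop

theorem Phi_zero {p : ℝ} (hp : 1 ≤ p) (l : ℝ) : Phi p l 0 = 0 := by
  simp [Phi, Real.zero_rpow (by linarith : p ≠ 0)]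

theorem one_le_log {t : ℝ} (ht : 0 ≤ t) : 1 ≤ Real.log (Real.exp 1 + t) := by
  rw [Real.le_log_iff_exp_le (by positivity)]; linarith

theorem Phi_real_contract (p l : ℝ) {m t : ℝ} (hm : 0 ≤ m) (ht : 0 ≤ t) :
    (Real.exp (-m) * t) ^ p * Real.log (Real.exp 1 + Real.exp (-m) * t) ^ l ≤
      (Real.exp (-p * m) * (1 + m) ^ |l|) * (t ^ p * Real.log (Real.exp 1 + t) ^ l) := by
  set a := Real.log (Real.exp 1 + Real.exp (-m) * t) with ha
  set b := Real.log (Real.exp 1 + t) with hb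
  have ht' : 0 ≤ Real.exp (-m) * t := by positivity
  have ha1 : 1 ≤ a := one_le_log ht'
  have hb1 : 1 ≤ b := one_le_log ht
  have hle : Real.exp (-m) ≤ 1 := Real.exp_le_one_iff.2 (by linarith)
  have hab : a ≤ b := Real.log_le_log (by positivity) (by nlinarith)
  have hba : b ≤ (1 + m) * a := by
    have h1 : Real.exp 1 + t ≤ Real.exp m * (Real.exp 1 + Real.exp (-m) * t) := by
      have e : Real.exp m * Real.exp (-m) = 1 := by rw [← Real.exp_add]; simp
      have : 1 ≤ Real.exp m := Real.one_le_exp hm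
      have h0 := Real.exp_pos 1
      calc Real.exp 1 + t ≤ Real.exp m * Real.exp 1 + (Real.exp m * Real.exp (-m)) * t := by
            rw [e]; nlinarith
        _ = _ := by ring
    have h2 : b ≤ m + a := by
      have := Real.log_le_log (by positivity) h1
      rwa [Real.log_mul (by positivity) (by positivity), Real.log_exp] at this
    nlinarith
  have hl : a ^ l ≤ (1 + m) ^ |l| * b ^ l := by
    rcases le_total 0 l with h | h
    · rw [abs_of_nonneg h, ← Real.mul_rpow (by linarith) (by linarith)]
      exact Real.rpow_le_rpow (by linarith) (by nlinarith) h
    · rw [abs_of_nonpos h, Real.rpow_neg (by linarith), ← Real.inv_rpow (by linarith),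
        ← Real.mul_rpow (by positivity) (by linarith)]
      refine Real.rpow_le_rpow_of_nonpos (by positivity) ?_ h
      rw [inv_mul_le_iff₀ (by linarith)]; exact hba
  have he : Real.exp (-m) ^ p = Real.exp (-p * m) := by
    rw [← Real.exp_mul]; ring_nf
  rw [Real.mul_rpow (by positivity) ht, he]
  calc Real.exp (-p * m) * t ^ p * a ^ l
      ≤ Real.exp (-p * m) * t ^ p * ((1 + m) ^ |l| * b ^ l) := by gcongr
    _ = _ := by ring

theorem Phi_small {p : ℝ} (hp : 1 ≤ p) (l : ℝ) :
    ∃ r : ℝ, 0 < r ∧ ∀ x y : ℝ≥0∞, x ≤ ENNReal.ofReal r * y → Phi p l x ≤ 2⁻¹ * Phi p l y := by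
  have hlim : Tendsto (fun m : ℝ => Real.exp (-p * m) * (1 + m) ^ |l|) atTop (𝓝 0) := by
    have h := (tendsto_rpow_mul_exp_neg_mul_atTop_nhds_zero |l| p (by linarith)).comp
      (tendsto_atTop_add_const_left atTop (1 : ℝ) tendsto_id)
    have h2 := h.const_mul (Real.exp p)
    rw [mul_zero] at h2
    refine h2.congr fun m => ?_
    simp only [Function.comp, id]
    have : Real.exp (-p * m) = Real.exp p * Real.exp (-p * (1 + m)) := by
      rw [← Real.exp_add]; ring_nf
    rw [this]; ring
  obtain ⟨m₀, hm₀, hM⟩ : ∃ m₀ : ℝ, 0 ≤ m₀ ∧ ∀ m, m₀ ≤ m →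
      Real.exp (-p * m) * (1 + m) ^ |l| ≤ 2⁻¹ := by
    obtain ⟨m₀, h⟩ := eventually_atTop.1 (hlim.eventually (Iic_mem_nhds (by norm_num : (0 : ℝ) < 2⁻¹)))
    exact ⟨max m₀ 0, le_max_right _ _, fun m hm => h m ((le_max_left _ _).trans hm)⟩
  refine ⟨Real.exp (-m₀), Real.exp_pos _, fun x y hxy => ?_⟩
  by_cases hy : y = ⊤
  · simp [hy, Phi]
  have hx : x ≠ ⊤ := ne_top_of_le_ne_top (ENNReal.mul_ne_top ENNReal.ofReal_ne_top hy) hxy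
  by_cases hx0 : x = 0
  · simp [hx0, Phi_zero hp]
  lift x to ℝ≥0 using hx
  lift y to ℝ≥0 using hy
  have hx0' : (0 : ℝ) < x := by
    have : x ≠ 0 := by simpa using hx0
    positivity
  have hxy' : (x : ℝ) ≤ Real.exp (-m₀) * y := by
    have := ENNReal.toReal_mono (ENNReal.mul_ne_top ENNReal.ofReal_ne_top ENNReal.coe_ne_top) hxy
    simpa [ENNReal.toReal_mul, ENNReal.toReal_ofReal (Real.exp_pos _).le] using this
  have hy0 : (0 : ℝ) < y := by
    by_contra h
    have : (y : ℝ) = 0 := le_antisymm (not_lt.1 h) y.2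
    rw [this] at hxy'; linarith
  set m := Real.log (y / x) with hmdef
  have hm : m₀ ≤ m := by
    rw [hmdef, Real.le_log_iff_exp_le (by positivity), le_div_iff₀ hx0']
    have e : Real.exp m₀ * Real.exp (-m₀) = 1 := by rw [← Real.exp_add]; simp
    calc Real.exp m₀ * x ≤ Real.exp m₀ * (Real.exp (-m₀) * y) := by gcongr
      _ = y := by rw [← mul_assoc, e, one_mul]
  have hxe : (x : ℝ) = Real.exp (-m) * y := by
    rw [hmdef, Real.exp_neg, Real.exp_log (by positivity)]; field_simp
  have h := Phi_real_contract p l (hm₀.trans hm) hy0.le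
  rw [← hxe] at h
  have hn : (0 : ℝ) ≤ (y : ℝ) ^ p * Real.log (Real.exp 1 + y) ^ l := by
    have := one_le_log hy0.le
    positivity
  have h' := h.trans (mul_le_mul_of_nonneg_right (hM m hm) hn)
  simp only [Phi, ENNReal.coe_ne_top, if_false, ENNReal.coe_toReal]
  refine (ENNReal.ofReal_le_ofReal h').trans ?_
  rw [ENNReal.ofReal_mul (by norm_num), ENNReal.ofReal_inv_of_pos (by norm_num)]
  simp

theorem div_le_of_scale {x s : ℝ≥0∞} {a k k' r : ℝ} (hk : 0 < k) (hr : 0 < r)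
    (hk' : a * k ≤ r * k') (hk0 : 0 < k') (h : x ≤ ENNReal.ofReal a * s) :
    x / ENNReal.ofReal k' ≤ ENNReal.ofReal r * (s / ENNReal.ofReal k) := by
  rw [ENNReal.div_le_iff (by simpa using hk0) ENNReal.ofReal_ne_top]
  refine h.trans ?_
  have e : ENNReal.ofReal r * (s / ENNReal.ofReal k) * ENNReal.ofReal k' =
      ENNReal.ofReal (r * k' / k) * s := by
    rw [ENNReal.ofReal_div_of_pos hk, ENNReal.ofReal_mul hr.le, div_eq_mul_inv, div_eq_mul_inv]
    ring
  rw [e]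
  gcongr
  rw [le_div_iff₀ hk]; exact hk'

theorem Phi_scale {p : ℝ} (hp : 1 ≤ p) (l : ℝ) {a k : ℝ} (ha : 0 ≤ a) (hk : 0 < k) :
    ∃ k' : ℝ, 0 < k' ∧ ∀ x s : ℝ≥0∞, x ≤ ENNReal.ofReal a * s →
      Phi p l (x / ENNReal.ofReal k') ≤ 2⁻¹ * Phi p l (s / ENNReal.ofReal k) := by
  obtain ⟨r, hr, h⟩ := Phi_small hp l
  have hk0 : 0 < (a + 1) * k / r := by positivity
  refine ⟨(a + 1) * k / r, hk0, fun x s hx => h _ _ (div_le_of_scale hk hr ?_ hk0 hx)⟩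
  rw [mul_div_cancel₀ _ hr.ne']; nlinarith

theorem Phi_add {p : ℝ} (hp : 1 ≤ p) (l : ℝ) {k₁ k₂ : ℝ} (h₁ : 0 < k₁) (h₂ : 0 < k₂) :
    ∃ k : ℝ, 0 < k ∧ ∀ x s t : ℝ≥0∞, x ≤ s + t → Phi p l (x / ENNReal.ofReal k) ≤
      2⁻¹ * Phi p l (s / ENNReal.ofReal k₁) + 2⁻¹ * Phi p l (t / ENNReal.ofReal k₂) := by
  obtain ⟨r, hr, h⟩ := Phi_small hp l
  have hk0 : 0 < 2 * (k₁ + k₂) / r := by positivity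
  refine ⟨2 * (k₁ + k₂) / r, hk0, fun x s t hx => ?_⟩
  have e2 : ENNReal.ofReal 2 = 2 := by simp
  rcases le_total s t with hst | hst
  · refine (h _ _ (div_le_of_scale (a := 2) (s := t) h₂ hr ?_ hk0 ?_)).trans
      le_add_self
    · rw [mul_div_cancel₀ _ hr.ne']; nlinarith
    · rw [e2, two_mul]; exact hx.trans (by gcongr)
  · refine (h _ _ (div_le_of_scale (a := 2) (s := s) h₁ hr ?_ hk0 ?_)).trans
      le_self_add
    · rw [mul_div_cancel₀ _ hr.ne']; nlinarith
    · rw [e2, two_mul]; exact hx.trans (by gcongr)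

theorem le_Phi_real {p l : ℝ} (h : Admissible p l) :
    ∃ A : ℝ, 0 ≤ A ∧ ∀ t : ℝ, 0 ≤ t →
      t ≤ 1 + A * (t ^ p * Real.log (Real.exp 1 + t) ^ l) := by
  have pos : ∀ t : ℝ, 0 ≤ t → 0 ≤ t ^ p * Real.log (Real.exp 1 + t) ^ l := fun t ht => by
    have := one_le_log ht
    positivity
  have big : 0 ≤ l → ∀ t : ℝ, 1 ≤ t → t ≤ t ^ p * Real.log (Real.exp 1 + t) ^ l := by
    intro hl t ht
    have h1 : t ≤ t ^ p := by
      simpa using Real.rpow_le_rpow_of_exponent_le ht h.one_le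
    have h2 := Real.one_le_rpow (one_le_log (by linarith : 0 ≤ t)) hl
    nlinarith
  by_cases hl : 0 ≤ l
  · refine ⟨1, by norm_num, fun t ht => ?_⟩
    rcases le_total t 1 with h1 | h1
    · linarith [pos t ht]
    · linarith [big hl t h1]
  · push Not at hl
    have hp : 1 < p := by
      rcases h with h | h
      · exact h
      · linarith [h.2]
    set a := (p - 1) / (-l) with hadef
    have ha : 0 < a := div_pos (by linarith) (by linarith)
    refine ⟨4 ^ (p - 1) * (1 / a) ^ (-l), by positivity, fun t ht => ?_⟩
    rcases le_total t 1 with h1 | h1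
    · have : 0 ≤ 4 ^ (p - 1) * (1 / a) ^ (-l) * (t ^ p * Real.log (Real.exp 1 + t) ^ l) :=
        mul_nonneg (by positivity) (pos t ht)
      linarith
    have hL := one_le_log ht
    set L := Real.log (Real.exp 1 + t) with hLdef
    have hlog : L ≤ (4 * t) ^ a * (1 / a) := by
      have h2 := Real.log_le_rpow_div (by positivity : 0 ≤ Real.exp 1 + t) ha
      have h3 : Real.exp 1 + t ≤ 4 * t := by
        have := Real.exp_one_lt_d9
        linarith
      calc L ≤ (Real.exp 1 + t) ^ a / a := h2
        _ ≤ (4 * t) ^ a / a := by gcongr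
        _ = _ := by ring
    have hpow : L ^ (-l) ≤ (4 ^ (p - 1) * (1 / a) ^ (-l)) * t ^ (p - 1) := by
      have h4 := Real.rpow_le_rpow (by linarith) hlog (by linarith : 0 ≤ -l)
      rw [Real.mul_rpow (by positivity) (by positivity), ← Real.rpow_mul (by positivity),
        hadef, div_mul_cancel₀ _ (by linarith : -l ≠ 0), ← hadef,
        Real.mul_rpow (by norm_num) ht] at h4
      calc L ^ (-l) ≤ _ := h4
        _ = _ := by ring
    have hinv : L ^ (-l) * L ^ l = 1 := by
      rw [← Real.rpow_add (by linarith)]; simp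
    have htp : t ^ p = t ^ (p - 1) * t := by
      rw [← Real.rpow_add_one (by linarith)]; simp
    have hLp : 0 ≤ L ^ l := by positivity
    calc t = t * (L ^ (-l) * L ^ l) := by rw [hinv, mul_one]
      _ ≤ t * ((4 ^ (p - 1) * (1 / a) ^ (-l)) * t ^ (p - 1) * L ^ l) := by gcongr
      _ = 4 ^ (p - 1) * (1 / a) ^ (-l) * (t ^ p * L ^ l) := by rw [htp]; ring
      _ ≤ _ := by linarith

theorem le_Phi {p l : ℝ} (h : Admissible p l) :
    ∃ A : ℝ≥0∞, A ≠ ⊤ ∧ ∀ t : ℝ≥0∞, t ≠ ⊤ → t ≤ 1 + A * Phi p l t := by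
  obtain ⟨A, hA, h'⟩ := le_Phi_real h
  refine ⟨ENNReal.ofReal A, ENNReal.ofReal_ne_top, fun t ht => ?_⟩
  have := ENNReal.ofReal_le_ofReal (h' t.toReal ENNReal.toReal_nonneg)
  rw [ENNReal.ofReal_toReal ht] at this
  refine this.trans ?_
  have hn : 0 ≤ t.toReal ^ p * Real.log (Real.exp 1 + t.toReal) ^ l := by
    have := one_le_log (t := t.toReal) ENNReal.toReal_nonneg
    positivity
  rw [ENNReal.ofReal_add (by norm_num) (by positivity), ENNReal.ofReal_mul hA, Phi, if_neg ht]
  simp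

section
variable {α : Type*} [MeasurableSpace α] {μ : Measure α} {p l : ℝ}

theorem luxemburg_ne_top {g : α → ℝ≥0∞} : luxemburg p l μ g ≠ ⊤ ↔
    ∃ k : ℝ, 0 < k ∧ ∫⁻ x, Phi p l (g x / ENNReal.ofReal k) ∂μ ≤ 1 := by
  simp only [luxemburg, ne_eq, iInf_eq_top, ENNReal.ofReal_ne_top]
  push Not
  constructor
  · rintro ⟨k, hk, h, -⟩; exact ⟨k, hk, h⟩
  · rintro ⟨k, hk, h⟩; exact ⟨k, hk, h, trivial⟩

theorem luxemburg_zero (hp : 1 ≤ p) : luxemburg p l μ (fun _ => 0) ≠ ⊤ :=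
  luxemburg_ne_top.2 ⟨1, one_pos, by simp [Phi_zero hp]⟩

theorem luxemburg_add (hp : 1 ≤ p) {f g h : α → ℝ≥0∞} (hg : AEMeasurable g μ)
    (hf : ∀ᵐ x ∂μ, f x ≤ g x + h x) (h₁ : luxemburg p l μ g ≠ ⊤) (h₂ : luxemburg p l μ h ≠ ⊤) :
    luxemburg p l μ f ≠ ⊤ := by
  obtain ⟨k₁, hk₁, i₁⟩ := luxemburg_ne_top.1 h₁
  obtain ⟨k₂, hk₂, i₂⟩ := luxemburg_ne_top.1 h₂
  obtain ⟨k, hk, H⟩ := Phi_add hp l hk₁ hk₂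
  refine luxemburg_ne_top.2 ⟨k, hk, ?_⟩
  calc ∫⁻ x, Phi p l (f x / ENNReal.ofReal k) ∂μ
      ≤ ∫⁻ x, (2⁻¹ * Phi p l (g x / ENNReal.ofReal k₁) +
          2⁻¹ * Phi p l (h x / ENNReal.ofReal k₂)) ∂μ :=
        lintegral_mono_ae (hf.mono fun x hx => H _ _ _ hx)
    _ = 2⁻¹ * ∫⁻ x, Phi p l (g x / ENNReal.ofReal k₁) ∂μ +
          2⁻¹ * ∫⁻ x, Phi p l (h x / ENNReal.ofReal k₂) ∂μ := by
        have hm : AEMeasurable (fun x => 2⁻¹ * Phi p l (g x / ENNReal.ofReal k₁)) μ :=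
          ((Phi_measurable p l).comp_aemeasurable (hg.div_const _)).const_mul _
        rw [lintegral_add_left' hm, lintegral_const_mul' _ _ (by simp),
          lintegral_const_mul' _ _ (by simp)]
    _ ≤ 2⁻¹ * 1 + 2⁻¹ * 1 := by gcongr
    _ = 1 := by simp [ENNReal.inv_two_add_inv_two]

theorem luxemburg_smul (hp : 1 ≤ p) {f g : α → ℝ≥0∞} {a : ℝ} (ha : 0 ≤ a)
    (hf : ∀ᵐ x ∂μ, f x ≤ ENNReal.ofReal a * g x) (h₁ : luxemburg p l μ g ≠ ⊤) :
    luxemburg p l μ f ≠ ⊤ := by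
  obtain ⟨k₁, hk₁, i₁⟩ := luxemburg_ne_top.1 h₁
  obtain ⟨k, hk, H⟩ := Phi_scale hp l ha hk₁
  refine luxemburg_ne_top.2 ⟨k, hk, le_trans ?_ i₁⟩
  refine lintegral_mono_ae (hf.mono fun x hx => (H _ _ hx).trans ?_)
  exact mul_le_of_le_one_left' (by simp)

theorem integrable_of_luxemburg [IsFiniteMeasure μ] (h : Admissible p l) {f : α → ℝ}
    (hf : AEStronglyMeasurable f μ)
    (hl : luxemburg p l μ (fun x => ENNReal.ofReal |f x|) ≠ ⊤) : Integrable f μ := by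
  obtain ⟨k, hk, i⟩ := luxemburg_ne_top.1 hl
  obtain ⟨A, hA, H⟩ := le_Phi h
  have hfin : ∫⁻ x, ENNReal.ofReal |f x| / ENNReal.ofReal k ∂μ ≠ ⊤ := by
    refine ne_top_of_le_ne_top ?_ (lintegral_mono fun x => H _ ?_)
    · rw [lintegral_add_left measurable_const, lintegral_const_mul' _ _ hA]
      refine ENNReal.add_ne_top.2 ⟨by simp, ENNReal.mul_ne_top hA ?_⟩
      exact ne_top_of_le_ne_top ENNReal.one_ne_top i
    · exact ENNReal.div_ne_top ENNReal.ofReal_ne_top (by simpa using hk)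
  refine ⟨hf, ?_⟩
  rw [hasFiniteIntegral_iff_norm]
  simp only [div_eq_mul_inv, Real.norm_eq_abs] at *
  rw [lintegral_mul_const' _ _ (by simpa using hk)] at hfin
  by_contra hcon
  rw [not_lt_top_iff] at hcon
  rw [hcon] at hfin
  exact hfin (ENNReal.top_mul (by simp))

end

/-! ### The Orlicz–Sobolev space on the tree -/

section
variable {K : ℕ} {ε : ℝ}

/-- `‖u‖_{L^Φ(μ)} + inf_g ‖g‖_{L^Φ(μ)}`, the infimum being over all upper gradients `g` of `u`. -/
noncomputable def sobolevNorm (p l : ℝ) (μ : Measure (Tree K ε)) (u : Tree K ε → ℝ) : ℝ≥0∞ :=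
  luxemburg p l μ (fun x => ENNReal.ofReal |u x|) +
    ⨅ (g : Tree K ε → ℝ≥0∞) (_ : IsUpperGradient u g), luxemburg p l μ g

theorem sobolevNorm_ne_top {p l : ℝ} {μ : Measure (Tree K ε)} {u : Tree K ε → ℝ} :
    sobolevNorm p l μ u ≠ ⊤ ↔ luxemburg p l μ (fun x => ENNReal.ofReal |u x|) ≠ ⊤ ∧
      ∃ g, IsUpperGradient u g ∧ luxemburg p l μ g ≠ ⊤ := by
  rw [sobolevNorm, ENNReal.add_ne_top]
  simp only [ne_eq, iInf_eq_top]
  push Not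
  rfl

/-- The Orlicz–Sobolev space `N^{1,Φ}(X, μ)`: the measurable functions on `X` of finite norm. -/
noncomputable def orliczSobolev {p l : ℝ} (h : Admissible p l) (μ : Measure (Tree K ε)) :
    Submodule ℝ (Tree K ε → ℝ) where
  carrier := {u | AEMeasurable u μ ∧ sobolevNorm p l μ u ≠ ⊤}
  zero_mem' := by
    refine ⟨measurable_const.aemeasurable, sobolevNorm_ne_top.2 ⟨?_, fun _ => 0, ?_, ?_⟩⟩
    · simpa using luxemburg_zero h.one_le
    · exact ⟨measurable_const, by simp⟩
    · exact luxemburg_zero h.one_le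
  add_mem' := by
    rintro u v ⟨mu, nu⟩ ⟨mv, nv⟩
    obtain ⟨u1, g, ⟨mg, hg⟩, ng⟩ := sobolevNorm_ne_top.1 nu
    obtain ⟨v1, g', ⟨mg', hg'⟩, ng'⟩ := sobolevNorm_ne_top.1 nv
    refine ⟨mu.add mv, sobolevNorm_ne_top.2 ⟨?_, fun z => g z + g' z, ⟨mg.add mg', ?_⟩, ?_⟩⟩
    · refine luxemburg_add h.one_le (by fun_prop) (ae_of_all _ fun x => ?_) u1 v1
      rw [← ENNReal.ofReal_add (abs_nonneg _) (abs_nonneg _)]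
      exact ENNReal.ofReal_le_ofReal (abs_add_le _ _)
    · intro x y
      rw [geodesicIntegral_add mg]
      refine le_trans ?_ (add_le_add (hg x y) (hg' x y))
      rw [← ENNReal.ofReal_add (abs_nonneg _) (abs_nonneg _)]
      refine ENNReal.ofReal_le_ofReal ?_
      have := abs_add_le (u x - u y) (v x - v y)
      simp only [Pi.add_apply]
      rwa [show u x + v x - (u y + v y) = u x - u y + (v x - v y) by ring]
    · exact luxemburg_add h.one_le mg.aemeasurable (ae_of_all _ fun x => le_rfl) ng ng'
  smul_mem' := by
    rintro a u ⟨mu, nu⟩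
    obtain ⟨u1, g, ⟨mg, hg⟩, ng⟩ := sobolevNorm_ne_top.1 nu
    refine ⟨mu.const_smul a, sobolevNorm_ne_top.2
      ⟨?_, fun z => ENNReal.ofReal |a| * g z, ⟨mg.const_mul _, ?_⟩, ?_⟩⟩
    · refine luxemburg_smul h.one_le (abs_nonneg a) (ae_of_all _ fun x => ?_) u1
      rw [← ENNReal.ofReal_mul (abs_nonneg _), ← abs_mul]; rfl
    · intro x y
      rw [geodesicIntegral_smul _ ENNReal.ofReal_ne_top]
      refine le_trans ?_ (mul_le_mul_right (hg x y) _)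
      rw [← ENNReal.ofReal_mul (abs_nonneg _), ← abs_mul, mul_sub]; rfl
    · exact luxemburg_smul h.one_le (abs_nonneg a) (ae_of_all _ fun x => le_rfl) ng

end

/-! ### The boundary -/

/-- The boundary `∂X`: a boundary point is an infinite geodesic starting at the root, that is, an
infinite word.  It carries the product topology and the product `σ`-algebra of `ℕ → Fin K`, which
are the topology and the Borel `σ`-algebra of the metric `boundaryDist`. -/
abbrev Boundary (K : ℕ) : Type := ℕ → Fin K

/-- The extension of `d_X` to the boundary: `d_X(ξ, ζ) = 2 ∫_k^∞ e^{-εt} dt = (2 / ε) e^{-εk}`,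
where `k` is the first index at which the words `ξ ≠ ζ` differ, so that the geodesics `[0, ξ)` and
`[0, ζ)` have their vertices of level at most `k`, and no others, in common. -/
noncomputable def boundaryDist {K : ℕ} (ε : ℝ) (ξ ζ : Boundary K) : ℝ :=
  open Classical in
  if ξ = ζ then 0
  else 2 / ε * Real.exp (-ε * (PiNat.firstDiff (E := fun _ => Fin K) ξ ζ : ℕ))

/-- `ν` is Ahlfors `Q`-regular with `Q = log K / ε`: `ν(B(ξ, r)) ≈ r^Q` for all `ξ ∈ ∂X` and
`0 < r ≤ diam ∂X = 2 / ε`. -/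
def IsAhlforsRegular {K : ℕ} (ε : ℝ) (ν : Measure (Boundary K)) : Prop :=
  ∃ c : ℝ, 0 < c ∧ ∀ (ξ : Boundary K) (r : ℝ), 0 < r → r ≤ 2 / ε →
    ENNReal.ofReal (c⁻¹ * r ^ (Real.log K / ε)) ≤ ν {ζ | boundaryDist ε ξ ζ < r} ∧
      ν {ζ | boundaryDist ε ξ ζ < r} ≤ ENNReal.ofReal (c * r ^ (Real.log K / ε))

theorem IsAhlforsRegular.isFiniteMeasure {K : ℕ} {ε : ℝ} (hε : 0 < ε) {ν : Measure (Boundary K)}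
    (h : IsAhlforsRegular ε ν) : IsFiniteMeasure ν := by
  obtain ⟨c, hc, h⟩ := h
  have hpos : 0 < 2 / ε := by positivity
  have hcov : (Set.univ : Set (Boundary K)) ⊆
      ⋃ i : Fin K, {ζ | boundaryDist ε (fun _ => i : Boundary K) ζ < 2 / ε} := by
    intro ζ _
    refine Set.mem_iUnion.2 ⟨ζ 0, ?_⟩
    simp only [Set.mem_ofPred_eq, boundaryDist]
    split_ifs with hζ
    · exact hpos
    · have h1 : PiNat.firstDiff (E := fun _ => Fin K) (fun _ => ζ 0) ζ ≠ 0 := by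
        intro h0
        have := PiNat.apply_firstDiff_ne (E := fun _ => Fin K) hζ
        rw [h0] at this
        exact this rfl
      have h2 : 0 < (PiNat.firstDiff (E := fun _ => Fin K) (fun _ => ζ 0) ζ : ℝ) := by
        exact_mod_cast Nat.pos_of_ne_zero h1
      have h3 : Real.exp (-ε * (PiNat.firstDiff (E := fun _ => Fin K) (fun _ => ζ 0) ζ : ℕ)) < 1 :=
        Real.exp_lt_one_iff.2 (by nlinarith)
      calc _ < 2 / ε * 1 := by gcongr
        _ = _ := mul_one _
  refine ⟨(measure_mono hcov).trans_lt ((measure_iUnion_le _).trans_lt ?_)⟩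
  rw [tsum_fintype]
  exact ENNReal.sum_lt_top.2 fun i _ => ((h _ _ hpos le_rfl).2).trans_lt ENNReal.ofReal_lt_top

/-- The point at level `s` of the geodesic ray `[0, ξ)` (the root if `s ≤ 0`). -/
noncomputable def ray {K : ℕ} (ε : ℝ) (ξ : Boundary K) (s : ℝ) : Tree K ε where
  level := max s 0
  word := (List.range ⌈max s 0⌉₊).map ξ
  level_nonneg := le_max_right _ _
  length_word := by simp

/-- The dyadic set `I_w` of the boundary points whose geodesic passes through the vertex `w`. -/
def cylinder {K : ℕ} (w : List (Fin K)) : Set (Boundary K) :=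
  {ξ | (List.range w.length).map ξ = w}

/-- The mean value `f_I` of `f` over `I = I_w`. -/
noncomputable def dyadicMean {K : ℕ} (ν : Measure (Boundary K)) (f : Boundary K → ℝ)
    (w : List (Fin K)) : ℝ :=
  ⨍ ξ in cylinder w, f ξ ∂ν

/-! ### The Orlicz–Besov space on the boundary -/

section
variable {K : ℕ}

/-- The quantity `|f_I - f_Î| / e^{-εn}` for `I = I_w`, whose parent is `Î = I_{w.dropLast}`. -/
noncomputable def oscillation (ε : ℝ) (ν : Measure (Boundary K)) (f : Boundary K → ℝ) (n : ℕ)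
    (w : List (Fin K)) : ℝ≥0∞ :=
  ENNReal.ofReal (|dyadicMean ν f w - dyadicMean ν f w.dropLast| / Real.exp (-ε * n))

/-- The dyadic energy
`∑_{n ≥ 1} e^{εn(θ-1)p} n^{l₂} ∑_{I ∈ 𝒬_n} ν(I) Φ(|f_I - f_Î| / e^{-εn})`.  The elements `I_w` of
`𝒬_n` are indexed by the words `w` of length `n`.  The summation index `n` below is the `n - 1` of the formula. -/
noncomputable def dyadicEnergy (ε θ p l₁ l₂ : ℝ) (ν : Measure (Boundary K))
    (f : Boundary K → ℝ) : ℝ≥0∞ :=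
  ∑' n : ℕ, ENNReal.ofReal
      (Real.exp (ε * ((n + 1 : ℕ) : ℝ) * (θ - 1) * p) * ((n + 1 : ℕ) : ℝ) ^ l₂) *
    ∑ w : Fin (n + 1) → Fin K, ν (cylinder (List.ofFn w)) *
      Phi p l₁ (oscillation ε ν f (n + 1) (List.ofFn w))

/-- `inf {k > 0 : |f / k| ≤ 1}`, where `|·|` is the dyadic energy. -/
noncomputable def besovSeminorm (ε θ p l₁ l₂ : ℝ) (ν : Measure (Boundary K))
    (f : Boundary K → ℝ) : ℝ≥0∞ :=
  ⨅ (k : ℝ) (_ : 0 < k) (_ : dyadicEnergy ε θ p l₁ l₂ ν (fun ξ => f ξ / k) ≤ 1), ENNReal.ofReal k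

/-- The Orlicz–Besov norm `‖f‖_{L^Φ(ν)} + inf {k > 0 : |f / k| ≤ 1}`. -/
noncomputable def besovNorm (ε θ p l₁ l₂ : ℝ) (ν : Measure (Boundary K))
    (f : Boundary K → ℝ) : ℝ≥0∞ :=
  luxemburg p l₁ ν (fun ξ => ENNReal.ofReal |f ξ|) + besovSeminorm ε θ p l₁ l₂ ν f

theorem besovSeminorm_ne_top {ε θ p l₁ l₂ : ℝ} {ν : Measure (Boundary K)} {f : Boundary K → ℝ} :
    besovSeminorm ε θ p l₁ l₂ ν f ≠ ⊤ ↔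
      ∃ k : ℝ, 0 < k ∧ dyadicEnergy ε θ p l₁ l₂ ν (fun ξ => f ξ / k) ≤ 1 := by
  simp only [besovSeminorm, ne_eq, iInf_eq_top, ENNReal.ofReal_ne_top]
  push Not
  constructor
  · rintro ⟨k, hk, h, -⟩; exact ⟨k, hk, h⟩
  · rintro ⟨k, hk, h⟩; exact ⟨k, hk, h, trivial⟩

theorem dyadicMean_congr {ν : Measure (Boundary K)} {f g : Boundary K → ℝ} (h : f =ᵐ[ν] g)
    (w : List (Fin K)) : dyadicMean ν f w = dyadicMean ν g w :=
  average_congr (ae_restrict_of_ae h)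

theorem dyadicMean_add {ν : Measure (Boundary K)} {f g : Boundary K → ℝ} (hf : Integrable f ν)
    (hg : Integrable g ν) (w : List (Fin K)) :
    dyadicMean ν (fun ξ => f ξ + g ξ) w = dyadicMean ν f w + dyadicMean ν g w := by
  simp only [dyadicMean, setAverage_eq]
  rw [integral_add hf.restrict hg.restrict, smul_add]

theorem dyadicMean_mul (ν : Measure (Boundary K)) (a : ℝ) (f : Boundary K → ℝ)
    (w : List (Fin K)) : dyadicMean ν (fun ξ => a * f ξ) w = a * dyadicMean ν f w := by
  simp only [dyadicMean, setAverage_eq]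
  rw [integral_const_mul, smul_eq_mul, smul_eq_mul]; ring

theorem oscillation_div (ε : ℝ) (ν : Measure (Boundary K)) (f : Boundary K → ℝ) (n : ℕ)
    (w : List (Fin K)) {k : ℝ} (hk : 0 < k) :
    oscillation ε ν (fun ξ => f ξ / k) n w = oscillation ε ν f n w / ENNReal.ofReal k := by
  have h : (fun ξ => f ξ / k) = fun ξ => k⁻¹ * f ξ := by ext ξ; ring
  rw [oscillation, oscillation, ← ENNReal.ofReal_div_of_pos hk, h, dyadicMean_mul, dyadicMean_mul,
    ← mul_sub, abs_mul, abs_of_pos (inv_pos.2 hk)]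
  congr 1
  ring

theorem besovSeminorm_add {ε θ p l₁ l₂ : ℝ} {ν : Measure (Boundary K)} {f g h : Boundary K → ℝ}
    (hp : 1 ≤ p)
    (hf : ∀ n w, oscillation ε ν f n w ≤ oscillation ε ν g n w + oscillation ε ν h n w)
    (h₁ : besovSeminorm ε θ p l₁ l₂ ν g ≠ ⊤) (h₂ : besovSeminorm ε θ p l₁ l₂ ν h ≠ ⊤) :
    besovSeminorm ε θ p l₁ l₂ ν f ≠ ⊤ := by
  obtain ⟨k₁, hk₁, i₁⟩ := besovSeminorm_ne_top.1 h₁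
  obtain ⟨k₂, hk₂, i₂⟩ := besovSeminorm_ne_top.1 h₂
  obtain ⟨k, hk, H⟩ := Phi_add hp l₁ hk₁ hk₂
  refine besovSeminorm_ne_top.2 ⟨k, hk, ?_⟩
  have key : dyadicEnergy ε θ p l₁ l₂ ν (fun ξ => f ξ / k) ≤
      2⁻¹ * dyadicEnergy ε θ p l₁ l₂ ν (fun ξ => g ξ / k₁) +
        2⁻¹ * dyadicEnergy ε θ p l₁ l₂ ν (fun ξ => h ξ / k₂) := by
    simp only [dyadicEnergy]
    rw [← ENNReal.tsum_mul_left, ← ENNReal.tsum_mul_left, ← ENNReal.tsum_add]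
    refine ENNReal.tsum_le_tsum fun n => ?_
    rw [mul_left_comm 2⁻¹, mul_left_comm 2⁻¹, ← mul_add, Finset.mul_sum Finset.univ _ (2⁻¹ : ℝ≥0∞),
      Finset.mul_sum Finset.univ _ (2⁻¹ : ℝ≥0∞), ← Finset.sum_add_distrib]
    gcongr with w
    rw [mul_left_comm 2⁻¹, mul_left_comm 2⁻¹, ← mul_add, oscillation_div _ _ _ _ _ hk,
      oscillation_div _ _ _ _ _ hk₁, oscillation_div _ _ _ _ _ hk₂]
    gcongr
    exact H _ _ _ (hf _ _)
  refine key.trans ?_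
  calc _ ≤ (2⁻¹ : ℝ≥0∞) * 1 + 2⁻¹ * 1 := by gcongr
    _ = 1 := by simp [ENNReal.inv_two_add_inv_two]

theorem besovSeminorm_smul {ε θ p l₁ l₂ : ℝ} {ν : Measure (Boundary K)} {f g : Boundary K → ℝ}
    (hp : 1 ≤ p) {a : ℝ} (ha : 0 ≤ a)
    (hf : ∀ n w, oscillation ε ν f n w ≤ ENNReal.ofReal a * oscillation ε ν g n w)
    (h₁ : besovSeminorm ε θ p l₁ l₂ ν g ≠ ⊤) : besovSeminorm ε θ p l₁ l₂ ν f ≠ ⊤ := by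
  obtain ⟨k₁, hk₁, i₁⟩ := besovSeminorm_ne_top.1 h₁
  obtain ⟨k, hk, H⟩ := Phi_scale hp l₁ ha hk₁
  refine besovSeminorm_ne_top.2 ⟨k, hk, le_trans ?_ i₁⟩
  simp only [dyadicEnergy]
  refine ENNReal.tsum_le_tsum fun n => ?_
  gcongr with w
  rw [oscillation_div _ _ _ _ _ hk, oscillation_div _ _ _ _ _ hk₁]
  exact (H _ _ (hf _ _)).trans (mul_le_of_le_one_left' (by simp))

/-- The Orlicz–Besov space on `∂X`: the `ν`-a.e. classes of measurable functions of finite norm.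
(Finiteness of the norm includes finiteness of the Luxemburg norm, hence membership in
`L^Φ(∂X)`.) -/
noncomputable def orliczBesov {ε p l₁ : ℝ} (hε : 0 < ε) (h : Admissible p l₁) (θ l₂ : ℝ)
    {ν : Measure (Boundary K)} (hν : IsAhlforsRegular ε ν) : Submodule ℝ (Boundary K →ₘ[ν] ℝ) where
  carrier := {f | besovNorm ε θ p l₁ l₂ ν f ≠ ⊤}
  zero_mem' := by
    have hz := AEEqFun.coeFn_zero (β := ℝ) (μ := ν)
    refine ENNReal.add_ne_top.2 ⟨?_, ?_⟩
    · refine luxemburg_smul h.one_le le_rfl (hz.mono fun ξ hξ => ?_)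
        (luxemburg_zero (μ := ν) (l := l₁) h.one_le)
      simp [hξ]
    · refine besovSeminorm_ne_top.2 ⟨1, one_pos, ?_⟩
      have hm : ∀ w, dyadicMean ν (fun ξ => (0 : Boundary K →ₘ[ν] ℝ) ξ / 1) w = 0 := fun w => by
        rw [dyadicMean_congr (g := fun _ => 0) (hz.mono fun ξ hξ => by simp [hξ])]
        simp [dyadicMean]
      simp only [dyadicEnergy, oscillation, hm]
      simp [Phi_zero h.one_le]
  add_mem' := by
    intro f g hf hg
    have := hν.isFiniteMeasure hε
    obtain ⟨f1, f2⟩ := ENNReal.add_ne_top.1 hf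
    obtain ⟨g1, g2⟩ := ENNReal.add_ne_top.1 hg
    have hadd := AEEqFun.coeFn_add f g
    have hfi := integrable_of_luxemburg h f.aestronglyMeasurable f1
    have hgi := integrable_of_luxemburg h g.aestronglyMeasurable g1
    refine ENNReal.add_ne_top.2 ⟨?_, ?_⟩
    · refine luxemburg_add h.one_le ?_ (hadd.mono fun ξ hξ => ?_) f1 g1
      · exact (f.aestronglyMeasurable.aemeasurable.abs).ennreal_ofReal
      · rw [hξ, ← ENNReal.ofReal_add (abs_nonneg _) (abs_nonneg _)]
        exact ENNReal.ofReal_le_ofReal (abs_add_le _ _)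
    · refine besovSeminorm_add h.one_le (fun n w => ?_) f2 g2
      have hm : ∀ v, dyadicMean ν (f + g : Boundary K →ₘ[ν] ℝ) v =
          dyadicMean ν f v + dyadicMean ν g v := fun v => by
        rw [dyadicMean_congr (g := fun ξ => f ξ + g ξ) hadd, dyadicMean_add hfi hgi]
      rw [oscillation, oscillation, oscillation,
        ← ENNReal.ofReal_add (by positivity) (by positivity), hm, hm, ← add_div]
      gcongr
      refine le_of_eq_of_le ?_ (abs_add_le _ _)
      congr 1
      ring
  smul_mem' := by
    intro a f hf
    obtain ⟨f1, f2⟩ := ENNReal.add_ne_top.1 hf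
    have hs := AEEqFun.coeFn_smul a f
    refine ENNReal.add_ne_top.2 ⟨?_, ?_⟩
    · refine luxemburg_smul h.one_le (abs_nonneg a) (hs.mono fun ξ hξ => ?_) f1
      rw [hξ, ← ENNReal.ofReal_mul (abs_nonneg _), ← abs_mul]; rfl
    · refine besovSeminorm_smul h.one_le (abs_nonneg a) (fun n w => ?_) f2
      have hm : ∀ v, dyadicMean ν (a • f : Boundary K →ₘ[ν] ℝ) v = a * dyadicMean ν f v :=
        fun v => by
          rw [dyadicMean_congr (g := fun ξ => a * f ξ) hs, dyadicMean_mul]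
      rw [oscillation, oscillation, ← ENNReal.ofReal_mul (abs_nonneg _), hm, hm, ← mul_sub,
        abs_mul, mul_div_assoc]

/-- The extension of `u` by dyadic means: it equals `u_{I_w}` at each vertex `w`, and on each edge
it is interpolated affinely with respect to `d_X`.  A point `x` with word `w` lies on the edge from
the vertex `w.dropLast` to the vertex `w`; at the root both are the empty word. -/
noncomputable def dyadicExtension (ε : ℝ) (ν : Measure (Boundary K)) (u : Boundary K → ℝ)
    (x : Tree K ε) : ℝ :=
  dyadicMean ν u x.word.dropLast +
    (dyadicMean ν u x.word - dyadicMean ν u x.word.dropLast) /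
        dist (vertex ε x.word.dropLast) (vertex ε x.word) *
      dist (vertex ε x.word.dropLast) x

end

end RegularTree

/-!
The proof reduces everything to sequences along the geodesic rays `[0, ξ)`.

Ahlfors regularity of `ν` says that a cylinder `I_w` with `|w| = n ≥ 1` has measure comparable to
`K^{-n}`.  Therefore the integral of a function over `X` against `μ_l` is comparable to its integral
along `[0, ξ)` with the weights `W_n = e^{-b(n+1)} (n+1)^l`, `b = β - log K`, on the edge from level
`n` to level `n + 1`, averaged over `ξ` (`lintegral_treeMeasure_le`, `le_lintegral_treeMeasure`).
The dyadic energy is a sum of integrals over the boundary with the same weights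
(`dyadicEnergy_eq_tsum_lintegral`), because `ε p (1 - θ) = b`.

The function `Φ` need not be monotone or convex if the exponent of the logarithm is negative, but
`Φ(t) / t` is increasing up to a constant factor and `Φ` satisfies the `Δ₂` condition.  This suffices
for Jensen's inequality with a constant (`Phi_lintegral_le`) and for a Hardy inequality along a
single ray (`tsum_levelWeight_mul_Phi_tsum_le`): the tail sums of `e^{-εj} G_j` are bounded by `G` in
the weighted modular as soon as `b < ε p`.

*Trace.*  If `g` is an upper gradient of `f` and `G_n` are its integrals over the edges of `[0, ξ)`,
then `f` varies beyond level `n` of the ray by at most the tail of the series `∑ e^{-εn} G_n`.  By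
the Hardy inequality this series converges for almost every `ξ`, so `f` has a limit there.  The
difference of the means of the limit over a cylinder and over its parent is at most the sum of the
averages of the tails over the two, so Jensen's and Hardy's inequalities bound the dyadic energy
(`besovSeminorm_rayLimit_le`).

*Extension.*  The slope of the extension on an edge is an upper gradient, and it is at most the
corresponding normalized difference of means, so its modular is at most a multiple of the dyadic
energy (`luxemburg_edgeSlope_le`).  The `L^Φ` bound is Jensen's inequality on cylinders together
with `∑ W_n < ∞`, which is where `b > 0` enters.  The extension of `u` has the limit `u(ξ)` at almost
every `ξ` by Lévy's upward theorem, the dyadic means being conditional expectations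
(`tendsto_dyadicMean`).

The bounds are proved for modulars with some constant and pass to the norms since `Φ(t / M)` is at
most any given multiple of `Φ(t)` for large `M` (`exists_mul_Phi_div_le`).
-/

namespace RegularTree

/-! ### Quasi-convexity and doubling of `Φ` -/

theorem exp_neg_mul_rpow_bounded {c d : ℝ} (hc : 0 < c) (hd : 0 ≤ d) :
    ∃ A : ℝ, 1 ≤ A ∧ ∀ m : ℝ, 0 ≤ m → Real.exp (-c * m) * (1 + m) ^ d ≤ A := by
  -- `1 + m ≤ B (1 + η m) ≤ B e^{η m}`, and `η (d + 1) = c`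
  set η := c / (d + 1) with hη
  have hη0 : 0 < η := by positivity
  set B := max 1 (1 / η) with hB
  have hB1 : 1 ≤ B := le_max_left _ _
  refine ⟨B ^ (d + 1), Real.one_le_rpow hB1 (by linarith), fun m hm => ?_⟩
  have h1 : 1 + m ≤ B * Real.exp (η * m) := by
    have h2 : 1 + η * m ≤ Real.exp (η * m) := by linarith [Real.add_one_le_exp (η * m)]
    have h3 : 1 ≤ B * η := by
      have : 1 / η ≤ B := le_max_right _ _
      rwa [div_le_iff₀ hη0] at this
    calc 1 + m ≤ B * 1 + (B * η) * m := by nlinarith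
      _ = B * (1 + η * m) := by ring
      _ ≤ _ := by gcongr
  have h4 : (1 + m) ^ d ≤ B ^ (d + 1) * Real.exp (c * m) := by
    calc (1 + m) ^ d ≤ (1 + m) ^ (d + 1) :=
          Real.rpow_le_rpow_of_exponent_le (by linarith) (by linarith)
      _ ≤ (B * Real.exp (η * m)) ^ (d + 1) :=
          Real.rpow_le_rpow (by linarith) h1 (by linarith)
      _ = B ^ (d + 1) * Real.exp (c * m) := by
          rw [Real.mul_rpow (by linarith) (Real.exp_pos _).le, ← Real.exp_mul]
          congr 2
          rw [hη]; field_simp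
  calc Real.exp (-c * m) * (1 + m) ^ d
      ≤ Real.exp (-c * m) * (B ^ (d + 1) * Real.exp (c * m)) := by gcongr
    _ = B ^ (d + 1) * (Real.exp (-c * m) * Real.exp (c * m)) := by ring
    _ = B ^ (d + 1) := by rw [← Real.exp_add]; simp

theorem Phi_ofReal (p l : ℝ) {t : ℝ} (ht : 0 ≤ t) : Phi p l (ENNReal.ofReal t) =
    ENNReal.ofReal (t ^ p * Real.log (Real.exp 1 + t) ^ l) := by
  simp [Phi, ENNReal.toReal_ofReal ht]

theorem Phi_top (p l : ℝ) : Phi p l ⊤ = ⊤ := by simp [Phi]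

theorem Phi_real_nonneg (p l : ℝ) {t : ℝ} (ht : 0 ≤ t) :
    0 ≤ t ^ p * Real.log (Real.exp 1 + t) ^ l := by
  have := one_le_log ht
  positivity

theorem Phi_real_pos (p l : ℝ) {t : ℝ} (ht : 0 < t) :
    0 < t ^ p * Real.log (Real.exp 1 + t) ^ l := by
  have := one_le_log ht.le
  positivity

theorem Phi_contract (p l : ℝ) {m : ℝ} (hm : 0 ≤ m) (t : ℝ≥0∞) :
    Phi p l (ENNReal.ofReal (Real.exp (-m)) * t) ≤
      ENNReal.ofReal (Real.exp (-p * m) * (1 + m) ^ |l|) * Phi p l t := by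
  by_cases ht : t = ⊤
  · subst ht
    have : 0 < Real.exp (-p * m) * (1 + m) ^ |l| := by positivity
    rw [Phi_top, ENNReal.mul_top (a := ENNReal.ofReal (Real.exp (-p * m) * (1 + m) ^ |l|))
      (by simpa using this)]
    exact le_top
  obtain ⟨t, ht0, rfl⟩ : ∃ s : ℝ, 0 ≤ s ∧ t = ENNReal.ofReal s :=
    ⟨t.toReal, ENNReal.toReal_nonneg, (ENNReal.ofReal_toReal ht).symm⟩
  rw [← ENNReal.ofReal_mul (Real.exp_pos _).le, Phi_ofReal _ _ (by positivity), Phi_ofReal _ _ ht0,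
    ← ENNReal.ofReal_mul (by positivity)]
  exact ENNReal.ofReal_le_ofReal (Phi_real_contract p l hm ht0)

/-- `Φ(t) / t` is increasing up to a constant factor.  For `p = 1` this uses `l ≥ 0`. -/
theorem Phi_real_ratio {p l : ℝ} (h : Admissible p l) :
    ∃ A : ℝ, 1 ≤ A ∧ ∀ s y : ℝ, 0 < s → s ≤ y →
      y * (s ^ p * Real.log (Real.exp 1 + s) ^ l) ≤
        A * (s * (y ^ p * Real.log (Real.exp 1 + y) ^ l)) := by
  rcases h with hp | ⟨rfl, hl⟩
  · obtain ⟨A, hA, H⟩ := exp_neg_mul_rpow_bounded (c := p - 1) (by linarith) (abs_nonneg l)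
    refine ⟨A, hA, fun s y hs hsy => ?_⟩
    have hy : 0 < y := hs.trans_le hsy
    set m := Real.log (y / s) with hm
    have hm0 : 0 ≤ m := Real.log_nonneg (by rwa [le_div_iff₀ hs, one_mul])
    have hsm : s = Real.exp (-m) * y := by
      rw [hm, Real.exp_neg, Real.exp_log (by positivity)]; field_simp
    have h1 := Phi_real_contract p l hm0 hy.le
    rw [← hsm] at h1
    have h2 := H m hm0
    have h3 : Real.exp (-p * m) = Real.exp (-m) * Real.exp (-(p - 1) * m) := by
      rw [← Real.exp_add]; ring_nf
    have h4 := Phi_real_nonneg p l hy.le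
    calc y * (s ^ p * Real.log (Real.exp 1 + s) ^ l)
        ≤ y * (Real.exp (-p * m) * (1 + m) ^ |l| *
            (y ^ p * Real.log (Real.exp 1 + y) ^ l)) := by gcongr
      _ = (Real.exp (-(p - 1) * m) * (1 + m) ^ |l|) *
            ((Real.exp (-m) * y) * (y ^ p * Real.log (Real.exp 1 + y) ^ l)) := by rw [h3]; ring
      _ ≤ A * (s * (y ^ p * Real.log (Real.exp 1 + y) ^ l)) := by
          rw [← hsm]; gcongr
  · refine ⟨1, le_rfl, fun s y hs hsy => ?_⟩
    have h1 := one_le_log hs.le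
    have : Real.log (Real.exp 1 + s) ^ l ≤ Real.log (Real.exp 1 + y) ^ l :=
      Real.rpow_le_rpow (by linarith) (Real.log_le_log (by positivity) (by linarith)) hl
    rw [Real.rpow_one, Real.rpow_one, one_mul]
    have hy : 0 < y := hs.trans_le hsy
    calc y * (s * Real.log (Real.exp 1 + s) ^ l) ≤ y * (s * Real.log (Real.exp 1 + y) ^ l) := by
          gcongr
      _ = _ := by ring

theorem Phi_ratio {p l : ℝ} (h : Admissible p l) :
    ∃ A : ℝ≥0, 1 ≤ A ∧ ∀ s y : ℝ≥0∞, s ≤ y → y * Phi p l s ≤ A * (s * Phi p l y) := by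
  obtain ⟨A, hA, H⟩ := Phi_real_ratio h
  refine ⟨A.toNNReal, by simpa using hA, fun s y hsy => ?_⟩
  by_cases hs0 : s = 0
  · simp [hs0, Phi_zero h.one_le]
  by_cases hy : y = ⊤
  · subst hy
    have : ((A.toNNReal : ℝ≥0) : ℝ≥0∞) ≠ 0 := by simp; linarith
    rw [Phi_top, ENNReal.mul_top hs0, ENNReal.mul_top this]
    exact le_top
  have hs : s ≠ ⊤ := ne_top_of_le_ne_top hy hsy
  obtain ⟨t, ht0, rfl⟩ : ∃ t : ℝ, 0 ≤ t ∧ s = ENNReal.ofReal t :=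
    ⟨s.toReal, ENNReal.toReal_nonneg, (ENNReal.ofReal_toReal hs).symm⟩
  obtain ⟨z, hz0, rfl⟩ : ∃ t : ℝ, 0 ≤ t ∧ y = ENNReal.ofReal t :=
    ⟨y.toReal, ENNReal.toReal_nonneg, (ENNReal.ofReal_toReal hy).symm⟩
  have htz : t ≤ z := (ENNReal.ofReal_le_ofReal_iff hz0).1 hsy
  have ht : 0 < t := by simpa using hs0
  rw [Phi_ofReal _ _ ht0, Phi_ofReal _ _ hz0, ← ENNReal.ofReal_mul hz0, ← ENNReal.ofReal_mul ht0]
  change _ ≤ ENNReal.ofReal A * _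
  rw [← ENNReal.ofReal_mul (by linarith)]
  exact ENNReal.ofReal_le_ofReal (H t z ht htz)

theorem Phi_mono {p l : ℝ} (h : Admissible p l) :
    ∃ A : ℝ≥0, ∀ x y : ℝ≥0∞, x ≤ y → Phi p l x ≤ A * Phi p l y := by
  obtain ⟨A, hA, H⟩ := Phi_ratio h
  refine ⟨A, fun x y hxy => ?_⟩
  have hA0 : ((A : ℝ≥0) : ℝ≥0∞) ≠ 0 := by
    have : A ≠ 0 := by rintro rfl; simp at hA
    simpa using this
  by_cases hx0 : x = 0
  · simp [hx0, Phi_zero h.one_le]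
  by_cases hy : y = ⊤
  · rw [hy, Phi_top, ENNReal.mul_top hA0]; exact le_top
  have hy0 : y ≠ 0 := fun hy0 => hx0 (le_antisymm (hy0 ▸ hxy) (by simp))
  have h1 : y * Phi p l x ≤ y * (A * Phi p l y) := by
    calc y * Phi p l x ≤ A * (x * Phi p l y) := H x y hxy
      _ ≤ A * (y * Phi p l y) := by gcongr
      _ = _ := by ring
  exact (ENNReal.mul_le_mul_iff_right hy0 hy).1 h1

theorem Phi_real_dilate (p l : ℝ) {a t : ℝ} (ha : 1 ≤ a) (ht : 0 ≤ t) :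
    (a * t) ^ p * Real.log (Real.exp 1 + a * t) ^ l ≤
      (a ^ p * (1 + Real.log a) ^ |l|) * (t ^ p * Real.log (Real.exp 1 + t) ^ l) := by
  have h0 := Real.exp_pos 1
  set L := Real.log (Real.exp 1 + t) with hL
  set M := Real.log (Real.exp 1 + a * t) with hM
  have hL1 : 1 ≤ L := one_le_log ht
  have hla : 0 ≤ Real.log a := Real.log_nonneg ha
  have hLM : L ≤ M := Real.log_le_log (by positivity) (by nlinarith)
  have hML : M ≤ (1 + Real.log a) * L := by
    have h2 := Real.log_le_log (by positivity)
      (show Real.exp 1 + a * t ≤ a * (Real.exp 1 + t) by nlinarith)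
    rw [Real.log_mul (by positivity) (by positivity)] at h2
    nlinarith
  have hl : M ^ l ≤ (1 + Real.log a) ^ |l| * L ^ l := by
    rcases le_total 0 l with h | h
    · rw [abs_of_nonneg h, ← Real.mul_rpow (by linarith) (by linarith)]
      exact Real.rpow_le_rpow (by linarith) hML h
    · have h1 : M ^ l ≤ L ^ l := Real.rpow_le_rpow_of_nonpos (by linarith) hLM h
      have h2 : 1 ≤ (1 + Real.log a) ^ |l| := Real.one_le_rpow (by linarith) (abs_nonneg l)
      have h3 : 0 ≤ L ^ l := by positivity
      nlinarith
  rw [Real.mul_rpow (by linarith) ht]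
  calc a ^ p * t ^ p * M ^ l ≤ a ^ p * t ^ p * ((1 + Real.log a) ^ |l| * L ^ l) := by gcongr
    _ = _ := by ring

/-- `Φ` is increasing up to a constant factor and satisfies the `Δ₂` condition. -/
theorem Phi_le_of_le_mul {p l : ℝ} (h : Admissible p l) (a : ℝ≥0) :
    ∃ A : ℝ≥0, ∀ x y : ℝ≥0∞, x ≤ a * y → Phi p l x ≤ A * Phi p l y := by
  obtain ⟨A, H⟩ := Phi_mono h
  set b : ℝ := max 1 a with hb
  have hb1 : 1 ≤ b := le_max_left _ _
  set D := b ^ p * (1 + Real.log b) ^ |l| with hD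
  have hlb : 0 ≤ Real.log b := Real.log_nonneg hb1
  have hD0 : 0 < D := by positivity
  have hA0 : ((A : ℝ≥0) : ℝ≥0∞) ≠ 0 := by
    rintro hA
    have := H 1 1 le_rfl
    rw [hA, zero_mul, ← ENNReal.ofReal_one, Phi_ofReal _ _ zero_le_one] at this
    have h2 := Phi_real_pos p l one_pos
    simp only [nonpos_iff_eq_zero, ENNReal.ofReal_eq_zero] at this
    linarith
  refine ⟨A * D.toNNReal, fun x y hxy => ?_⟩
  have hD1 : ((D.toNNReal : ℝ≥0) : ℝ≥0∞) ≠ 0 := by simpa using hD0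
  by_cases hy : y = ⊤
  · rw [hy, Phi_top, ENNReal.mul_top]
    · exact le_top
    · rw [ENNReal.coe_mul]
      exact mul_ne_zero hA0 hD1
  obtain ⟨z, hz0, rfl⟩ : ∃ t : ℝ, 0 ≤ t ∧ y = ENNReal.ofReal t :=
    ⟨y.toReal, ENNReal.toReal_nonneg, (ENNReal.ofReal_toReal hy).symm⟩
  have hx : x ≤ ENNReal.ofReal (b * z) := by
    refine hxy.trans ?_
    rw [ENNReal.ofReal_mul (by linarith)]
    gcongr
    rw [← ENNReal.ofReal_coe_nnreal]
    exact ENNReal.ofReal_le_ofReal (le_max_right _ _)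
  refine (H _ _ hx).trans ?_
  rw [ENNReal.coe_mul, mul_assoc]
  gcongr
  change _ ≤ ENNReal.ofReal D * _
  rw [Phi_ofReal _ _ (by positivity), Phi_ofReal _ _ hz0, ← ENNReal.ofReal_mul hD0.le]
  exact ENNReal.ofReal_le_ofReal (Phi_real_dilate p l hb1 hz0)

theorem Phi_add_le {p l : ℝ} (h : Admissible p l) (a : ℝ≥0) :
    ∃ A : ℝ≥0, ∀ x y z : ℝ≥0∞, x ≤ a * (y + z) →
      Phi p l x ≤ A * (Phi p l y + Phi p l z) := by
  obtain ⟨A, H⟩ := Phi_le_of_le_mul h (a * 2)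
  refine ⟨A, fun x y z hx => ?_⟩
  rcases le_total y z with hyz | hyz
  · refine (H x z (hx.trans ?_)).trans (by gcongr; exact le_add_self)
    rw [ENNReal.coe_mul, mul_assoc]
    gcongr
    rw [ENNReal.coe_ofNat, two_mul]; gcongr
  · refine (H x y (hx.trans ?_)).trans (by gcongr; exact le_self_add)
    rw [ENNReal.coe_mul, mul_assoc]
    gcongr
    rw [ENNReal.coe_ofNat, two_mul]; gcongr

/-- Jensen's inequality for the quasi-convex function `Φ`.  With `s` half the mean value `∫ g`, the
almost monotonicity of `Φ(t) / t` gives the tangent inequality `g Φ(s) ≤ s Φ(s) + A s Φ(g)`, whose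
integral is the claim up to the `Δ₂` condition. -/
theorem Phi_lintegral_le {p l : ℝ} (h : Admissible p l) :
    ∃ A : ℝ≥0, ∀ {α : Type} [MeasurableSpace α] (P : Measure α) [IsProbabilityMeasure P]
      (g : α → ℝ≥0∞), Phi p l (∫⁻ x, g x ∂P) ≤ A * ∫⁻ x, Phi p l (g x) ∂P := by
  obtain ⟨A, hA, H⟩ := Phi_ratio h
  obtain ⟨B, HB⟩ := Phi_le_of_le_mul h 2
  obtain ⟨D, hD, HD⟩ := le_Phi h
  refine ⟨B * A + 1, fun {α} _ P _ g => ?_⟩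
  set J := ∫⁻ x, Phi p l (g x) ∂P with hJ
  by_cases hJt : J = ⊤
  · rw [hJt, ENNReal.mul_top (by simp)]; exact le_top
  have htan : ∀ s y : ℝ≥0∞, y * Phi p l s ≤ s * Phi p l s + (A * s) * Phi p l y := by
    intro s y
    rcases le_total y s with hys | hys
    · exact le_add_right (by gcongr)
    · exact le_add_left ((H s y hys).trans_eq (by ring))
  set t := ∫⁻ x, g x ∂P with ht
  have htt : t ≠ ⊤ := by
    have h1 : ∀ x, g x ≤ 1 + (D + 1) * Phi p l (g x) := by
      intro x
      by_cases hx : g x = ⊤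
      · rw [hx, Phi_top, ENNReal.mul_top (by simp)]; simp
      · exact (HD _ hx).trans (by gcongr; exact le_self_add)
    refine ne_top_of_le_ne_top ?_ (lintegral_mono h1)
    rw [lintegral_add_left measurable_const, lintegral_const_mul' _ _ (by simp [hD])]
    refine ENNReal.add_ne_top.2 ⟨by simp, ENNReal.mul_ne_top (by simp [hD]) hJt⟩
  by_cases ht0 : t = 0
  · simp [ht0, Phi_zero h.one_le]
  set s := t / 2 with hs
  have hst : s ≠ ⊤ := ENNReal.div_ne_top htt (by norm_num)
  have hs0 : s ≠ 0 := by simp [hs, ht0]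
  have hPs : Phi p l s ≠ ⊤ := by simp [Phi, hst]
  have h2s : t = s + s := (ENNReal.add_halves t).symm
  have h3 : t * Phi p l s ≤ s * Phi p l s + (A * s) * J := by
    rw [ht, hJ, ← lintegral_mul_const' _ _ hPs,
      ← lintegral_const_mul' _ _ (ENNReal.mul_ne_top ENNReal.coe_ne_top hst)]
    refine (lintegral_mono fun x => htan s (g x)).trans ?_
    rw [lintegral_add_left measurable_const]
    simp
  have h4 : s * Phi p l s ≤ s * (A * J) := by
    rw [h2s, add_mul] at h3
    refine (ENNReal.add_le_add_iff_left (ENNReal.mul_ne_top hst hPs)).1 (h3.trans_eq ?_)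
    ring
  have h5 : Phi p l s ≤ A * J := (ENNReal.mul_le_mul_iff_right hs0 hst).1 h4
  calc Phi p l t ≤ B * Phi p l s := HB t s (by rw [h2s]; simp [two_mul])
    _ ≤ B * (A * J) := by gcongr
    _ ≤ _ := by
      rw [← mul_assoc]
      gcongr
      push_cast
      exact le_self_add

/-- Dividing by a large constant makes `Φ` as small a multiple as desired. -/
theorem exists_mul_Phi_div_le {p : ℝ} (hp : 1 ≤ p) (l : ℝ) (A : ℝ≥0) :
    ∃ M : ℝ≥0, 0 < M ∧ ∀ (k : ℝ) (x : ℝ≥0∞), 0 < k →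
      A * Phi p l (x / ENNReal.ofReal (M * k)) ≤ Phi p l (x / ENNReal.ofReal k) := by
  obtain ⟨r, hr, H⟩ := Phi_small hp l
  obtain ⟨n, hn⟩ := pow_unbounded_of_one_lt A (one_lt_two : (1 : ℝ≥0) < 2)
  have key : ∀ (n : ℕ) (y : ℝ≥0∞),
      2 ^ n * Phi p l (ENNReal.ofReal r ^ n * y) ≤ Phi p l y := by
    intro n
    induction n with
    | zero => intro y; simp
    | succ n ih =>
      intro y
      have h1 := H (ENNReal.ofReal r ^ (n + 1) * y) (ENNReal.ofReal r ^ n * y)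
        (by rw [pow_succ', mul_assoc])
      calc (2 : ℝ≥0∞) ^ (n + 1) * Phi p l (ENNReal.ofReal r ^ (n + 1) * y)
          ≤ 2 ^ (n + 1) * (2⁻¹ * Phi p l (ENNReal.ofReal r ^ n * y)) := by gcongr
        _ = 2 ^ n * (2 * 2⁻¹) * Phi p l (ENNReal.ofReal r ^ n * y) := by ring
        _ = 2 ^ n * Phi p l (ENNReal.ofReal r ^ n * y) := by
            rw [ENNReal.mul_inv_cancel (by simp) (by simp), mul_one]
        _ ≤ _ := ih y
  refine ⟨(r.toNNReal ^ n)⁻¹, by simp [hr], fun k x hk => ?_⟩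
  have e : x / ENNReal.ofReal (((r.toNNReal ^ n)⁻¹ : ℝ≥0) * k) =
      ENNReal.ofReal r ^ n * (x / ENNReal.ofReal k) := by
    push_cast
    rw [Real.coe_toNNReal _ hr.le, ENNReal.ofReal_mul (by positivity),
      ENNReal.ofReal_inv_of_pos (by positivity), ENNReal.ofReal_pow hr.le, div_eq_mul_inv,
      ENNReal.mul_inv (Or.inr (by simp)) (Or.inr (by simpa using hk)), inv_inv, div_eq_mul_inv]
    ring
  rw [e]
  refine le_trans ?_ (key n _)
  gcongr
  exact_mod_cast hn.le

theorem luxemburg_le_of_lintegral_le {p : ℝ} (hp : 1 ≤ p) (l : ℝ) (A : ℝ≥0) :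
    ∃ M : ℝ≥0, ∀ {α : Type} [MeasurableSpace α] (μ : Measure α) (g : α → ℝ≥0∞) (k : ℝ), 0 < k →
      ∫⁻ x, Phi p l (g x / ENNReal.ofReal k) ∂μ ≤ A →
      luxemburg p l μ g ≤ M * ENNReal.ofReal k := by
  obtain ⟨M, hM, H⟩ := exists_mul_Phi_div_le hp l (A + 1)
  refine ⟨M, fun {α} _ μ g k hk hA => ?_⟩
  have hMk : 0 < (M : ℝ) * k := by positivity
  have h1 : ∫⁻ x, Phi p l (g x / ENNReal.ofReal (M * k)) ∂μ ≤ 1 := by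
    have h2 : ((A + 1 : ℝ≥0) : ℝ≥0∞) * ∫⁻ x, Phi p l (g x / ENNReal.ofReal (M * k)) ∂μ ≤
        ((A + 1 : ℝ≥0) : ℝ≥0∞) * 1 := by
      rw [← lintegral_const_mul' _ _ ENNReal.coe_ne_top]
      refine (lintegral_mono fun x => H k (g x) hk).trans (hA.trans ?_)
      rw [mul_one]; exact_mod_cast le_self_add
    exact (ENNReal.mul_le_mul_iff_right (by simp) ENNReal.coe_ne_top).1 h2
  calc luxemburg p l μ g ≤ ENNReal.ofReal (M * k) := iInf_le_of_le _ (iInf₂_le hMk h1)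
    _ = _ := by rw [ENNReal.ofReal_mul M.coe_nonneg]; simp

theorem besovSeminorm_le_of_dyadicEnergy_le {K : ℕ} {p : ℝ} (hp : 1 ≤ p) (l : ℝ) (A : ℝ≥0) :
    ∃ M : ℝ≥0, ∀ (ε θ l₂ : ℝ) (ν : Measure (Boundary K)) (f : Boundary K → ℝ) (k : ℝ), 0 < k →
      dyadicEnergy ε θ p l l₂ ν (fun ξ => f ξ / k) ≤ A →
      besovSeminorm ε θ p l l₂ ν f ≤ M * ENNReal.ofReal k := by
  obtain ⟨M, hM, H⟩ := exists_mul_Phi_div_le hp l (A + 1)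
  refine ⟨M, fun ε θ l₂ ν f k hk hA => ?_⟩
  have hMk : 0 < (M : ℝ) * k := by positivity
  have h1 : dyadicEnergy ε θ p l l₂ ν (fun ξ => f ξ / (M * k)) ≤ 1 := by
    have h2 : ((A + 1 : ℝ≥0) : ℝ≥0∞) * dyadicEnergy ε θ p l l₂ ν (fun ξ => f ξ / (M * k)) ≤
        ((A + 1 : ℝ≥0) : ℝ≥0∞) * 1 := by
      refine le_trans ?_ (hA.trans (by rw [mul_one]; exact_mod_cast le_self_add))
      simp only [dyadicEnergy]
      rw [← ENNReal.tsum_mul_left]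
      refine ENNReal.tsum_le_tsum fun n => ?_
      rw [mul_left_comm, Finset.mul_sum]
      refine mul_le_mul_right (Finset.sum_le_sum fun w _ => ?_) _
      rw [mul_left_comm, oscillation_div _ _ _ _ _ hMk, oscillation_div _ _ _ _ _ hk]
      gcongr
      exact H _ _ hk
    exact (ENNReal.mul_le_mul_iff_right (by simp) ENNReal.coe_ne_top).1 h2
  calc besovSeminorm ε θ p l l₂ ν f ≤ ENNReal.ofReal (M * k) := iInf_le_of_le _ (iInf₂_le hMk h1)
    _ = _ := by rw [ENNReal.ofReal_mul M.coe_nonneg]; simp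

/-! ### A discrete Hardy inequality -/

theorem Phi_tsum_le {p l : ℝ} (h : Admissible p l) :
    ∃ A : ℝ≥0, ∀ P g : ℕ → ℝ≥0∞, ∑' j, P j = 1 →
      Phi p l (∑' j, P j * g j) ≤ A * ∑' j, P j * Phi p l (g j) := by
  obtain ⟨A, H⟩ := Phi_lintegral_le h
  refine ⟨A, fun P g hP => ?_⟩
  have hm : ∀ f : ℕ → ℝ≥0∞, ∫⁻ j, f j ∂(Measure.count.withDensity P) = ∑' j, P j * f j := by
    intro f
    rw [lintegral_withDensity_eq_lintegral_mul _ (measurable_of_countable P)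
      (measurable_of_countable f), lintegral_count]
    rfl
  have : IsProbabilityMeasure (Measure.count.withDensity P) := by
    refine ⟨?_⟩
    rw [← lintegral_one, hm]
    simpa using hP
  have h1 := H (Measure.count.withDensity P) g
  rwa [hm, hm] at h1

/-- The weight `e^{-b(n+1)} (n+1)^l` of the edges that join level `n` to level `n + 1`. -/
noncomputable def levelWeight (b l : ℝ) (n : ℕ) : ℝ≥0∞ :=
  ENNReal.ofReal (Real.exp (-b * ((n + 1 : ℕ) : ℝ)) * ((n + 1 : ℕ) : ℝ) ^ l)

theorem levelWeight_ne_top (b l : ℝ) (n : ℕ) : levelWeight b l n ≠ ⊤ := ENNReal.ofReal_ne_top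

theorem levelWeight_ne_zero (b l : ℝ) (n : ℕ) : levelWeight b l n ≠ 0 := by
  have : 0 < Real.exp (-b * ((n + 1 : ℕ) : ℝ)) * ((n + 1 : ℕ) : ℝ) ^ l := by positivity
  simpa [levelWeight] using this

theorem rpow_le_mul_rpow_of_le {x y c l : ℝ} (hx : 0 < x) (hy : 0 < y) (h1 : x ≤ c * y)
    (h2 : y ≤ c * x) : x ^ l ≤ c ^ |l| * y ^ l := by
  have hc : 0 < c := by
    by_contra hc
    nlinarith [mul_nonpos_of_nonpos_of_nonneg (not_lt.1 hc) hy.le]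
  rcases le_total 0 l with h | h
  · rw [abs_of_nonneg h, ← Real.mul_rpow hc.le hy.le]
    exact Real.rpow_le_rpow hx.le h1 h
  · rw [abs_of_nonpos h, Real.rpow_neg hc.le, ← Real.inv_rpow hc.le,
      ← Real.mul_rpow (by positivity) hy.le]
    refine Real.rpow_le_rpow_of_nonpos (by positivity) ?_ h
    rwa [inv_mul_le_iff₀ hc]

theorem levelWeight_le (b l : ℝ) (n j : ℕ) : levelWeight b l n ≤
    ENNReal.ofReal (Real.exp (b * j) * (1 + j) ^ |l|) * levelWeight b l (n + j) := by
  rw [levelWeight, levelWeight, ← ENNReal.ofReal_mul (by positivity)]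
  refine ENNReal.ofReal_le_ofReal ?_
  have h1 : ((n + 1 : ℕ) : ℝ) ^ l ≤ (1 + j : ℝ) ^ |l| * ((n + j + 1 : ℕ) : ℝ) ^ l := by
    refine rpow_le_mul_rpow_of_le (by positivity) (by positivity) ?_ ?_ <;> push_cast <;>
      nlinarith [Nat.cast_nonneg (α := ℝ) n, Nat.cast_nonneg (α := ℝ) j,
        mul_nonneg (Nat.cast_nonneg (α := ℝ) n) (Nat.cast_nonneg (α := ℝ) j)]
  have h2 : Real.exp (-b * ((n + 1 : ℕ) : ℝ)) =
      Real.exp (b * j) * Real.exp (-b * ((n + j + 1 : ℕ) : ℝ)) := by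
    rw [← Real.exp_add]; push_cast; ring_nf
  rw [h2]
  calc _ ≤ Real.exp (b * j) * Real.exp (-b * ((n + j + 1 : ℕ) : ℝ)) *
        ((1 + j : ℝ) ^ |l| * ((n + j + 1 : ℕ) : ℝ) ^ l) := by gcongr
    _ = _ := by ring

theorem tsum_exp_neg_ne_top {c : ℝ} (hc : 0 < c) :
    ∑' j : ℕ, ENNReal.ofReal (Real.exp (-c * j)) ≠ ⊤ := by
  have h : Summable fun j : ℕ => Real.exp (-c * j) := by
    simpa [mul_comm] using Real.summable_exp_nat_mul_iff.2 (neg_lt_zero.2 hc)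
  exact h.tsum_ofReal_ne_top

theorem tsum_levelWeight_ne_top {b : ℝ} (l : ℝ) (hb : 0 < b) : ∑' n, levelWeight b l n ≠ ⊤ := by
  obtain ⟨A, hA, H⟩ := exp_neg_mul_rpow_bounded (c := b / 2) (by linarith) (abs_nonneg l)
  refine ne_top_of_le_ne_top ?_ (ENNReal.tsum_le_tsum (g := fun n : ℕ =>
    ENNReal.ofReal A * ENNReal.ofReal (Real.exp (-(b / 2) * n))) fun n => ?_)
  · rw [ENNReal.tsum_mul_left]
    exact ENNReal.mul_ne_top ENNReal.ofReal_ne_top (tsum_exp_neg_ne_top (by linarith))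
  · rw [levelWeight, ← ENNReal.ofReal_mul (by linarith)]
    refine ENNReal.ofReal_le_ofReal ?_
    have h1 := H n (Nat.cast_nonneg n)
    have h2 : ((n + 1 : ℕ) : ℝ) ^ l ≤ (1 + n : ℝ) ^ |l| := by
      push_cast
      rw [add_comm]
      exact Real.rpow_le_rpow_of_exponent_le (by linarith [Nat.cast_nonneg (α := ℝ) n])
        (le_abs_self l)
    have h3 : Real.exp (-b * ((n + 1 : ℕ) : ℝ)) ≤
        Real.exp (-(b / 2) * n) * Real.exp (-(b / 2) * n) := by
      rw [← Real.exp_add]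
      refine Real.exp_le_exp.2 ?_
      push_cast; linarith
    calc _ ≤ (Real.exp (-(b / 2) * n) * Real.exp (-(b / 2) * n)) * (1 + n : ℝ) ^ |l| := by gcongr
      _ = (Real.exp (-(b / 2) * n) * (1 + n : ℝ) ^ |l|) * Real.exp (-(b / 2) * n) := by ring
      _ ≤ _ := by gcongr

/-- The Hardy inequality behind the trace theorem.  The factor `e^{-εj}` is split as
`e^{-(ε-σ)j} e^{-σj}` with `b / p < σ < ε`: the first factor makes the sum over `j` an average,
to which Jensen's inequality applies, and `Φ(e^{-σj} G)` gains `e^{-pσj}`, which beats the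
growth `e^{bj}` of the weights. -/
theorem tsum_levelWeight_mul_Phi_tsum_le {ε b p l₁ : ℝ} (l₂ : ℝ) (hb : 0 < b)
    (hbp : b < ε * p) (h : Admissible p l₁) :
    ∃ A : ℝ≥0, ∀ G : ℕ → ℝ≥0∞,
      ∑' n, levelWeight b l₂ n *
          Phi p l₁ (∑' j : ℕ, ENNReal.ofReal (Real.exp (-ε * j)) * G (n + j)) ≤
        A * ∑' n, levelWeight b l₂ n * Phi p l₁ (G n) := by
  have hp : 0 < p := by linarith [h.one_le]
  obtain ⟨σ, hσ1, hσ2⟩ := exists_between ((div_lt_iff₀ hp).2 hbp)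
  have hσ : 0 < σ := (by positivity : 0 < b / p).trans hσ1
  rw [div_lt_iff₀ hp] at hσ1
  set δ := ε - σ with hδdef
  have hδ : 0 < δ := by linarith
  set τ := (p * σ - b) / 2 with hτdef
  have hτ : 0 < τ := by nlinarith
  set Z := ∑' j : ℕ, ENNReal.ofReal (Real.exp (-δ * j)) with hZ
  have hZt : Z ≠ ⊤ := tsum_exp_neg_ne_top hδ
  have hZ1 : 1 ≤ Z := by
    refine le_trans ?_ (ENNReal.le_tsum 0)
    simp
  have hZ0 : Z ≠ 0 := fun h0 => by simp [h0] at hZ1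
  obtain ⟨A₁, H₁⟩ := Phi_le_of_le_mul h Z.toNNReal
  obtain ⟨A₂, H₂⟩ := Phi_tsum_le h
  obtain ⟨B₁, hB₁, K₁⟩ := exp_neg_mul_rpow_bounded (c := δ / σ) (by positivity) (abs_nonneg l₁)
  obtain ⟨B₂, hB₂, K₂⟩ := exp_neg_mul_rpow_bounded (c := τ) hτ (abs_nonneg l₂)
  set Y := ∑' j : ℕ, ENNReal.ofReal (Real.exp (-τ * j)) with hY
  have hYt : Y ≠ ⊤ := tsum_exp_neg_ne_top hτ
  set D : ℝ≥0∞ := A₁ * A₂ * ENNReal.ofReal (B₁ * B₂) with hD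
  have hDt : D * Y ≠ ⊤ := ENNReal.mul_ne_top
    (ENNReal.mul_ne_top (ENNReal.mul_ne_top ENNReal.coe_ne_top ENNReal.coe_ne_top)
      ENNReal.ofReal_ne_top) hYt
  refine ⟨(D * Y).toNNReal, fun G => ?_⟩
  rw [ENNReal.coe_toNNReal hDt]
  have hterm : ∀ n : ℕ,
      Phi p l₁ (∑' j : ℕ, ENNReal.ofReal (Real.exp (-ε * j)) * G (n + j)) ≤
        A₁ * A₂ * ∑' j : ℕ, ENNReal.ofReal (B₁ * Real.exp (-p * (σ * j))) * Phi p l₁ (G (n + j)) := by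
    intro n
    set P : ℕ → ℝ≥0∞ := fun j => Z⁻¹ * ENNReal.ofReal (Real.exp (-δ * j)) with hP
    have hP1 : ∑' j, P j = 1 := by
      rw [hP, ENNReal.tsum_mul_left, ENNReal.inv_mul_cancel hZ0 hZt]
    have e1 : ∑' j : ℕ, ENNReal.ofReal (Real.exp (-ε * j)) * G (n + j) =
        Z * ∑' j, P j * (ENNReal.ofReal (Real.exp (-(σ * j))) * G (n + j)) := by
      rw [← ENNReal.tsum_mul_left]
      refine tsum_congr fun j => ?_
      have : ENNReal.ofReal (Real.exp (-ε * j)) =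
          ENNReal.ofReal (Real.exp (-δ * j)) * ENNReal.ofReal (Real.exp (-(σ * j))) := by
        rw [← ENNReal.ofReal_mul (Real.exp_pos _).le, ← Real.exp_add, hδdef]; ring_nf
      rw [this]
      calc _ = (Z * Z⁻¹) * (ENNReal.ofReal (Real.exp (-δ * j)) *
            ENNReal.ofReal (Real.exp (-(σ * j))) * G (n + j)) := by
              rw [ENNReal.mul_inv_cancel hZ0 hZt, one_mul]
        _ = _ := by rw [hP]; ring
    have e2 := H₁ _ (∑' j, P j * (ENNReal.ofReal (Real.exp (-(σ * j))) * G (n + j)))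
      (by rw [ENNReal.coe_toNNReal hZt])
    rw [e1]
    refine e2.trans ?_
    rw [mul_assoc]
    gcongr
    refine (H₂ P _ hP1).trans ?_
    refine mul_le_mul_right (ENNReal.tsum_le_tsum fun j => ?_) _
    calc P j * Phi p l₁ (ENNReal.ofReal (Real.exp (-(σ * j))) * G (n + j))
        ≤ ENNReal.ofReal (Real.exp (-δ * j)) *
          (ENNReal.ofReal (Real.exp (-p * (σ * j)) * (1 + σ * j) ^ |l₁|) *
            Phi p l₁ (G (n + j))) := by
          gcongr
          · exact mul_le_of_le_one_left' (ENNReal.inv_le_one.2 hZ1)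
          · exact Phi_contract p l₁ (by positivity) _
      _ ≤ _ := by
          rw [← mul_assoc, ← ENNReal.ofReal_mul (Real.exp_pos _).le]
          refine mul_le_mul_left (ENNReal.ofReal_le_ofReal ?_) _
          have h3 := K₁ (σ * j) (by positivity)
          have h4 : -(δ / σ) * (σ * j) = -δ * j := by field_simp
          rw [h4] at h3
          calc _ = (Real.exp (-δ * j) * (1 + σ * j) ^ |l₁|) * Real.exp (-p * (σ * j)) := by ring
            _ ≤ _ := by gcongr
  have hW : ∀ n j : ℕ, levelWeight b l₂ n * ENNReal.ofReal (B₁ * Real.exp (-p * (σ * j))) ≤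
      ENNReal.ofReal (B₁ * B₂) * ENNReal.ofReal (Real.exp (-τ * j)) * levelWeight b l₂ (n + j) := by
    intro n j
    calc _ ≤ (ENNReal.ofReal (Real.exp (b * j) * (1 + j) ^ |l₂|) * levelWeight b l₂ (n + j)) *
          ENNReal.ofReal (B₁ * Real.exp (-p * (σ * j))) := by
          gcongr; exact levelWeight_le b l₂ n j
      _ = ENNReal.ofReal ((Real.exp (b * j) * (1 + j) ^ |l₂|) * (B₁ * Real.exp (-p * (σ * j)))) *
          levelWeight b l₂ (n + j) := by
          rw [ENNReal.ofReal_mul (p := Real.exp (b * j) * (1 + j) ^ |l₂|) (by positivity)]; ring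
      _ ≤ _ := by
          rw [← ENNReal.ofReal_mul (by positivity)]
          refine mul_le_mul_left (ENNReal.ofReal_le_ofReal ?_) _
          have h5 := K₂ j (Nat.cast_nonneg j)
          have h6 : Real.exp (b * j) * Real.exp (-p * (σ * j)) =
              Real.exp (-τ * j) * Real.exp (-τ * j) := by
            rw [← Real.exp_add, ← Real.exp_add, hτdef]; ring_nf
          calc _ = (Real.exp (b * j) * Real.exp (-p * (σ * j))) * (1 + j : ℝ) ^ |l₂| * B₁ := by ring
            _ = (Real.exp (-τ * j) * (1 + j : ℝ) ^ |l₂|) * (B₁ * Real.exp (-τ * j)) := by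
                rw [h6]; ring
            _ ≤ B₂ * (B₁ * Real.exp (-τ * j)) := by gcongr
            _ = _ := by ring
  calc ∑' n, levelWeight b l₂ n *
          Phi p l₁ (∑' j : ℕ, ENNReal.ofReal (Real.exp (-ε * j)) * G (n + j))
      ≤ ∑' n, ∑' j : ℕ, D * (ENNReal.ofReal (Real.exp (-τ * j)) *
          (levelWeight b l₂ (n + j) * Phi p l₁ (G (n + j)))) := by
        refine ENNReal.tsum_le_tsum fun n => ?_
        calc _ ≤ levelWeight b l₂ n * (A₁ * A₂ * ∑' j : ℕ,
              ENNReal.ofReal (B₁ * Real.exp (-p * (σ * j))) * Phi p l₁ (G (n + j))) := by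
              gcongr; exact hterm n
          _ = ∑' j : ℕ, A₁ * A₂ * ((levelWeight b l₂ n *
              ENNReal.ofReal (B₁ * Real.exp (-p * (σ * j)))) * Phi p l₁ (G (n + j))) := by
              rw [← ENNReal.tsum_mul_left, ← ENNReal.tsum_mul_left]
              exact tsum_congr fun j => by ring
          _ ≤ _ := by
              refine ENNReal.tsum_le_tsum fun j => ?_
              calc _ ≤ A₁ * A₂ * ((ENNReal.ofReal (B₁ * B₂) * ENNReal.ofReal (Real.exp (-τ * j)) *
                    levelWeight b l₂ (n + j)) * Phi p l₁ (G (n + j))) := by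
                    exact mul_le_mul_right (mul_le_mul_left (hW n j) _) _
                _ = _ := by rw [hD]; ring
    _ = D * ∑' j : ℕ, ENNReal.ofReal (Real.exp (-τ * j)) *
          ∑' n, levelWeight b l₂ (n + j) * Phi p l₁ (G (n + j)) := by
        rw [ENNReal.tsum_comm, ← ENNReal.tsum_mul_left]
        refine tsum_congr fun j => ?_
        rw [ENNReal.tsum_mul_left, ENNReal.tsum_mul_left]
    _ ≤ D * ∑' j : ℕ, ENNReal.ofReal (Real.exp (-τ * j)) *
          ∑' n, levelWeight b l₂ n * Phi p l₁ (G n) := by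
        refine mul_le_mul_right (ENNReal.tsum_le_tsum fun j => mul_le_mul_right ?_ _) _
        exact ENNReal.tsum_comp_le_tsum_of_injective (add_left_injective j)
          (fun n => levelWeight b l₂ n * Phi p l₁ (G n))
    _ = _ := by rw [ENNReal.tsum_mul_right, ← hY, ← mul_assoc D]

/-! ### Prefixes, cylinders and averages on the boundary -/

section
variable {K : ℕ}

/-- The word of length `n` of the vertex through which the geodesic `[0, ξ)` passes at level `n`. -/
def prefixWord (ξ : Boundary K) (n : ℕ) : List (Fin K) := (List.range n).map ξ

@[simp] theorem length_prefixWord (ξ : Boundary K) (n : ℕ) : (prefixWord ξ n).length = n := by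
  simp [prefixWord]

theorem prefixWord_succ (ξ : Boundary K) (n : ℕ) :
    prefixWord ξ (n + 1) = prefixWord ξ n ++ [ξ n] := by
  simp [prefixWord, List.range_succ]

@[simp] theorem dropLast_prefixWord_succ (ξ : Boundary K) (n : ℕ) :
    (prefixWord ξ (n + 1)).dropLast = prefixWord ξ n := by
  simp [prefixWord_succ]

theorem take_prefixWord (ξ : Boundary K) {m n : ℕ} (h : m ≤ n) :
    (prefixWord ξ n).take m = prefixWord ξ m := by
  rw [prefixWord, ← List.map_take, List.take_range, min_eq_left h, prefixWord]

theorem prefixWord_eq_ofFn (ξ : Boundary K) (n : ℕ) :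
    prefixWord ξ n = List.ofFn fun i : Fin n => ξ i := by
  refine List.ext_getElem (by simp) fun i h1 h2 => ?_
  simp [prefixWord]

theorem mem_cylinder {ξ : Boundary K} {w : List (Fin K)} :
    ξ ∈ cylinder w ↔ prefixWord ξ w.length = w := Iff.rfl

theorem mem_cylinder_prefixWord_iff {ξ ζ : Boundary K} {n : ℕ} :
    ζ ∈ cylinder (prefixWord ξ n) ↔ prefixWord ζ n = prefixWord ξ n := by
  simp [mem_cylinder]

theorem mem_cylinder_ofFn {ξ : Boundary K} {n : ℕ} (w : Fin n → Fin K) :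
    ξ ∈ cylinder (List.ofFn w) ↔ (fun i : Fin n => ξ i) = w := by
  rw [mem_cylinder, List.length_ofFn, prefixWord_eq_ofFn, List.ofFn_inj]

theorem measurable_comp_prefixWord {γ : Type*} [MeasurableSpace γ] (h : List (Fin K) → γ) (n : ℕ) :
    Measurable fun ξ : Boundary K => h (prefixWord ξ n) := by
  have h1 : (fun ξ : Boundary K => h (prefixWord ξ n)) =
      (fun w : Fin n → Fin K => h (List.ofFn w)) ∘ fun ξ i => ξ i := by
    ext ξ; simp [prefixWord_eq_ofFn]
  rw [h1]
  exact (measurable_of_finite _).comp (measurable_pi_lambda _ fun i => measurable_pi_apply _)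

theorem measurableSet_cylinder (w : List (Fin K)) : MeasurableSet (cylinder w) := by
  classical
  have h := measurable_comp_prefixWord (fun v => decide (v = w)) w.length
  have h2 : cylinder w = (fun ξ : Boundary K => decide (prefixWord ξ w.length = w)) ⁻¹' {true} := by
    ext ξ; simp [mem_cylinder]
  rw [h2]
  exact h (measurableSet_singleton _)

theorem lintegral_comp_prefixWord (ν : Measure (Boundary K)) (h : List (Fin K) → ℝ≥0∞) (n : ℕ) :
    ∫⁻ ξ, h (prefixWord ξ n) ∂ν =
      ∑ w : Fin n → Fin K, ν (cylinder (List.ofFn w)) * h (List.ofFn w) := by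
  have hm : Measurable fun (ξ : Boundary K) (i : Fin n) => ξ i :=
    measurable_pi_lambda _ fun i => measurable_pi_apply _
  calc ∫⁻ ξ, h (prefixWord ξ n) ∂ν
      = ∫⁻ ξ, (fun w : Fin n → Fin K => h (List.ofFn w)) (fun i => ξ i) ∂ν := by
        simp [prefixWord_eq_ofFn]
    _ = ∫⁻ w, h (List.ofFn w) ∂(ν.map fun (ξ : Boundary K) (i : Fin n) => ξ i) :=
        (lintegral_map (f := fun w : Fin n → Fin K => h (List.ofFn w))
          (measurable_of_finite _) hm).symm
    _ = _ := by
        rw [lintegral_fintype]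
        refine Finset.sum_congr rfl fun w _ => ?_
        rw [Measure.map_apply hm (measurableSet_singleton _), mul_comm]
        congr 2
        ext ξ
        rw [mem_cylinder_ofFn]; rfl

/-- The tower property of the averages over the cylinders of level `n`. -/
theorem lintegral_setLAverage_cylinder (ν : Measure (Boundary K)) [IsFiniteMeasure ν]
    (h : Boundary K → ℝ≥0∞) (n : ℕ) :
    ∫⁻ ξ, (⨍⁻ ζ in cylinder (prefixWord ξ n), h ζ ∂ν) ∂ν = ∫⁻ ξ, h ξ ∂ν := by
  rw [lintegral_comp_prefixWord ν (fun w => ⨍⁻ ζ in cylinder w, h ζ ∂ν) n]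
  simp only [measure_mul_setLAverage _ (measure_ne_top ν _)]
  have hU : (⋃ w : Fin n → Fin K, cylinder (List.ofFn w)) = Set.univ :=
    Set.eq_univ_of_forall fun ξ => Set.mem_iUnion.2 ⟨fun i => ξ i, (mem_cylinder_ofFn _).2 rfl⟩
  have hd : Pairwise (Function.onFun Disjoint fun w : Fin n → Fin K => cylinder (List.ofFn w)) := by
    intro v w hvw
    refine Set.disjoint_left.2 fun ξ h1 h2 => hvw ?_
    rw [← (mem_cylinder_ofFn v).1 h1, (mem_cylinder_ofFn w).1 h2]
  rw [← tsum_fintype (L := SummationFilter.unconditional _),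
    ← lintegral_iUnion (fun w => measurableSet_cylinder _) hd, hU,
    setLIntegral_univ]

theorem exists_mem_cylinder (hK : 0 < K) (w : List (Fin K)) : ∃ ξ : Boundary K, ξ ∈ cylinder w := by
  refine ⟨fun i => w.getD i ⟨0, hK⟩, ?_⟩
  rw [mem_cylinder]
  refine List.ext_getElem (by simp) fun i h1 h2 => ?_
  simp [prefixWord, h2]

theorem cylinder_eq_boundaryBall {ε : ℝ} (hε : 0 < ε) (ξ : Boundary K) (n : ℕ) :
    cylinder (prefixWord ξ (n + 1)) =
      {ζ | boundaryDist ε ξ ζ < 2 / ε * Real.exp (-ε * n)} := by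
  ext ζ
  rw [mem_cylinder_prefixWord_iff]
  by_cases h : ξ = ζ
  · subst h
    simp only [Set.mem_ofPred_eq, boundaryDist, if_true]
    refine iff_of_true trivial (by positivity)
  · simp only [Set.mem_ofPred_eq, boundaryDist, if_neg h]
    rw [mul_lt_mul_iff_right₀ (by positivity), Real.exp_lt_exp]
    have h1 : -ε * (PiNat.firstDiff (E := fun _ => Fin K) ξ ζ : ℕ) < -ε * n ↔
        n + 1 ≤ PiNat.firstDiff (E := fun _ => Fin K) ξ ζ := by
      rw [Nat.succ_le_iff, ← Nat.cast_lt (α := ℝ)]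
      constructor <;> intro h' <;> nlinarith
    rw [h1, prefixWord_eq_ofFn, prefixWord_eq_ofFn, List.ofFn_inj, funext_iff]
    constructor
    · intro h2
      by_contra! h3
      exact PiNat.apply_firstDiff_ne (E := fun _ => Fin K) h (h2 ⟨_, h3⟩).symm
    · intro h2 i
      exact (PiNat.apply_eq_of_lt_firstDiff (E := fun _ => Fin K) (i.2.trans_le h2)).symm

/-- Ahlfors regularity says that the cylinders of words of length `n ≥ 1` have measure
comparable to `K^{-n}`. -/
theorem IsAhlforsRegular.measure_cylinder (hK : 0 < K) {ε : ℝ} (hε : 0 < ε)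
    {ν : Measure (Boundary K)} (h : IsAhlforsRegular ε ν) :
    ∃ a A : ℝ, 0 < a ∧ 0 < A ∧ ∀ w : List (Fin K), w ≠ [] →
      ENNReal.ofReal (a * Real.exp (-Real.log K * w.length)) ≤ ν (cylinder w) ∧
        ν (cylinder w) ≤ ENNReal.ofReal (A * Real.exp (-Real.log K * w.length)) := by
  obtain ⟨c, hc, H⟩ := h
  -- a cylinder of level `n + 1` is a ball of radius `r = (2 / ε) e^{-εn}`, and
  -- `r ^ (log K / ε) = D e^{-(n + 1) log K}`
  set D := (2 / ε) ^ (Real.log K / ε) * Real.exp (Real.log K) with hD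
  have hD0 : 0 < D := by positivity
  refine ⟨c⁻¹ * D, c * D, by positivity, by positivity, fun w hw => ?_⟩
  obtain ⟨n, hn⟩ := Nat.exists_eq_succ_of_ne_zero (List.length_pos_iff.2 hw).ne'
  obtain ⟨ξ, hξ⟩ := exists_mem_cylinder hK w
  have hw' : w = prefixWord ξ (n + 1) := by rw [← Nat.succ_eq_add_one, ← hn]; exact hξ.symm
  set r := 2 / ε * Real.exp (-ε * n) with hr
  have hr0 : 0 < r := by positivity
  have hr1 : r ≤ 2 / ε := by
    have : Real.exp (-ε * n) ≤ 1 :=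
      Real.exp_le_one_iff.2 (by nlinarith [Nat.cast_nonneg (α := ℝ) n])
    calc r ≤ 2 / ε * 1 := by rw [hr]; gcongr
      _ = _ := mul_one _
  have hrQ : r ^ (Real.log K / ε) = D * Real.exp (-Real.log K * w.length) := by
    rw [hr, Real.mul_rpow (by positivity) (Real.exp_pos _).le, ← Real.exp_mul, hD,
      mul_assoc ((2 / ε) ^ (Real.log K / ε)), ← Real.exp_add, hn]
    congr 2
    push_cast
    field_simp
    ring
  have h1 := H ξ r hr0 hr1
  rw [← cylinder_eq_boundaryBall hε, ← hw', hrQ, ← mul_assoc c⁻¹,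
    ← mul_assoc c] at h1
  exact h1

end

/-! ### Integration over the tree along geodesic rays -/

section
variable {K : ℕ} {ε : ℝ}

theorem ray_eq_ancestor (ξ : Boundary K) {s : ℝ} {n : ℕ} (h : s ≤ n) :
    ray ε ξ s = ancestor (vertex ε (prefixWord ξ n)) s := by
  have h0 : max s 0 ≤ n := max_le h (Nat.cast_nonneg n)
  refine Tree.ext ?_ ?_
  · simp [ray, ancestor, vertex, h0]
  · have h1 : ⌈max s 0⌉₊ ≤ n := Nat.ceil_le.2 h0
    simp only [ray, ancestor, vertex, length_prefixWord, min_eq_left h0]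
    rw [take_prefixWord ξ h1, prefixWord]

theorem ray_natCast (ξ : Boundary K) (n : ℕ) : ray ε ξ n = vertex ε (prefixWord ξ n) := by
  refine Tree.ext ?_ ?_
  · simp [ray, vertex]
  · simp [ray, vertex, prefixWord]

theorem ancestor_ray (ξ : Boundary K) {r s : ℝ} (h : r ≤ s) :
    ancestor (ray ε ξ s) r = ray ε ξ r := by
  have h0 : max r 0 ≤ max s 0 := max_le_max_right 0 h
  refine Tree.ext ?_ ?_
  · simp [ray, ancestor, h0]
  · simp only [ray, ancestor, min_eq_left h0]
    exact take_prefixWord ξ (Nat.ceil_mono h0)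

theorem meet_ray (ξ : Boundary K) (s t : ℝ) :
    meet (ray ε ξ s) (ray ε ξ t) = min (max s 0) (max t 0) := by
  obtain ⟨n, hn⟩ := exists_nat_ge (max s t)
  rw [ray_eq_ancestor ξ ((le_max_left s t).trans hn),
    ray_eq_ancestor ξ ((le_max_right s t).trans hn), meet_ancestor,
    ← ray_eq_ancestor ξ ((le_max_left s t).trans hn),
    ← ray_eq_ancestor ξ ((le_max_right s t).trans hn)]
  rfl

/-- The integral of `h` over the edge that ends at the vertex labelled by the nonempty word `w`. -/
noncomputable def edgeIntegral (h : Tree K ε → ℝ≥0∞) (w : List (Fin K)) : ℝ≥0∞ :=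
  ∫⁻ s in Set.Ioc ((w.length : ℝ) - 1) w.length, h (ancestor (vertex ε w) s)

theorem edgeIntegral_append (h : Tree K ε → ℝ≥0∞) (v : List (Fin K)) (i : Fin K) :
    edgeIntegral h (v ++ [i]) = ∫⁻ s in Set.Ioc (v.length : ℝ) (v.length + 1),
      h (ancestor (vertex ε (v ++ [i])) s) := by
  simp [edgeIntegral]

theorem edgeIntegral_prefixWord (h : Tree K ε → ℝ≥0∞) (ξ : Boundary K) (n : ℕ) :
    edgeIntegral h (prefixWord ξ (n + 1)) =
      ∫⁻ s in Set.Ioc (n : ℝ) (n + 1), h (ray ε ξ s) := by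
  have e : ((n + 1 : ℕ) : ℝ) - 1 = n := by simp
  rw [edgeIntegral, length_prefixWord, e, Nat.cast_add_one]
  refine setLIntegral_congr_fun measurableSet_Ioc fun s hs => ?_
  rw [ray_eq_ancestor ξ (n := n + 1) (by exact_mod_cast hs.2)]

/-- The edges are labelled by the nonempty words, here sorted by length. -/
theorem tsum_edges (F : List (Fin K) → ℝ≥0∞) :
    ∑' e : List (Fin K) × Fin K, F (e.1 ++ [e.2]) =
      ∑' n : ℕ, ∑ w : Fin (n + 1) → Fin K, F (List.ofFn w) := by
  rw [ENNReal.tsum_prod', ← List.equivSigmaTuple.symm.tsum_eq, ENNReal.tsum_sigma']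
  refine tsum_congr fun n => ?_
  rw [← Fintype.sum_equiv (Fin.snocEquiv fun _ => Fin K)
    (fun x => F (List.ofFn x.2 ++ [x.1])) (fun w => F (List.ofFn w)), Fintype.sum_prod_type_right,
    tsum_fintype]
  · refine Finset.sum_congr rfl fun v _ => ?_
    rw [tsum_fintype]
    rfl
  · intro x
    rw [List.ofFn_succ']
    simp [Fin.snocEquiv]

/-- The density of `treeMeasure`. -/
noncomputable def treeDensity (β C l : ℝ) (s : ℝ) : ℝ≥0∞ :=
  ENNReal.ofReal (Real.exp (-β * s) * (s + C) ^ l)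

/-- On the edges between the levels `n` and `n + 1` the density of `treeMeasure` is comparable to
`levelWeight (β - κ) l n * e^{-κ(n+1)}`; with `κ = log K` the last factor is comparable to the
measure of a cylinder of level `n + 1`. -/
theorem treeDensity_comparable (β l : ℝ) {C : ℝ} (hC : 0 < C) (κ : ℝ) :
    ∃ A : ℝ, 0 < A ∧ ∀ (n : ℕ) (s : ℝ), s ∈ Set.Ioc (n : ℝ) (n + 1) →
      treeDensity β C l s ≤ ENNReal.ofReal A * (levelWeight (β - κ) l n *
        ENNReal.ofReal (Real.exp (-κ * ((n + 1 : ℕ) : ℝ)))) ∧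
      levelWeight (β - κ) l n * ENNReal.ofReal (Real.exp (-κ * ((n + 1 : ℕ) : ℝ))) ≤
        ENNReal.ofReal A * treeDensity β C l s := by
  -- a common bound for `(s + C) / (n + 1)` and `(n + 1) / (s + C)`
  set c := 1 + C + 2 / C + 2 with hc
  have h2C : 0 < 2 / C := by positivity
  refine ⟨Real.exp |β| * c ^ |l|, by positivity, fun n s hs => ?_⟩
  have hn := Nat.cast_nonneg (α := ℝ) n
  have hs0 : 0 < s + C := by linarith [hs.1]
  have hn0 : 0 < ((n + 1 : ℕ) : ℝ) := by positivity
  have h1 : s + C ≤ c * ((n + 1 : ℕ) : ℝ) := by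
    push_cast
    have := hs.2
    nlinarith
  have h2 : ((n + 1 : ℕ) : ℝ) ≤ c * (s + C) := by
    push_cast
    have h3 : (1 + 2 / C) * (s + C) = s + C + 2 / C * s + 2 := by
      field_simp
      ring
    have h5 : 0 ≤ (C + 2) * (s + C) := by positivity
    have h6 : c * (s + C) = (1 + 2 / C) * (s + C) + (C + 2) * (s + C) := by rw [hc]; ring
    have h7 : (n : ℝ) < s := hs.1
    nlinarith
  have hW : levelWeight (β - κ) l n * ENNReal.ofReal (Real.exp (-κ * ((n + 1 : ℕ) : ℝ))) =
      ENNReal.ofReal (Real.exp (-β * ((n + 1 : ℕ) : ℝ)) * ((n + 1 : ℕ) : ℝ) ^ l) := by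
    rw [levelWeight, ← ENNReal.ofReal_mul (by positivity)]
    congr 1
    have : Real.exp (-β * ((n + 1 : ℕ) : ℝ)) = Real.exp (-(β - κ) * ((n + 1 : ℕ) : ℝ)) *
        Real.exp (-κ * ((n + 1 : ℕ) : ℝ)) := by
      rw [← Real.exp_add]; ring_nf
    rw [this]; ring
  have hβ1 : β * (((n + 1 : ℕ) : ℝ) - s) ≤ |β| := by
    push_cast
    have h3 : |((n : ℝ) + 1) - s| ≤ 1 := abs_le.2 ⟨by linarith [hs.2], by linarith [hs.1]⟩
    calc _ ≤ |β * ((n : ℝ) + 1 - s)| := le_abs_self _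
      _ = |β| * |((n : ℝ) + 1) - s| := abs_mul _ _
      _ ≤ |β| * 1 := by gcongr
      _ = _ := mul_one _
  have hβ2 : -(β * (((n + 1 : ℕ) : ℝ) - s)) ≤ |β| := by
    push_cast
    have h3 : |((n : ℝ) + 1) - s| ≤ 1 := abs_le.2 ⟨by linarith [hs.2], by linarith [hs.1]⟩
    calc _ ≤ |β * ((n : ℝ) + 1 - s)| := neg_le_abs _
      _ = |β| * |((n : ℝ) + 1) - s| := abs_mul _ _
      _ ≤ |β| * 1 := by gcongr
      _ = _ := mul_one _
  have hE1 : Real.exp (-β * s) ≤ Real.exp |β| * Real.exp (-β * ((n + 1 : ℕ) : ℝ)) := by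
    rw [← Real.exp_add]; exact Real.exp_le_exp.2 (by linarith)
  have hE2 : Real.exp (-β * ((n + 1 : ℕ) : ℝ)) ≤ Real.exp |β| * Real.exp (-β * s) := by
    rw [← Real.exp_add]; exact Real.exp_le_exp.2 (by linarith)
  have hL1 := rpow_le_mul_rpow_of_le (l := l) hs0 hn0 h1 h2
  have hL2 := rpow_le_mul_rpow_of_le (l := l) hn0 hs0 h2 h1
  rw [hW, treeDensity, ← ENNReal.ofReal_mul (by positivity), ← ENNReal.ofReal_mul (by positivity)]
  constructor <;> refine ENNReal.ofReal_le_ofReal ?_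
  · calc _ ≤ (Real.exp |β| * Real.exp (-β * ((n + 1 : ℕ) : ℝ))) *
          (c ^ |l| * ((n + 1 : ℕ) : ℝ) ^ l) := by gcongr
      _ = _ := by ring
  · calc _ ≤ (Real.exp |β| * Real.exp (-β * s)) * (c ^ |l| * (s + C) ^ l) := by gcongr
      _ = _ := by ring

theorem radial_level (x : Tree K ε) : radial ε x.level = dist (vertex ε []) x := by
  have h : meet (vertex ε []) x = 0 := by
    simp [meet, vertex, commonPrefix, x.level_nonneg]
  rw [dist_eq_radial, h]
  simp [vertex, radial]

theorem measurable_level : Measurable (Tree.level : Tree K ε → ℝ) := by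
  refine measurable_of_Iio fun a => ?_
  have : Tree.level ⁻¹' Set.Iio a = {x : Tree K ε | dist (vertex ε []) x < radial ε a} := by
    ext x
    simp only [Set.mem_preimage, Set.mem_Iio, Set.mem_ofPred_eq]
    rw [← radial_level, (radial_strictMono ε).lt_iff_lt]
  rw [this]
  exact (isOpen_lt (by fun_prop) continuous_const).measurableSet

theorem treeMeasure_eq (β C l : ℝ) : treeMeasure K ε β C l =
    (lengthMeasure K ε).withDensity fun x => treeDensity β C l x.level := rfl

theorem measurable_treeDensity (β C l : ℝ) : Measurable (treeDensity β C l) := by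
  unfold treeDensity
  fun_prop

theorem lintegral_treeMeasure_eq (β C l : ℝ) (h : Tree K ε → ℝ≥0∞) :
    ∫⁻ x, h x ∂(treeMeasure K ε β C l) =
      ∑' e : List (Fin K) × Fin K, ∫⁻ x, treeDensity β C l x.level * h x
        ∂((volume.restrict (Set.Ioc (e.1.length : ℝ) (e.1.length + 1))).map
          (ancestor (vertex ε (e.1 ++ [e.2])))) := by
  rw [treeMeasure_eq, lintegral_withDensity_eq_lintegral_mul_non_measurable _
    (f := fun x : Tree K ε => treeDensity β C l x.level)
    ((measurable_treeDensity β C l).comp measurable_level)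
    (ae_of_all _ fun x => ENNReal.ofReal_lt_top), lengthMeasure, lintegral_sum_measure]
  rfl

theorem level_ancestor_vertex (w : List (Fin K)) {s : ℝ} (h0 : 0 ≤ s) (h1 : s ≤ w.length) :
    (ancestor (vertex ε w) s).level = s := by
  simp [ancestor, vertex, h0, h1]

theorem tsum_levelWeight_edgeIntegral (ν : Measure (Boundary K)) (b l : ℝ) (h : Tree K ε → ℝ≥0∞) :
    ∑' e : List (Fin K) × Fin K, levelWeight b l e.1.length * (ν (cylinder (e.1 ++ [e.2])) *
        edgeIntegral h (e.1 ++ [e.2])) =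
      ∑' n, levelWeight b l n * ∫⁻ ξ, edgeIntegral h (prefixWord ξ (n + 1)) ∂ν := by
  have := tsum_edges fun w : List (Fin K) => levelWeight b l (w.length - 1) *
    (ν (cylinder w) * edgeIntegral h w)
  simp only [List.length_append, List.length_singleton, Nat.add_sub_cancel, List.length_ofFn]
    at this
  rw [this]
  refine tsum_congr fun n => ?_
  rw [lintegral_comp_prefixWord ν (edgeIntegral h), Finset.mul_sum]

/-- The integral over the tree against `μ_l` is at most a constant multiple of the integral along
the rays `[0, ξ)`, averaged over `ξ`. -/
theorem lintegral_treeMeasure_le (hK : 0 < K) (hε : 0 < ε) (β l : ℝ) {C : ℝ} (hC : 0 < C)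
    {ν : Measure (Boundary K)} (hν : IsAhlforsRegular ε ν) :
    ∃ A : ℝ≥0, ∀ h : Tree K ε → ℝ≥0∞, ∫⁻ x, h x ∂(treeMeasure K ε β C l) ≤
      A * ∑' n, levelWeight (β - Real.log K) l n *
        ∫⁻ ξ, edgeIntegral h (prefixWord ξ (n + 1)) ∂ν := by
  obtain ⟨A, hA, H⟩ := treeDensity_comparable β l hC (Real.log K)
  obtain ⟨a, _, ha, _, Hν⟩ := hν.measure_cylinder hK hε
  refine ⟨(A * a⁻¹).toNNReal, fun h => ?_⟩
  rw [lintegral_treeMeasure_eq, ← tsum_levelWeight_edgeIntegral, ← ENNReal.tsum_mul_left]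
  refine ENNReal.tsum_le_tsum fun e => (lintegral_map_le _ _).trans ?_
  rw [edgeIntegral_append, ← mul_assoc, ← mul_assoc, mul_assoc (_ : ℝ≥0∞) (levelWeight _ _ _),
    ← lintegral_const_mul' _ _ (ENNReal.mul_ne_top ENNReal.coe_ne_top (ENNReal.mul_ne_top
      (levelWeight_ne_top _ _ _) (hν.isFiniteMeasure hε).measure_univ_lt_top.ne |> fun h' =>
        ne_top_of_le_ne_top h' (by gcongr; exact Set.subset_univ _)))]
  refine setLIntegral_mono' measurableSet_Ioc fun s hs => ?_
  have hs0 : 0 ≤ s := (Nat.cast_nonneg _).trans hs.1.le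
  rw [level_ancestor_vertex _ hs0 (by simpa using hs.2)]
  refine mul_le_mul_left ((H _ s hs).1.trans ?_) _
  have h1 := (Hν (e.1 ++ [e.2]) (by simp)).1
  rw [ENNReal.ofReal_mul ha.le] at h1
  simp only [List.length_append, List.length_singleton] at h1
  calc ENNReal.ofReal A * (levelWeight (β - Real.log K) l e.1.length *
        ENNReal.ofReal (Real.exp (-Real.log K * ((e.1.length + 1 : ℕ) : ℝ))))
      = (ENNReal.ofReal A * ENNReal.ofReal a⁻¹) * (levelWeight (β - Real.log K) l e.1.length *
        (ENNReal.ofReal a *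
          ENNReal.ofReal (Real.exp (-Real.log K * ((e.1.length + 1 : ℕ) : ℝ))))) := by
        have : ENNReal.ofReal a⁻¹ * ENNReal.ofReal a = 1 := by
          rw [← ENNReal.ofReal_mul (by positivity), inv_mul_cancel₀ ha.ne', ENNReal.ofReal_one]
        calc _ = ENNReal.ofReal A * (ENNReal.ofReal a⁻¹ * ENNReal.ofReal a) *
              (levelWeight (β - Real.log K) l e.1.length *
                ENNReal.ofReal (Real.exp (-Real.log K * ((e.1.length + 1 : ℕ) : ℝ)))) := by
              rw [this, mul_one]
          _ = _ := by ring
    _ ≤ (ENNReal.ofReal A * ENNReal.ofReal a⁻¹) * (levelWeight (β - Real.log K) l e.1.length *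
        ν (cylinder (e.1 ++ [e.2]))) := by gcongr
    _ = _ := by
        rw [← ENNReal.ofReal_mul hA.le]; rfl

/-- The converse of `lintegral_treeMeasure_le`. -/
theorem le_lintegral_treeMeasure (hK : 0 < K) (hε : 0 < ε) (β l : ℝ) {C : ℝ} (hC : 0 < C)
    {ν : Measure (Boundary K)} (hν : IsAhlforsRegular ε ν) :
    ∃ A : ℝ≥0, ∀ h : Tree K ε → ℝ≥0∞, AEMeasurable h (treeMeasure K ε β C l) →
      ∑' n, levelWeight (β - Real.log K) l n *
        ∫⁻ ξ, edgeIntegral h (prefixWord ξ (n + 1)) ∂ν ≤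
      A * ∫⁻ x, h x ∂(treeMeasure K ε β C l) := by
  obtain ⟨A, hA, H⟩ := treeDensity_comparable β l hC (Real.log K)
  obtain ⟨_, a, _, ha, Hν⟩ := hν.measure_cylinder hK hε
  refine ⟨(A * a).toNNReal, fun h hm => ?_⟩
  have hD : Measurable fun x : Tree K ε => treeDensity β C l x.level :=
    (measurable_treeDensity β C l).comp measurable_level
  have hm' : AEMeasurable (fun x => treeDensity β C l x.level * h x) (lengthMeasure K ε) := by
    have hD' : Measurable fun x : Tree K ε => (treeDensity β C l x.level).toNNReal :=
      hD.ennreal_toNNReal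
    have e : ∀ x : Tree K ε, ((treeDensity β C l x.level).toNNReal : ℝ≥0∞) =
        treeDensity β C l x.level := fun x => ENNReal.coe_toNNReal ENNReal.ofReal_ne_top
    have h1 := aemeasurable_withDensity_ennreal_iff (μ := lengthMeasure K ε) (g := h) hD'
    simp only [e] at h1
    exact h1.1 hm
  rw [lengthMeasure, aemeasurable_sum_measure_iff] at hm'
  rw [lintegral_treeMeasure_eq, ← tsum_levelWeight_edgeIntegral, ← ENNReal.tsum_mul_left]
  refine ENNReal.tsum_le_tsum fun e => ?_
  rw [lintegral_map' (hm' e) (ancestor_measurable _).aemeasurable, edgeIntegral_append, ← mul_assoc,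
    ← lintegral_const_mul' _ _ (ENNReal.mul_ne_top
      (levelWeight_ne_top _ _ _) (hν.isFiniteMeasure hε).measure_univ_lt_top.ne |> fun h' =>
        ne_top_of_le_ne_top h' (by gcongr; exact Set.subset_univ _)),
    ← lintegral_const_mul' _ _ ENNReal.coe_ne_top]
  refine setLIntegral_mono' measurableSet_Ioc fun s hs => ?_
  have hs0 : 0 ≤ s := (Nat.cast_nonneg _).trans hs.1.le
  rw [level_ancestor_vertex _ hs0 (by simpa using hs.2), ← mul_assoc]
  refine mul_le_mul_left ?_ _
  have h1 := (Hν (e.1 ++ [e.2]) (by simp)).2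
  rw [ENNReal.ofReal_mul ha.le] at h1
  simp only [List.length_append, List.length_singleton] at h1
  calc levelWeight (β - Real.log K) l e.1.length * ν (cylinder (e.1 ++ [e.2]))
      ≤ levelWeight (β - Real.log K) l e.1.length * (ENNReal.ofReal a *
          ENNReal.ofReal (Real.exp (-Real.log K * ((e.1.length + 1 : ℕ) : ℝ)))) := by gcongr
    _ = ENNReal.ofReal a * (levelWeight (β - Real.log K) l e.1.length *
          ENNReal.ofReal (Real.exp (-Real.log K * ((e.1.length + 1 : ℕ) : ℝ)))) := by ring
    _ ≤ ENNReal.ofReal a * (ENNReal.ofReal A * treeDensity β C l s) :=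
        mul_le_mul_right (H _ s hs).2 _
    _ = _ := by
        rw [← mul_assoc, ← ENNReal.ofReal_mul ha.le, mul_comm a]; rfl

end

/-! ### Jensen's inequality on edges and cylinders -/

section
variable {K : ℕ} {ε : ℝ}

theorem Phi_setLAverage_le {p l : ℝ} (h : Admissible p l) :
    ∃ A : ℝ≥0, ∀ (ν : Measure (Boundary K)) [IsFiniteMeasure ν] (s : Set (Boundary K))
      (g : Boundary K → ℝ≥0∞),
      Phi p l (⨍⁻ ζ in s, g ζ ∂ν) ≤ A * ⨍⁻ ζ in s, Phi p l (g ζ) ∂ν := by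
  obtain ⟨A, H⟩ := Phi_lintegral_le h
  refine ⟨A, fun ν _ s g => ?_⟩
  by_cases hs : ν.restrict s = 0
  · simp [hs, Phi_zero h.one_le]
  · have : NeZero (ν.restrict s) := ⟨hs⟩
    exact H _ g

/-- Averaging over the cylinders of a fixed level is bounded in `L^Φ(ν)`. -/
theorem lintegral_Phi_setLAverage_le {p l : ℝ} (h : Admissible p l) :
    ∃ A : ℝ≥0, ∀ (ν : Measure (Boundary K)) [IsFiniteMeasure ν] (n : ℕ) (g : Boundary K → ℝ≥0∞),
      ∫⁻ ξ, Phi p l (⨍⁻ ζ in cylinder (prefixWord ξ n), g ζ ∂ν) ∂ν ≤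
        A * ∫⁻ ξ, Phi p l (g ξ) ∂ν := by
  obtain ⟨A, H⟩ := Phi_setLAverage_le (K := K) h
  refine ⟨A, fun ν _ n g => ?_⟩
  rw [← lintegral_setLAverage_cylinder ν (fun ξ => Phi p l (g ξ)) n,
    ← lintegral_const_mul' _ _ ENNReal.coe_ne_top]
  exact lintegral_mono fun ξ => H ν _ g

theorem Phi_edgeIntegral_le {p l : ℝ} (h : Admissible p l) :
    ∃ A : ℝ≥0, ∀ (g : Tree K ε → ℝ≥0∞) (w : List (Fin K)),
      Phi p l (edgeIntegral g w) ≤ A * edgeIntegral (fun x => Phi p l (g x)) w := by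
  obtain ⟨A, H⟩ := Phi_lintegral_le h
  refine ⟨A, fun g w => ?_⟩
  have : IsProbabilityMeasure (volume.restrict (Set.Ioc ((w.length : ℝ) - 1) w.length)) :=
    ⟨by simp⟩
  exact H _ fun s => g (ancestor (vertex ε w) s)

theorem ofReal_abs_dyadicMean_sub_le (ν : Measure (Boundary K)) [IsFiniteMeasure ν]
    {F : Boundary K → ℝ} (hF : Integrable F ν) {w : List (Fin K)} (hw : ν (cylinder w) ≠ 0) (c : ℝ) :
    ENNReal.ofReal |dyadicMean ν F w - c| ≤ ⨍⁻ ζ in cylinder w, ENNReal.ofReal |F ζ - c| ∂ν := by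
  have h0 : NeZero (ν.restrict (cylinder w)) := ⟨by simpa using hw⟩
  have hi : Integrable F (((ν.restrict (cylinder w)) Set.univ)⁻¹ • ν.restrict (cylinder w)) :=
    hF.restrict.to_average
  have h1 : dyadicMean ν F w - c =
      ∫ ζ, (F ζ - c) ∂(((ν.restrict (cylinder w)) Set.univ)⁻¹ • ν.restrict (cylinder w)) := by
    rw [integral_sub hi (integrable_const c), integral_const, probReal_univ, one_smul]
    rfl
  rw [h1, ← Real.enorm_eq_ofReal_abs]
  refine (enorm_integral_le_lintegral_enorm _).trans_eq ?_
  simp only [Real.enorm_eq_ofReal_abs]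
  rfl

theorem setLAverage_div (ν : Measure (Boundary K)) (s : Set (Boundary K)) (g : Boundary K → ℝ≥0∞)
    {k : ℝ≥0∞} (hk : k ≠ 0) :
    ⨍⁻ ζ in s, g ζ / k ∂ν = (⨍⁻ ζ in s, g ζ ∂ν) / k := by
  simp only [div_eq_mul_inv, laverage]
  rw [lintegral_mul_const' _ _ (by simpa using hk)]

theorem edgeIntegral_div (g : Tree K ε → ℝ≥0∞) {k : ℝ≥0∞} (hk : k ≠ 0) (w : List (Fin K)) :
    edgeIntegral (fun x => g x / k) w = edgeIntegral g w / k := by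
  simp only [div_eq_mul_inv, edgeIntegral]
  rw [lintegral_mul_const' _ _ (by simpa using hk)]

end

/-! ### Upper gradients along geodesic rays -/

section
variable {K : ℕ} {ε : ℝ}

/-- The discretized tail `∑ⱼ e^{-εj} ∫ g` of the integral of `g` along the ray `[0, ξ)`, the `j`-th
integral being over the edge of the ray between the levels `n + j` and `n + j + 1`.  It is
normalized so that `e^{-εn} raySum g ξ n` bounds `∫ g ds_X` over the part of the ray beyond
level `n`. -/
noncomputable def raySum (g : Tree K ε → ℝ≥0∞) (ξ : Boundary K) (n : ℕ) : ℝ≥0∞ :=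
  ∑' j : ℕ, ENNReal.ofReal (Real.exp (-ε * j)) * edgeIntegral g (prefixWord ξ (n + j + 1))

theorem measurable_raySum (g : Tree K ε → ℝ≥0∞) (n : ℕ) : Measurable fun ξ => raySum g ξ n := by
  unfold raySum
  exact Measurable.tsum fun j => (measurable_comp_prefixWord (edgeIntegral g) _).const_mul _

theorem raySum_div (g : Tree K ε → ℝ≥0∞) {k : ℝ≥0∞} (hk : k ≠ 0) (ξ : Boundary K) (n : ℕ) :
    raySum (fun x => g x / k) ξ n = raySum g ξ n / k := by
  simp only [raySum, edgeIntegral_div g hk]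
  simp only [div_eq_mul_inv, ← mul_assoc, ENNReal.tsum_mul_right]

theorem exp_mul_raySum (g : Tree K ε → ℝ≥0∞) (ξ : Boundary K) (n : ℕ) :
    ENNReal.ofReal (Real.exp (-ε * n)) * raySum g ξ n =
      ∑' j : ℕ, ENNReal.ofReal (Real.exp (-ε * ((j + n : ℕ) : ℝ))) *
        edgeIntegral g (prefixWord ξ (j + n + 1)) := by
  rw [raySum, ← ENNReal.tsum_mul_left]
  refine tsum_congr fun j => ?_
  rw [← mul_assoc, ← ENNReal.ofReal_mul (Real.exp_pos _).le, ← Real.exp_add, add_comm j n]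
  push_cast
  ring_nf

theorem lintegral_ray_le (hε : 0 < ε) (g : Tree K ε → ℝ≥0∞) (ξ : Boundary K) (n : ℕ) :
    ∫⁻ r in Set.Ioi (n : ℝ), g (ray ε ξ r) * ENNReal.ofReal (Real.exp (-ε * r)) ≤
      ENNReal.ofReal (Real.exp (-ε * n)) * raySum g ξ n := by
  rw [exp_mul_raySum]
  have hsub : Set.Ioi (n : ℝ) ⊆ ⋃ j : ℕ, Set.Ioc ((j + n : ℕ) : ℝ) ((j + n : ℕ) + 1) := by
    intro r hr
    have hr' : (n : ℝ) < r := hr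
    have h0 : 0 < r := (Nat.cast_nonneg n).trans_lt hr'
    have h1 : n < ⌈r⌉₊ := Nat.lt_ceil.2 hr'
    refine Set.mem_iUnion.2 ⟨⌈r⌉₊ - 1 - n, ?_⟩
    have h2 : ⌈r⌉₊ - 1 - n + n = ⌈r⌉₊ - 1 := by omega
    have h3 : ((⌈r⌉₊ - 1 : ℕ) : ℝ) + 1 = ⌈r⌉₊ := by
      rw [Nat.cast_sub (by omega)]; simp
    rw [h2]
    refine ⟨?_, h3 ▸ Nat.le_ceil r⟩
    have := Nat.ceil_lt_add_one h0.le
    linarith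
  refine (lintegral_mono_set hsub).trans ((lintegral_iUnion_le _ _).trans ?_)
  refine ENNReal.tsum_le_tsum fun j => ?_
  rw [edgeIntegral_prefixWord, ← lintegral_const_mul' _ _ ENNReal.ofReal_ne_top]
  refine setLIntegral_mono' measurableSet_Ioc fun r hr => ?_
  rw [mul_comm]
  refine mul_le_mul_left (ENNReal.ofReal_le_ofReal (Real.exp_le_exp.2 ?_)) _
  have := hr.1
  nlinarith

/-- Beyond level `n`, a function varies along a ray by at most the tail of its upper gradient. -/
theorem IsUpperGradient.edist_ray_le (hε : 0 < ε) {f : Tree K ε → ℝ} {g : Tree K ε → ℝ≥0∞}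
    (h : IsUpperGradient f g) (ξ : Boundary K) {n : ℕ} {s t : ℝ} (hs : n ≤ s) (ht : n ≤ t) :
    edist (f (ray ε ξ s)) (f (ray ε ξ t)) ≤
      ENNReal.ofReal (Real.exp (-ε * n)) * raySum g ξ n := by
  wlog hts : t ≤ s generalizing s t
  · rw [edist_comm]
    exact this ht hs (not_le.1 hts).le
  have hn := Nat.cast_nonneg (α := ℝ) n
  have ht0 : max t 0 = t := max_eq_left (hn.trans ht)
  have hs0 : max s 0 = s := max_eq_left (hn.trans hs)
  rw [edist_dist, Real.dist_eq]
  refine (h.2 _ _).trans ?_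
  have h1 : (ray ε ξ s).level = s := hs0
  have h2 : (ray ε ξ t).level = t := ht0
  rw [geodesicIntegral, meet_ray, hs0, ht0, min_eq_right hts, h1, h2, Set.Ioc_self,
    setLIntegral_empty, add_zero]
  refine le_trans ?_ (lintegral_ray_le hε g ξ n)
  refine le_trans ?_ (lintegral_mono_set (s := Set.Ioc t s)
    fun r hr => ht.trans_lt hr.1)
  exact (setLIntegral_congr_fun measurableSet_Ioc fun r hr => by
    rw [ancestor_ray ξ hr.2]).le

/-- The limit of `f` along the geodesic ray `[0, ξ)`; a junk value if it does not exist. -/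
noncomputable def rayLimit (f : Tree K ε → ℝ) (ξ : Boundary K) : ℝ :=
  limUnder atTop fun s : ℝ => f (ray ε ξ s)

theorem IsUpperGradient.tendsto_rayLimit (hε : 0 < ε) {f : Tree K ε → ℝ} {g : Tree K ε → ℝ≥0∞}
    (h : IsUpperGradient f g) {ξ : Boundary K} (hξ : raySum g ξ 0 ≠ ⊤) :
    Tendsto (fun s : ℝ => f (ray ε ξ s)) atTop (𝓝 (rayLimit f ξ)) := by
  have hlim : Tendsto (fun n : ℕ => ENNReal.ofReal (Real.exp (-ε * n)) * raySum g ξ n)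
      atTop (𝓝 0) := by
    simp only [exp_mul_raySum]
    refine ENNReal.tendsto_sum_nat_add (fun j : ℕ => ENNReal.ofReal (Real.exp (-ε * (j : ℝ))) *
        edgeIntegral g (prefixWord ξ (j + 1))) ?_
    simpa [raySum] using hξ
  have hc : CauchySeq fun s : ℝ => f (ray ε ξ s) := by
    rw [EMetric.cauchySeq_iff]
    intro δ hδ
    obtain ⟨n, hn⟩ := (hlim.eventually (gt_mem_nhds hδ)).exists
    exact ⟨n, fun s hs t ht => (h.edist_ray_le hε ξ hs ht).trans_lt hn⟩
  exact hc.tendsto_limUnder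

theorem IsUpperGradient.edist_rayLimit_le (hε : 0 < ε) {f : Tree K ε → ℝ} {g : Tree K ε → ℝ≥0∞}
    (h : IsUpperGradient f g) {ξ : Boundary K} (hξ : raySum g ξ 0 ≠ ⊤) {n : ℕ} {t : ℝ}
    (ht : n ≤ t) :
    edist (rayLimit f ξ) (f (ray ε ξ t)) ≤ ENNReal.ofReal (Real.exp (-ε * n)) * raySum g ξ n := by
  refine le_of_tendsto ((h.tendsto_rayLimit hε hξ).edist tendsto_const_nhds) ?_
  filter_upwards [eventually_ge_atTop (n : ℝ)] with s hs
  exact h.edist_ray_le hε ξ hs ht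

end

/-! ### The trace operator -/

section
variable {K : ℕ} {ε : ℝ}

/-- The energy of the tails of `g` along the rays is controlled by the modular of `g`: Jensen's
inequality on the edges and the Hardy inequality along each ray. -/
theorem tsum_lintegral_Phi_raySum_le (hK : 0 < K) (hε : 0 < ε) {β C p l₁ : ℝ} (l₂ : ℝ) (hC : 0 < C)
    (hb : 0 < β - Real.log K) (hbp : β - Real.log K < ε * p) (h : Admissible p l₁)
    {ν : Measure (Boundary K)} (hν : IsAhlforsRegular ε ν) :
    ∃ A : ℝ≥0, ∀ g : Tree K ε → ℝ≥0∞, Measurable g →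
      ∑' n, levelWeight (β - Real.log K) l₂ n * ∫⁻ ξ, Phi p l₁ (raySum g ξ n) ∂ν ≤
        A * ∫⁻ x, Phi p l₁ (g x) ∂(treeMeasure K ε β C l₂) := by
  obtain ⟨A₁, H₁⟩ := tsum_levelWeight_mul_Phi_tsum_le (ε := ε) l₂ hb hbp h
  obtain ⟨A₂, H₂⟩ := Phi_edgeIntegral_le (K := K) (ε := ε) h
  obtain ⟨A₃, H₃⟩ := le_lintegral_treeMeasure hK hε β l₂ hC hν
  refine ⟨A₁ * A₂ * A₃, fun g hg => ?_⟩
  have hm1 : ∀ n, Measurable fun ξ => levelWeight (β - Real.log K) l₂ n *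
      Phi p l₁ (raySum g ξ n) := fun n =>
    ((Phi_measurable p l₁).comp (measurable_raySum g n)).const_mul _
  have hm2 : ∀ n, Measurable fun ξ : Boundary K => levelWeight (β - Real.log K) l₂ n *
      Phi p l₁ (edgeIntegral g (prefixWord ξ (n + 1))) := fun n =>
    (measurable_comp_prefixWord (fun w => Phi p l₁ (edgeIntegral g w)) _).const_mul _
  calc ∑' n, levelWeight (β - Real.log K) l₂ n * ∫⁻ ξ, Phi p l₁ (raySum g ξ n) ∂ν
      = ∫⁻ ξ, ∑' n, levelWeight (β - Real.log K) l₂ n * Phi p l₁ (raySum g ξ n) ∂ν := by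
        rw [lintegral_tsum fun n => (hm1 n).aemeasurable]
        exact tsum_congr fun n => (lintegral_const_mul' _ _ (levelWeight_ne_top _ _ _)).symm
    _ ≤ ∫⁻ ξ, A₁ * ∑' n, levelWeight (β - Real.log K) l₂ n *
          Phi p l₁ (edgeIntegral g (prefixWord ξ (n + 1))) ∂ν :=
        lintegral_mono fun ξ => H₁ fun n => edgeIntegral g (prefixWord ξ (n + 1))
    _ = A₁ * ∑' n, levelWeight (β - Real.log K) l₂ n *
          ∫⁻ ξ, Phi p l₁ (edgeIntegral g (prefixWord ξ (n + 1))) ∂ν := by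
        rw [lintegral_const_mul' _ _ ENNReal.coe_ne_top, lintegral_tsum fun n => (hm2 n).aemeasurable]
        congr 1
        exact tsum_congr fun n => lintegral_const_mul' _ _ (levelWeight_ne_top _ _ _)
    _ ≤ A₁ * ∑' n, levelWeight (β - Real.log K) l₂ n *
          (A₂ * ∫⁻ ξ, edgeIntegral (fun x => Phi p l₁ (g x)) (prefixWord ξ (n + 1)) ∂ν) := by
        refine mul_le_mul_right (ENNReal.tsum_le_tsum fun n => mul_le_mul_right ?_ _) _
        rw [← lintegral_const_mul' _ _ ENNReal.coe_ne_top]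
        exact lintegral_mono fun ξ => H₂ g _
    _ = A₁ * A₂ * ∑' n, levelWeight (β - Real.log K) l₂ n *
          ∫⁻ ξ, edgeIntegral (fun x => Phi p l₁ (g x)) (prefixWord ξ (n + 1)) ∂ν := by
        rw [mul_assoc, ← ENNReal.tsum_mul_left (a := (A₂ : ℝ≥0∞))]
        congr 1
        exact tsum_congr fun n => mul_left_comm _ _ _
    _ ≤ A₁ * A₂ * (A₃ * ∫⁻ x, Phi p l₁ (g x) ∂(treeMeasure K ε β C l₂)) :=
        mul_le_mul_right (H₃ _ ((Phi_measurable p l₁).comp hg).aemeasurable) _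
    _ = _ := by push_cast; ring

/-- The dyadic energy as an integral over the boundary, the sum over the words of length `n + 1`
being the integral over the rays. -/
theorem dyadicEnergy_eq_tsum_lintegral {b θ p : ℝ} (hb : ε * (1 - θ) * p = b) (l₁ l₂ : ℝ)
    (ν : Measure (Boundary K)) (f : Boundary K → ℝ) :
    dyadicEnergy ε θ p l₁ l₂ ν f = ∑' n, levelWeight b l₂ n *
      ∫⁻ ξ, Phi p l₁ (oscillation ε ν f (n + 1) (prefixWord ξ (n + 1))) ∂ν := by
  refine tsum_congr fun n => ?_
  rw [lintegral_comp_prefixWord ν (fun w => Phi p l₁ (oscillation ε ν f (n + 1) w)), levelWeight,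
    ← hb]
  congr 4
  ring

/-- The oscillation of a function `F` between a cylinder and its parent of level `n` is bounded by
the averages of `S` over the two, if `F` deviates by at most `e^{-εn} S` from a constant on the
parent. -/
theorem oscillation_le {ν : Measure (Boundary K)} [IsFiniteMeasure ν]
    (hν0 : ∀ w : List (Fin K), ν (cylinder w) ≠ 0) {F : Boundary K → ℝ} (hF : Integrable F ν)
    (S : Boundary K → ℝ≥0∞) (c : List (Fin K) → ℝ) (n : ℕ)
    (h : ∀ᵐ ζ ∂ν, ENNReal.ofReal |F ζ - c (prefixWord ζ n)| ≤
      ENNReal.ofReal (Real.exp (-ε * n)) * S ζ) (ξ : Boundary K) :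
    oscillation ε ν F (n + 1) (prefixWord ξ (n + 1)) ≤ ENNReal.ofReal (Real.exp ε) *
      ((⨍⁻ ζ in cylinder (prefixWord ξ (n + 1)), S ζ ∂ν) +
        ⨍⁻ ζ in cylinder (prefixWord ξ n), S ζ ∂ν) := by
  have key : ∀ m, n ≤ m → ENNReal.ofReal |dyadicMean ν F (prefixWord ξ m) - c (prefixWord ξ n)| ≤
      ENNReal.ofReal (Real.exp (-ε * n)) * ⨍⁻ ζ in cylinder (prefixWord ξ m), S ζ ∂ν := by
    intro m hm
    refine (ofReal_abs_dyadicMean_sub_le ν hF (hν0 _) _).trans ?_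
    rw [laverage, laverage, ← lintegral_const_mul' _ _ ENNReal.ofReal_ne_top]
    refine lintegral_mono_ae (Measure.ae_smul_measure ?_ _)
    filter_upwards [ae_restrict_of_ae h, ae_restrict_mem (measurableSet_cylinder _)] with ζ h1 h2
    have h3 : prefixWord ζ n = prefixWord ξ n := by
      rw [← take_prefixWord ζ hm, ← take_prefixWord ξ hm, mem_cylinder_prefixWord_iff.1 h2]
    rwa [h3] at h1
  have h1 := key (n + 1) n.le_succ
  have h2 := key n le_rfl
  rw [oscillation, dropLast_prefixWord_succ, div_eq_mul_inv, ← Real.exp_neg,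
    ENNReal.ofReal_mul (abs_nonneg _)]
  have h3 : ENNReal.ofReal |dyadicMean ν F (prefixWord ξ (n + 1)) - dyadicMean ν F (prefixWord ξ n)|
      ≤ ENNReal.ofReal (Real.exp (-ε * n)) *
        ((⨍⁻ ζ in cylinder (prefixWord ξ (n + 1)), S ζ ∂ν) +
          ⨍⁻ ζ in cylinder (prefixWord ξ n), S ζ ∂ν) := by
    rw [mul_add]
    refine le_trans ?_ (add_le_add h1 h2)
    rw [← ENNReal.ofReal_add (abs_nonneg _) (abs_nonneg _)]
    refine ENNReal.ofReal_le_ofReal ?_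
    rw [abs_sub_comm (dyadicMean ν F (prefixWord ξ n))]
    exact abs_sub_le _ _ _
  refine (mul_le_mul_left h3 _).trans_eq ?_
  have h4 : ENNReal.ofReal (Real.exp (-ε * n)) *
      ENNReal.ofReal (Real.exp (-(-ε * ((n + 1 : ℕ) : ℝ)))) = ENNReal.ofReal (Real.exp ε) := by
    rw [← ENNReal.ofReal_mul (Real.exp_pos _).le, ← Real.exp_add]
    congr 2
    push_cast
    ring
  rw [← h4]
  ring

theorem IsAhlforsRegular.measure_cylinder_ne_zero (hK : 0 < K) (hε : 0 < ε)
    {ν : Measure (Boundary K)} (hν : IsAhlforsRegular ε ν) (w : List (Fin K)) :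
    ν (cylinder w) ≠ 0 := by
  obtain ⟨a, _, ha, _, H⟩ := hν.measure_cylinder hK hε
  obtain ⟨ξ, hξ⟩ := exists_mem_cylinder hK w
  have h1 := (H (prefixWord ξ (w.length + 1)) (by simp [prefixWord_succ])).1
  have h2 : cylinder (prefixWord ξ (w.length + 1)) ⊆ cylinder w := by
    intro ζ hζ
    rw [mem_cylinder, ← take_prefixWord ζ w.length.le_succ, mem_cylinder_prefixWord_iff.1 hζ,
      take_prefixWord ξ w.length.le_succ]
    exact hξ
  have h3 : 0 < a * Real.exp (-Real.log K * (prefixWord ξ (w.length + 1)).length) := by positivity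
  exact ((ENNReal.ofReal_pos.2 h3).trans_le (h1.trans (measure_mono h2))).ne'

/-- A function in `L^Φ` has finite integral along almost every ray. -/
theorem ae_raySum_ne_top (hK : 0 < K) (hε : 0 < ε) {β C p l₁ : ℝ} (l₂ : ℝ)
    (hC : 0 < C) (hb : 0 < β - Real.log K) (hbp : β - Real.log K < ε * p) (h : Admissible p l₁)
    {ν : Measure (Boundary K)} (hν : IsAhlforsRegular ε ν) {g : Tree K ε → ℝ≥0∞}
    (hg : Measurable g) (hl : luxemburg p l₁ (treeMeasure K ε β C l₂) g ≠ ⊤) :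
    ∀ᵐ ξ ∂ν, raySum g ξ 0 ≠ ⊤ := by
  obtain ⟨k, hk, hi⟩ := luxemburg_ne_top.1 hl
  obtain ⟨A, H⟩ := tsum_lintegral_Phi_raySum_le hK hε l₂ hC hb hbp h hν
  have h1 : levelWeight (β - Real.log K) l₂ 0 *
      ∫⁻ ξ, Phi p l₁ (raySum (fun x => g x / ENNReal.ofReal k) ξ 0) ∂ν ≠ ⊤ := by
    refine ne_top_of_le_ne_top (ENNReal.coe_ne_top (r := A)) ?_
    refine (ENNReal.le_tsum (f := fun n => levelWeight (β - Real.log K) l₂ n *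
      ∫⁻ ξ, Phi p l₁ (raySum (fun x => g x / ENNReal.ofReal k) ξ n) ∂ν) 0).trans ?_
    refine (H _ (hg.div_const _)).trans ?_
    exact (mul_le_mul_right hi _).trans_eq (mul_one _)
  have h2 : ∫⁻ ξ, Phi p l₁ (raySum (fun x => g x / ENNReal.ofReal k) ξ 0) ∂ν ≠ ⊤ := fun h2 =>
    h1 (by rw [h2, ENNReal.mul_top (levelWeight_ne_zero _ _ _)])
  filter_upwards [ae_lt_top ((Phi_measurable p l₁).comp (measurable_raySum _ 0)) h2] with ξ hξ htop
  have hk' : ENNReal.ofReal k ≠ 0 := by simpa using hk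
  rw [Function.comp, raySum_div g hk', htop, ENNReal.top_div_of_ne_top ENNReal.ofReal_ne_top, Phi_top]
    at hξ
  exact lt_irrefl _ hξ

theorem aestronglyMeasurable_rayLimit {ν : Measure (Boundary K)} {f : Tree K ε → ℝ}
    (h : ∀ᵐ ξ ∂ν, Tendsto (fun s : ℝ => f (ray ε ξ s)) atTop (𝓝 (rayLimit f ξ))) :
    AEStronglyMeasurable (rayLimit f) ν := by
  refine aestronglyMeasurable_of_tendsto_ae atTop (f := fun (n : ℕ) ξ => f (ray ε ξ n))
    (fun n => ?_) (h.mono fun ξ hξ => hξ.comp tendsto_natCast_atTop_atTop)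
  simp only [ray_natCast]
  exact (measurable_comp_prefixWord (fun w => f (vertex ε w)) n).aestronglyMeasurable

/-- The `L^Φ` bound for the trace.  The trace at `ξ` is compared with all the values of `f` on the
first edge of the ray `[0, ξ)`. -/
theorem luxemburg_rayLimit_le (hK : 0 < K) (hε : 0 < ε) {β C p l₁ : ℝ} (l₂ : ℝ)
    (hC : 0 < C) (hb : 0 < β - Real.log K) (hbp : β - Real.log K < ε * p) (h : Admissible p l₁)
    {ν : Measure (Boundary K)} (hν : IsAhlforsRegular ε ν) :
    ∃ M : ℝ≥0, ∀ (f : Tree K ε → ℝ) (g : Tree K ε → ℝ≥0∞) (k₁ k₂ : ℝ),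
      AEMeasurable f (treeMeasure K ε β C l₂) → IsUpperGradient f g → 0 < k₁ → 0 < k₂ →
      ∫⁻ x, Phi p l₁ (ENNReal.ofReal |f x| / ENNReal.ofReal k₁) ∂(treeMeasure K ε β C l₂) ≤ 1 →
      ∫⁻ x, Phi p l₁ (g x / ENNReal.ofReal k₂) ∂(treeMeasure K ε β C l₂) ≤ 1 →
      luxemburg p l₁ ν (fun ξ => ENNReal.ofReal |rayLimit f ξ|) ≤ M * ENNReal.ofReal (k₁ + k₂) := by
  obtain ⟨A₁, H₁⟩ := tsum_lintegral_Phi_raySum_le hK hε l₂ hC hb hbp h hν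
  obtain ⟨A₂, H₂⟩ := le_lintegral_treeMeasure hK hε β l₂ hC hν
  obtain ⟨A₃, H₃⟩ := Phi_add_le h 1
  set W := levelWeight (β - Real.log K) l₂ 0 with hW
  have hW0 : W ≠ 0 := levelWeight_ne_zero _ _ _
  have hWt : W ≠ ⊤ := levelWeight_ne_top _ _ _
  have hfin : A₃ * (W⁻¹ * A₂ + W⁻¹ * A₁) ≠ ⊤ := by
    have : W⁻¹ ≠ ⊤ := ENNReal.inv_ne_top.2 hW0
    finiteness
  obtain ⟨M, HM⟩ := luxemburg_le_of_lintegral_le h.one_le l₁ (A₃ * (W⁻¹ * A₂ + W⁻¹ * A₁)).toNNReal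
  refine ⟨M, fun f g k₁ k₂ hf hg hk₁ hk₂ hi₁ hi₂ => HM ν _ (k₁ + k₂) (by positivity) ?_⟩
  rw [ENNReal.coe_toNNReal hfin]
  have hk₂' : ENNReal.ofReal k₂ ≠ 0 := by simpa using hk₂
  set F : Tree K ε → ℝ≥0∞ := fun x => Phi p l₁ (ENNReal.ofReal |f x| / ENNReal.ofReal k₁) with hF
  set G : Tree K ε → ℝ≥0∞ := fun x => g x / ENNReal.ofReal k₂ with hG
  have hFm : AEMeasurable F (treeMeasure K ε β C l₂) :=
    (Phi_measurable p l₁).comp_aemeasurable (hf.abs.ennreal_ofReal.div_const _)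
  have hGm : Measurable G := hg.1.div_const _
  have hae := ae_raySum_ne_top hK hε l₂ hC hb hbp h hν hg.1
    (luxemburg_ne_top.2 ⟨k₂, hk₂, hi₂⟩)
  have hpt : ∀ᵐ ξ ∂ν, Phi p l₁ (ENNReal.ofReal |rayLimit f ξ| / ENNReal.ofReal (k₁ + k₂)) ≤
      A₃ * (edgeIntegral F (prefixWord ξ (0 + 1)) + Phi p l₁ (raySum G ξ 0)) := by
    filter_upwards [hae] with ξ hξ
    have hs : ∀ s ∈ Set.Ioc ((0 : ℕ) : ℝ) ((0 : ℕ) + 1),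
        Phi p l₁ (ENNReal.ofReal |rayLimit f ξ| / ENNReal.ofReal (k₁ + k₂)) ≤
          A₃ * (F (ray ε ξ s) + Phi p l₁ (raySum G ξ 0)) := by
      intro s hs
      refine H₃ _ _ _ ?_
      have h1 := hg.edist_rayLimit_le hε hξ (n := 0) hs.1.le
      have h2 : ENNReal.ofReal |rayLimit f ξ| ≤
          ENNReal.ofReal |f (ray ε ξ s)| + raySum g ξ 0 := by
        rw [edist_dist, Real.dist_eq] at h1
        simp only [Nat.cast_zero, mul_zero, Real.exp_zero, ENNReal.ofReal_one, one_mul] at h1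
        refine le_trans ?_ (add_le_add_right h1 _)
        rw [← ENNReal.ofReal_add (abs_nonneg _) (abs_nonneg _)]
        refine ENNReal.ofReal_le_ofReal ?_
        have := abs_add_le (f (ray ε ξ s)) (rayLimit f ξ - f (ray ε ξ s))
        rwa [add_sub_cancel] at this
      rw [hG, raySum_div g hk₂', ENNReal.coe_one, one_mul]
      refine (ENNReal.div_le_div_right h2 _).trans ?_
      rw [ENNReal.add_div]
      gcongr <;> linarith
    have e1 : Phi p l₁ (ENNReal.ofReal |rayLimit f ξ| / ENNReal.ofReal (k₁ + k₂)) =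
        ∫⁻ _ in Set.Ioc ((0 : ℕ) : ℝ) ((0 : ℕ) + 1),
          Phi p l₁ (ENNReal.ofReal |rayLimit f ξ| / ENNReal.ofReal (k₁ + k₂)) := by simp
    rw [e1]
    refine (setLIntegral_mono' measurableSet_Ioc hs).trans_eq ?_
    rw [lintegral_const_mul' _ _ ENNReal.coe_ne_top, lintegral_add_right _ measurable_const,
      edgeIntegral_prefixWord]
    simp
  have h1 : ∫⁻ ξ, edgeIntegral F (prefixWord ξ (0 + 1)) ∂ν ≤ W⁻¹ * A₂ := by
    rw [← ENNReal.mul_le_iff_le_inv hW0 hWt]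
    refine (ENNReal.le_tsum (f := fun n => levelWeight (β - Real.log K) l₂ n *
      ∫⁻ ξ, edgeIntegral F (prefixWord ξ (n + 1)) ∂ν) 0).trans ?_
    exact (H₂ F hFm).trans ((mul_le_mul_right hi₁ _).trans_eq (mul_one _))
  have h2 : ∫⁻ ξ, Phi p l₁ (raySum G ξ 0) ∂ν ≤ W⁻¹ * A₁ := by
    rw [← ENNReal.mul_le_iff_le_inv hW0 hWt]
    refine (ENNReal.le_tsum (f := fun n => levelWeight (β - Real.log K) l₂ n *
      ∫⁻ ξ, Phi p l₁ (raySum G ξ n) ∂ν) 0).trans ?_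
    exact (H₁ G hGm).trans ((mul_le_mul_right hi₂ _).trans_eq (mul_one _))
  refine (lintegral_mono_ae hpt).trans ?_
  rw [lintegral_const_mul' _ _ ENNReal.coe_ne_top,
    lintegral_add_left (measurable_comp_prefixWord (edgeIntegral F) (0 + 1))]
  gcongr

/-- The energy bound for the trace. -/
theorem besovSeminorm_rayLimit_le (hK : 0 < K) (hε : 0 < ε) {β C p l₁ θ : ℝ} (l₂ : ℝ)
    (hC : 0 < C) (hb : 0 < β - Real.log K) (hbp : β - Real.log K < ε * p)
    (hθ : ε * (1 - θ) * p = β - Real.log K) (h : Admissible p l₁)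
    {ν : Measure (Boundary K)} (hν : IsAhlforsRegular ε ν) :
    ∃ M : ℝ≥0, ∀ (f : Tree K ε → ℝ) (g : Tree K ε → ℝ≥0∞) (k : ℝ),
      Integrable (rayLimit f) ν → IsUpperGradient f g → 0 < k →
      ∫⁻ x, Phi p l₁ (g x / ENNReal.ofReal k) ∂(treeMeasure K ε β C l₂) ≤ 1 →
      besovSeminorm ε θ p l₁ l₂ ν (rayLimit f) ≤ M * ENNReal.ofReal k := by
  have := hν.isFiniteMeasure hε
  obtain ⟨A₁, H₁⟩ := tsum_lintegral_Phi_raySum_le hK hε l₂ hC hb hbp h hν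
  obtain ⟨A₂, H₂⟩ := lintegral_Phi_setLAverage_le (K := K) h
  obtain ⟨A₃, H₃⟩ := Phi_add_le h (Real.exp ε).toNNReal
  obtain ⟨M, HM⟩ := besovSeminorm_le_of_dyadicEnergy_le (K := K) h.one_le l₁
    (A₃ * (2 * A₂) * A₁)
  refine ⟨M, fun f g k hF hg hk hi => HM ε θ l₂ ν _ k hk ?_⟩
  have hk' : ENNReal.ofReal k ≠ 0 := by simpa using hk
  set G : Tree K ε → ℝ≥0∞ := fun x => g x / ENNReal.ofReal k with hG
  have hae := ae_raySum_ne_top hK hε l₂ hC hb hbp h hν hg.1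
    (luxemburg_ne_top.2 ⟨k, hk, hi⟩)
  have hpt : ∀ (n : ℕ) (ξ : Boundary K), Phi p l₁ (oscillation ε ν (fun ξ => rayLimit f ξ / k)
      (n + 1) (prefixWord ξ (n + 1))) ≤
      A₃ * (Phi p l₁ (⨍⁻ ζ in cylinder (prefixWord ξ (n + 1)), raySum G ζ n ∂ν) +
        Phi p l₁ (⨍⁻ ζ in cylinder (prefixWord ξ n), raySum G ζ n ∂ν)) := by
    intro n ξ
    refine H₃ _ _ _ ?_
    rw [oscillation_div _ _ _ _ _ hk]
    simp only [hG, raySum_div g hk']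
    rw [setLAverage_div _ _ _ hk', setLAverage_div _ _ _ hk', ← ENNReal.add_div, ← mul_div_assoc]
    refine ENNReal.div_le_div_right ?_ _
    -- on the cylinder of a vertex of level `n`, the trace is close to the value at that vertex
    refine oscillation_le (hν.measure_cylinder_ne_zero hK hε) hF (fun ζ => raySum g ζ n)
      (fun w => f (vertex ε w)) n ?_ ξ
    filter_upwards [hae] with ζ hζ
    have := hg.edist_rayLimit_le hε hζ (n := n) le_rfl
    rwa [ray_natCast, edist_dist, Real.dist_eq] at this
  rw [dyadicEnergy_eq_tsum_lintegral hθ]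
  calc _ ≤ ∑' n, levelWeight (β - Real.log K) l₂ n *
        (A₃ * (2 * A₂) * ∫⁻ ξ, Phi p l₁ (raySum G ξ n) ∂ν) := by
        refine ENNReal.tsum_le_tsum fun n => mul_le_mul_right ?_ _
        refine (lintegral_mono (hpt n)).trans ?_
        rw [lintegral_const_mul' _ _ ENNReal.coe_ne_top, lintegral_add_left
          (measurable_comp_prefixWord
            (fun w => Phi p l₁ (⨍⁻ ζ in cylinder w, raySum G ζ n ∂ν)) (n + 1))]
        calc _ ≤ A₃ * (A₂ * ∫⁻ ξ, Phi p l₁ (raySum G ξ n) ∂ν +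
              A₂ * ∫⁻ ξ, Phi p l₁ (raySum G ξ n) ∂ν) :=
              mul_le_mul_right (add_le_add (H₂ ν _ _) (H₂ ν _ _)) _
          _ = _ := by ring
    _ = A₃ * (2 * A₂) * ∑' n, levelWeight (β - Real.log K) l₂ n *
          ∫⁻ ξ, Phi p l₁ (raySum G ξ n) ∂ν := by
        rw [← ENNReal.tsum_mul_left]
        exact tsum_congr fun n => mul_left_comm _ _ _
    _ ≤ A₃ * (2 * A₂) * (A₁ * 1) := by
        refine mul_le_mul_right ((H₁ G (hg.1.div_const _)).trans (mul_le_mul_right hi _)) _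
    _ = _ := by push_cast; ring

/-- Passage to the infima that define the Luxemburg and Sobolev norms.  The case `M = 0` has to be
excluded because `0 * ⊤ = 0`. -/
theorem le_mul_add_iInf {ι : Sort*} {M : ℝ≥0} (hM : M ≠ 0) {x c : ℝ≥0∞} {z : ι → ℝ≥0∞}
    (h : ∀ i, x ≤ M * (c + z i)) : x ≤ M * (c + ⨅ i, z i) := by
  have hM' : (M : ℝ≥0∞) ≠ 0 := by simpa using hM
  rw [mul_comm, ← ENNReal.div_le_iff_le_mul (Or.inl hM') (Or.inl ENNReal.coe_ne_top), add_comm,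
    ← tsub_le_iff_right]
  refine le_iInf fun i => ?_
  rw [tsub_le_iff_right, add_comm, ENNReal.div_le_iff_le_mul (Or.inl hM') (Or.inl ENNReal.coe_ne_top), mul_comm]
  exact h i

theorem besovNorm_rayLimit_le (hK : 0 < K) (hε : 0 < ε) {β C p l₁ θ : ℝ} (l₂ : ℝ)
    (hC : 0 < C) (hb : 0 < β - Real.log K) (hbp : β - Real.log K < ε * p)
    (hθ : ε * (1 - θ) * p = β - Real.log K) (h : Admissible p l₁)
    {ν : Measure (Boundary K)} (hν : IsAhlforsRegular ε ν) :
    ∃ M : ℝ≥0, ∀ f : Tree K ε → ℝ, AEMeasurable f (treeMeasure K ε β C l₂) →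
      besovNorm ε θ p l₁ l₂ ν (rayLimit f) ≤ M * sobolevNorm p l₁ (treeMeasure K ε β C l₂) f := by
  have := hν.isFiniteMeasure hε
  obtain ⟨M₁, H₁⟩ := luxemburg_rayLimit_le hK hε l₂ hC hb hbp h hν
  obtain ⟨M₂, H₂⟩ := besovSeminorm_rayLimit_le hK hε l₂ hC hb hbp hθ h hν
  have hM : M₁ + M₂ + 1 ≠ 0 := by positivity
  refine ⟨M₁ + M₂ + 1, fun f hf => ?_⟩
  rw [sobolevNorm]
  refine le_mul_add_iInf hM fun g => le_mul_add_iInf hM fun hg => ?_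
  refine le_mul_add_iInf hM fun k₂ => le_mul_add_iInf hM fun hk₂ =>
    le_mul_add_iInf hM fun hi₂ => ?_
  rw [add_comm (luxemburg _ _ _ _)]
  refine le_mul_add_iInf hM fun k₁ => le_mul_add_iInf hM fun hk₁ =>
    le_mul_add_iInf hM fun hi₁ => ?_
  have h1 := H₁ f g k₁ k₂ hf hg hk₁ hk₂ hi₁ hi₂
  have hae := ae_raySum_ne_top hK hε l₂ hC hb hbp h hν hg.1
    (luxemburg_ne_top.2 ⟨k₂, hk₂, hi₂⟩)
  have hF : Integrable (rayLimit f) ν := by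
    refine integrable_of_luxemburg h
      (aestronglyMeasurable_rayLimit (hae.mono fun ξ hξ => hg.tendsto_rayLimit hε hξ)) ?_
    exact ne_top_of_le_ne_top (ENNReal.mul_ne_top ENNReal.coe_ne_top ENNReal.ofReal_ne_top) h1
  have h2 := H₂ f g k₂ hF hg hk₂ hi₂
  rw [← ENNReal.ofReal_add hk₂.le hk₁.le, add_comm k₂]
  calc besovNorm ε θ p l₁ l₂ ν (rayLimit f)
      ≤ M₁ * ENNReal.ofReal (k₁ + k₂) + M₂ * ENNReal.ofReal (k₁ + k₂) := by
        refine add_le_add h1 (h2.trans ?_)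
        gcongr
        linarith
    _ = (M₁ + M₂) * ENNReal.ofReal (k₁ + k₂) := by ring
    _ ≤ _ := by
        push_cast
        exact mul_le_mul_left le_self_add _

end

/-! ### Convergence of dyadic means -/

section
variable {K : ℕ}

/-- The filtration generated by the cylinders of level `n`. -/
def cylinderFiltration (K : ℕ) : Filtration ℕ (inferInstance : MeasurableSpace (Boundary K)) where
  seq n := MeasurableSpace.comap (fun ξ => prefixWord ξ n) ⊤
  mono' m n hmn := by
    have h : (fun ξ : Boundary K => prefixWord ξ m) =
        (fun w => w.take m) ∘ fun ξ => prefixWord ξ n := by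
      ext1 ξ; exact (take_prefixWord ξ hmn).symm
    change MeasurableSpace.comap _ ⊤ ≤ MeasurableSpace.comap _ ⊤
    rw [h, ← MeasurableSpace.comap_comp]
    exact MeasurableSpace.comap_mono le_top
  le' n := by
    let _ : MeasurableSpace (List (Fin K)) := ⊤
    exact (measurable_comp_prefixWord (fun w => w) n).comap_le

theorem le_iSup_cylinderFiltration :
    (inferInstance : MeasurableSpace (Boundary K)) ≤ ⨆ n, cylinderFiltration K n := by
  refine iSup_le fun i => le_trans ?_ (le_iSup (fun n => cylinderFiltration K n) (i + 1))
  rintro _ ⟨s, -, rfl⟩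
  refine ⟨{w | ∃ a ∈ s, w[i]? = some a}, trivial, ?_⟩
  ext ξ
  simp [prefixWord]

theorem integrable_comp_prefixWord (ν : Measure (Boundary K)) [IsFiniteMeasure ν]
    (a : List (Fin K) → ℝ) (n : ℕ) : Integrable (fun ξ => a (prefixWord ξ n)) ν := by
  obtain ⟨C, hC⟩ := (Set.finite_range fun w : Fin n → Fin K => ‖a (List.ofFn w)‖).bddAbove
  refine Integrable.of_bound (measurable_comp_prefixWord a n).aestronglyMeasurable C
    (ae_of_all _ fun ξ => ?_)
  rw [prefixWord_eq_ofFn]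
  exact hC ⟨_, rfl⟩

/-- Dyadic means are conditional expectations. -/
theorem dyadicMean_ae_eq_condExp (ν : Measure (Boundary K)) [IsFiniteMeasure ν]
    {u : Boundary K → ℝ} (hu : Integrable u ν) (n : ℕ) :
    (fun ξ => dyadicMean ν u (prefixWord ξ n)) =ᵐ[ν] ν[u | cylinderFiltration K n] := by
  classical
  have hi := integrable_comp_prefixWord ν (dyadicMean ν u) n
  refine ae_eq_condExp_of_forall_setIntegral_eq ((cylinderFiltration K).le n) hu
    (fun s _ _ => hi.integrableOn) ?_ ?_
  · rintro _ ⟨B, -, rfl⟩ -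
    have hB : (fun ξ : Boundary K => prefixWord ξ n) ⁻¹' B =
        ⋃ w : {w : Fin n → Fin K // List.ofFn w ∈ B}, cylinder (List.ofFn w.1) := by
      ext ξ
      simp only [Set.mem_preimage, Set.mem_iUnion, mem_cylinder_ofFn, Subtype.exists, exists_prop,
        exists_eq_right', prefixWord_eq_ofFn]
    have hd : Pairwise (Function.onFun Disjoint
        fun w : {w : Fin n → Fin K // List.ofFn w ∈ B} => cylinder (List.ofFn w.1)) := by
      intro v w hvw
      refine Set.disjoint_left.2 fun ξ h1 h2 => hvw (Subtype.ext ?_)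
      rw [← (mem_cylinder_ofFn v.1).1 h1, (mem_cylinder_ofFn w.1).1 h2]
    rw [hB, integral_iUnion_fintype (fun w => measurableSet_cylinder _) hd
      fun w => hi.integrableOn, integral_iUnion_fintype (fun w => measurableSet_cylinder _) hd
      fun w => hu.integrableOn]
    refine Finset.sum_congr rfl fun w _ => ?_
    rw [setIntegral_congr_fun (g := fun _ => dyadicMean ν u (List.ofFn w.1))
      (measurableSet_cylinder _), setIntegral_const, dyadicMean,
      measure_smul_setAverage _ (measure_ne_top ν _)]
    intro ξ hξ
    have : prefixWord ξ n = List.ofFn w.1 := by simpa [mem_cylinder] using hξ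
    simp only [this]
  · let _ : MeasurableSpace (List (Fin K)) := ⊤
    have h1 : Measurable[cylinderFiltration K n] fun ξ : Boundary K => prefixWord ξ n :=
      comap_measurable _
    have h2 : Measurable (dyadicMean ν u) := measurable_from_top
    exact (h2.comp h1).stronglyMeasurable.aestronglyMeasurable

/-- The dyadic means of `u` converge to `u` almost everywhere, by Lévy's upward theorem. -/
theorem tendsto_dyadicMean (ν : Measure (Boundary K)) [IsFiniteMeasure ν]
    {u : Boundary K → ℝ} (hu : Integrable u ν) (hm : StronglyMeasurable u) :
    ∀ᵐ ξ ∂ν, Tendsto (fun n => dyadicMean ν u (prefixWord ξ n)) atTop (𝓝 (u ξ)) := by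
  have h1 := hu.tendsto_ae_condExp (ℱ := cylinderFiltration K) (hm.mono le_iSup_cylinderFiltration)
  have h2 : ∀ᵐ ξ ∂ν, ∀ n, dyadicMean ν u (prefixWord ξ n) =
      (ν[u | cylinderFiltration K n]) ξ :=
    ae_all_iff.2 fun n => dyadicMean_ae_eq_condExp ν hu n
  filter_upwards [h1, h2] with ξ h3 h4
  exact h3.congr fun n => (h4 n).symm

end

/-! ### Interpolation of functions on the vertices -/

section
variable {K : ℕ} {ε : ℝ}

theorem take_eq_of_le_commonPrefix {v w : List (Fin K)} {n : ℕ} (h : n ≤ commonPrefix v w) :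
    v.take n = w.take n := by
  induction v generalizing w n with
  | nil =>
    have : n = 0 := by cases w <;> simpa [commonPrefix] using h
    simp [this]
  | cons a v ih =>
    cases n with
    | zero => simp
    | succ n =>
      cases w with
      | nil => simp [commonPrefix] at h
      | cons b w =>
        by_cases hab : a = b
        · simp only [commonPrefix, hab, if_true, Nat.add_le_add_iff_right] at h
          simp [hab, ih h]
        · simp [commonPrefix, hab] at h

theorem meet_nonneg (x y : Tree K ε) : 0 ≤ meet x y :=
  le_min (le_min x.level_nonneg y.level_nonneg) (Nat.cast_nonneg _)

theorem ancestor_meet (x y : Tree K ε) : ancestor x (meet x y) = ancestor y (meet x y) := by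
  have h0 := meet_nonneg x y
  have h1 := meet_le_left x y
  have h2 := meet_le_right x y
  have h3 : ⌈meet x y⌉₊ ≤ commonPrefix x.word y.word := Nat.ceil_le.2 (min_le_right _ _)
  refine Tree.ext ?_ ?_
  · simp [ancestor, h0, h1, h2]
  · simp only [ancestor, max_eq_left h0, min_eq_left h1, min_eq_left h2]
    exact take_eq_of_le_commonPrefix h3

theorem exists_ray_eq (hK : 0 < K) (x : Tree K ε) : ∃ ξ : Boundary K, ray ε ξ x.level = x := by
  obtain ⟨ξ, hξ⟩ := exists_mem_cylinder hK x.word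
  refine ⟨ξ, Tree.ext (max_eq_left x.level_nonneg) ?_⟩
  rw [mem_cylinder, x.length_word] at hξ
  simpa [ray, max_eq_left x.level_nonneg, prefixWord] using hξ

/-- The edge that ends at the vertex `w` is the set of points beyond level `|w| - 1` that lie on
the geodesic from the root to `w`. -/
theorem measurableSet_word_eq (w : List (Fin K)) : MeasurableSet {x : Tree K ε | x.word = w} := by
  have h : {x : Tree K ε | x.word = w} =
      {x | radial ε x.level = radial ε (w.length : ℝ) - dist x (vertex ε w)} ∩
        {x | (w.length : ℝ) - 1 < x.level} := by
    ext x
    have hv : (vertex ε w).level = w.length := rfl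
    have hvw : (vertex ε w).word = w := rfl
    have e : radial ε x.level = radial ε (w.length : ℝ) - dist x (vertex ε w) ↔
        x.level = meet x (vertex ε w) := by
      rw [dist_eq_radial, hv]
      constructor
      · intro h; exact (radial_strictMono ε).injective (by linarith)
      · intro h; rw [← h]; ring
    simp only [Set.mem_inter_iff, Set.mem_ofPred_eq, e]
    constructor
    · intro hx
      have h1 : (w.length : ℝ) = ⌈x.level⌉₊ := by rw [← hx, x.length_word]
      have h2 : x.level ≤ w.length := h1 ▸ Nat.le_ceil x.level
      refine ⟨?_, ?_⟩
      · rw [meet, hv, hvw, hx, commonPrefix_self, min_eq_left h2, min_eq_left h2]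
      · have := Nat.ceil_lt_add_one x.level_nonneg
        linarith
    · rintro ⟨h1, h2⟩
      have h3 : x.level ≤ commonPrefix x.word w := h1 ▸ min_le_right _ _
      have h4 : ⌈x.level⌉₊ ≤ commonPrefix x.word w := Nat.ceil_le.2 h3
      refine commonPrefix_eq (x.length_word ▸ h4) (le_trans ?_ h4)
      have h5 : (w.length : ℝ) < (⌈x.level⌉₊ + 1 : ℕ) := by
        push_cast
        linarith [Nat.le_ceil x.level]
      exact Nat.lt_succ_iff.1 (by exact_mod_cast h5)
  rw [h]
  refine MeasurableSet.inter (measurableSet_eq_fun ?_ ?_) (measurableSet_lt measurable_const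
    measurable_level)
  · exact (radial_continuous ε).measurable.comp measurable_level
  · fun_prop

/-- Functions on the tree can be defined by countably many cases, according to the edge. -/
theorem measurable_of_word {γ : Type*} [MeasurableSpace γ] (H : List (Fin K) → Tree K ε → γ)
    (h : ∀ w, Measurable (H w)) : Measurable fun x : Tree K ε => H x.word x := by
  let _ : MeasurableSpace (List (Fin K)) := ⊤
  have hw : Measurable (Tree.word : Tree K ε → List (Fin K)) :=
    measurable_to_countable' fun w => measurableSet_word_eq w
  exact (measurable_from_prod_countable_right (f := fun q : List (Fin K) × Tree K ε => H q.1 q.2)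
    h).comp (hw.prodMk measurable_id)

/-- The function on the tree with the values `a` at the vertices that is affine with respect to
`d_X` on every edge. -/
noncomputable def interpolate (ε : ℝ) (a : List (Fin K) → ℝ) (x : Tree K ε) : ℝ :=
  a x.word.dropLast +
    (a x.word - a x.word.dropLast) / dist (vertex ε x.word.dropLast) (vertex ε x.word) *
      dist (vertex ε x.word.dropLast) x

/-- The slope of `interpolate ε a` on the edge of `x`, an upper gradient. -/
noncomputable def edgeSlope (a : List (Fin K) → ℝ) (x : Tree K ε) : ℝ≥0∞ :=
  ENNReal.ofReal
    (|a x.word - a x.word.dropLast| / dist (vertex ε x.word.dropLast) (vertex ε x.word))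

theorem measurable_interpolate (a : List (Fin K) → ℝ) : Measurable (interpolate ε a) :=
  measurable_of_word (fun w x => a w.dropLast + (a w - a w.dropLast) /
    dist (vertex ε w.dropLast) (vertex ε w) * dist (vertex ε w.dropLast) x) fun w => by fun_prop

theorem measurable_edgeSlope (a : List (Fin K) → ℝ) :
    Measurable (edgeSlope a : Tree K ε → ℝ≥0∞) :=
  measurable_of_word (fun w _ => ENNReal.ofReal
    (|a w - a w.dropLast| / dist (vertex ε w.dropLast) (vertex ε w))) fun _ => measurable_const

theorem dist_ray (ξ : Boundary K) {s t : ℝ} (hs : 0 ≤ s) (hst : s ≤ t) :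
    dist (ray ε ξ s) (ray ε ξ t) = radial ε t - radial ε s := by
  rw [dist_eq_radial, meet_ray, max_eq_left hs, max_eq_left (hs.trans hst), min_eq_left hst]
  have h1 : (ray ε ξ s).level = s := max_eq_left hs
  have h2 : (ray ε ξ t).level = t := max_eq_left (hs.trans hst)
  rw [h1, h2]; ring

theorem word_ray (ξ : Boundary K) {n : ℕ} {s : ℝ} (hs : s ∈ Set.Ioc (n : ℝ) (n + 1)) :
    (ray ε ξ s).word = prefixWord ξ (n + 1) := by
  have h0 : 0 ≤ s := (Nat.cast_nonneg n).trans hs.1.le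
  have h1 : ⌈s⌉₊ = n + 1 := by
    rw [Nat.ceil_eq_iff (by omega)]
    simpa using hs
  simp [ray, max_eq_left h0, h1, prefixWord]

theorem dist_vertex_prefixWord (ξ : Boundary K) (n : ℕ) :
    dist (vertex ε (prefixWord ξ n)) (vertex ε (prefixWord ξ (n + 1))) =
      radial ε (n + 1) - radial ε n := by
  rw [← ray_natCast, ← ray_natCast, dist_ray ξ (Nat.cast_nonneg n) (by simp)]
  simp

theorem interpolate_vertex (a : List (Fin K) → ℝ) (w : List (Fin K)) :
    interpolate ε a (vertex ε w) = a w := by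
  have hw : (vertex ε w).word = w := rfl
  rw [interpolate, hw]
  by_cases h : w.dropLast = w
  · simp [h]
  · have h2 : dist (vertex ε w.dropLast) (vertex ε w) ≠ 0 := by
      rw [dist_ne_zero]
      exact fun h3 => h (congrArg Tree.word h3)
    rw [div_mul_cancel₀ _ h2]; ring

theorem interpolate_ray (a : List (Fin K) → ℝ) (ξ : Boundary K) {n : ℕ} {s : ℝ}
    (hs : s ∈ Set.Icc (n : ℝ) (n + 1)) :
    interpolate ε a (ray ε ξ s) = a (prefixWord ξ n) +
      (a (prefixWord ξ (n + 1)) - a (prefixWord ξ n)) / (radial ε (n + 1) - radial ε n) *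
        (radial ε s - radial ε n) := by
  rcases hs.1.eq_or_lt with h | h
  · rw [← h, ray_natCast, interpolate_vertex]; ring
  · rw [interpolate, word_ray ξ ⟨h, hs.2⟩, dropLast_prefixWord_succ, dist_vertex_prefixWord,
      ← ray_natCast, dist_ray ξ (Nat.cast_nonneg n) hs.1]

theorem edgeSlope_ray (a : List (Fin K) → ℝ) (ξ : Boundary K) {n : ℕ} {s : ℝ}
    (hs : s ∈ Set.Ioc (n : ℝ) (n + 1)) :
    edgeSlope a (ray ε ξ s) = ENNReal.ofReal
      (|a (prefixWord ξ (n + 1)) - a (prefixWord ξ n)| / (radial ε (n + 1) - radial ε n)) := by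
  rw [edgeSlope, word_ray ξ hs, dropLast_prefixWord_succ, dist_vertex_prefixWord]

theorem lintegral_exp_Ioc (ε : ℝ) {s t : ℝ} (hst : s ≤ t) :
    ∫⁻ r in Set.Ioc s t, ENNReal.ofReal (Real.exp (-ε * r)) =
      ENNReal.ofReal (radial ε t - radial ε s) := by
  rw [← integral_exp_eq, intervalIntegral.integral_of_le hst, ofReal_integral_eq_lintegral_ofReal]
  · exact (intervalIntegrable_exp ε s t).1
  · exact ae_of_all _ fun r => (Real.exp_pos _).le

theorem radial_lt_succ (ε : ℝ) (n : ℕ) : radial ε n < radial ε (n + 1) :=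
  radial_strictMono ε (lt_add_one _)

theorem edist_interpolate_ray_le (a : List (Fin K) → ℝ) (ξ : Boundary K) (n : ℕ) :
    ∀ {s t : ℝ}, 0 ≤ s → s ≤ t → t ≤ n →
      edist (interpolate ε a (ray ε ξ s)) (interpolate ε a (ray ε ξ t)) ≤
        ∫⁻ r in Set.Ioc s t, edgeSlope a (ray ε ξ r) * ENNReal.ofReal (Real.exp (-ε * r)) := by
  induction n with
  | zero =>
    intro s t hs hst ht
    rw [Nat.cast_zero] at ht
    have : s = t := by linarith
    simp [this]
  | succ n ih =>
    have edge : ∀ {s t : ℝ}, (n : ℝ) ≤ s → s ≤ t → t ≤ n + 1 →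
        edist (interpolate ε a (ray ε ξ s)) (interpolate ε a (ray ε ξ t)) ≤
          ∫⁻ r in Set.Ioc s t, edgeSlope a (ray ε ξ r) * ENNReal.ofReal (Real.exp (-ε * r)) := by
      intro s t hs hst ht
      have hd : 0 < radial ε (n + 1) - radial ε n := sub_pos.2 (radial_lt_succ ε n)
      have h1 : ∫⁻ r in Set.Ioc s t, edgeSlope a (ray ε ξ r) *
          ENNReal.ofReal (Real.exp (-ε * r)) = ENNReal.ofReal
            (|a (prefixWord ξ (n + 1)) - a (prefixWord ξ n)| / (radial ε (n + 1) - radial ε n)) *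
              ENNReal.ofReal (radial ε t - radial ε s) := by
        rw [← lintegral_exp_Ioc ε hst, ← lintegral_const_mul' _ _ ENNReal.ofReal_ne_top]
        refine setLIntegral_congr_fun measurableSet_Ioc fun r hr => ?_
        simp only [edgeSlope_ray a ξ (n := n) ⟨hs.trans_lt hr.1, hr.2.trans ht⟩]
      rw [h1, ← ENNReal.ofReal_mul (by positivity), edist_comm, edist_dist, Real.dist_eq,
        interpolate_ray a ξ ⟨hs, hst.trans ht⟩, interpolate_ray a ξ ⟨hs.trans hst, ht⟩]
      refine ENNReal.ofReal_le_ofReal (le_of_eq ?_)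
      rw [add_sub_add_left_eq_sub, ← mul_sub, sub_sub_sub_cancel_right, abs_mul, abs_div,
        abs_of_pos hd, abs_of_nonneg (sub_nonneg.2 ((radial_strictMono ε).monotone hst))]
    intro s t hs hst ht
    rw [Nat.cast_add_one] at ht
    rcases le_total t n with h1 | h1
    · exact ih hs hst h1
    rcases le_total (n : ℝ) s with h2 | h2
    · exact edge h2 hst ht
    · refine (edist_triangle _ (interpolate ε a (ray ε ξ n)) _).trans ?_
      rw [← Set.Ioc_union_Ioc_eq_Ioc h2 h1, lintegral_union measurableSet_Ioc]
      · exact add_le_add (ih hs h2 le_rfl) (edge le_rfl h1 ht)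
      · exact Set.disjoint_left.2 fun r hr hr' => absurd hr.2 (not_le.2 hr'.1)

theorem isUpperGradient_edgeSlope (hK : 0 < K) (a : List (Fin K) → ℝ) :
    IsUpperGradient (interpolate ε a) (edgeSlope a) := by
  have key : ∀ (x : Tree K ε) (t : ℝ), 0 ≤ t → t ≤ x.level →
      edist (interpolate ε a (ancestor x t)) (interpolate ε a x) ≤
        ∫⁻ s in Set.Ioc t x.level, edgeSlope a (ancestor x s) *
          ENNReal.ofReal (Real.exp (-ε * s)) := by
    intro x t ht htx
    obtain ⟨ξ, hξ⟩ := exists_ray_eq hK x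
    obtain ⟨n, hn⟩ := exists_nat_ge x.level
    have h1 := edist_interpolate_ray_le (ε := ε) a ξ n ht htx hn
    have h2 : ∀ s, s ≤ x.level → ancestor x s = ray ε ξ s := fun s hs => by
      conv_lhs => rw [← hξ]
      exact ancestor_ray ξ hs
    rw [hξ, ← h2 t htx] at h1
    refine h1.trans_eq (setLIntegral_congr_fun measurableSet_Ioc fun s hs => ?_)
    simp only [h2 s hs.2]
  refine ⟨measurable_edgeSlope a, fun x y => ?_⟩
  rw [← Real.dist_eq, ← edist_dist]
  have h1 := key x (meet x y) (meet_nonneg x y) (meet_le_left x y)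
  have h2 := key y (meet x y) (meet_nonneg x y) (meet_le_right x y)
  rw [← ancestor_meet] at h2
  refine (edist_triangle_left _ _ (interpolate ε a (ancestor x (meet x y)))).trans ?_
  exact add_le_add h1 h2

end

/-! ### The extension operator -/

section
variable {K : ℕ} {ε : ℝ}

theorem abs_interpolate_ray_le (a : List (Fin K) → ℝ) (ξ : Boundary K) {n : ℕ} {s : ℝ}
    (hs : s ∈ Set.Ioc (n : ℝ) (n + 1)) :
    |interpolate ε a (ray ε ξ s)| ≤ |a (prefixWord ξ (n + 1))| + |a (prefixWord ξ n)| := by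
  have hd : 0 < radial ε (n + 1) - radial ε n := sub_pos.2 (radial_lt_succ ε n)
  rw [interpolate_ray a ξ ⟨hs.1.le, hs.2⟩]
  set a₀ := a (prefixWord ξ n)
  set a₁ := a (prefixWord ξ (n + 1))
  set τ := (radial ε s - radial ε n) / (radial ε (n + 1) - radial ε n) with hτ
  have hτ0 : 0 ≤ τ := div_nonneg (sub_nonneg.2 ((radial_strictMono ε).monotone hs.1.le)) hd.le
  have hτ1 : τ ≤ 1 := by
    rw [hτ, div_le_one hd]
    exact sub_le_sub_right ((radial_strictMono ε).monotone hs.2) _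
  have e : a₀ + (a₁ - a₀) / (radial ε (n + 1) - radial ε n) * (radial ε s - radial ε n) =
      τ * a₁ + (1 - τ) * a₀ := by rw [hτ]; field_simp; ring
  rw [e]
  refine (abs_add_le _ _).trans (add_le_add ?_ ?_)
  · rw [abs_mul, abs_of_nonneg hτ0]
    exact mul_le_of_le_one_left (abs_nonneg _) hτ1
  · rw [abs_mul, abs_of_nonneg (by linarith)]
    exact mul_le_of_le_one_left (abs_nonneg _) (by linarith)

theorem edgeSlope_ray_le (hε : 0 < ε) (ν : Measure (Boundary K)) (u : Boundary K → ℝ)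
    (ξ : Boundary K) {n : ℕ} {s : ℝ} (hs : s ∈ Set.Ioc (n : ℝ) (n + 1)) :
    edgeSlope (dyadicMean ν u) (ray ε ξ s) ≤
      oscillation ε ν u (n + 1) (prefixWord ξ (n + 1)) := by
  have hd : Real.exp (-ε * ((n + 1 : ℕ) : ℝ)) ≤ radial ε (n + 1) - radial ε n := by
    rw [← integral_exp_eq]
    calc Real.exp (-ε * ((n + 1 : ℕ) : ℝ))
        = ∫ _ in (n : ℝ)..(n + 1), Real.exp (-ε * ((n + 1 : ℕ) : ℝ)) := by simp
      _ ≤ _ := by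
        refine intervalIntegral.integral_mono_on (by linarith) (by simp)
          (intervalIntegrable_exp _ _ _) fun r hr => Real.exp_le_exp.2 ?_
        push_cast
        nlinarith [hr.2]
  rw [edgeSlope_ray _ ξ hs, oscillation, dropLast_prefixWord_succ]
  refine ENNReal.ofReal_le_ofReal ?_
  gcongr

/-- The `L^Φ` bound for the extension. -/
theorem luxemburg_interpolate_le (hK : 0 < K) (hε : 0 < ε) {β C p l₁ : ℝ} (l₂ : ℝ)
    (hC : 0 < C) (hb : 0 < β - Real.log K) (h : Admissible p l₁)
    {ν : Measure (Boundary K)} (hν : IsAhlforsRegular ε ν) :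
    ∃ M : ℝ≥0, ∀ (u : Boundary K → ℝ) (k : ℝ), Integrable u ν → 0 < k →
      ∫⁻ ξ, Phi p l₁ (ENNReal.ofReal |u ξ| / ENNReal.ofReal k) ∂ν ≤ 1 →
      luxemburg p l₁ (treeMeasure K ε β C l₂)
        (fun x => ENNReal.ofReal |interpolate ε (dyadicMean ν u) x|) ≤ M * ENNReal.ofReal k := by
  have := hν.isFiniteMeasure hε
  obtain ⟨A₁, H₁⟩ := lintegral_treeMeasure_le hK hε β l₂ hC hν
  obtain ⟨A₂, H₂⟩ := lintegral_Phi_setLAverage_le (K := K) h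
  obtain ⟨A₃, H₃⟩ := Phi_add_le h 1
  set W := ∑' n, levelWeight (β - Real.log K) l₂ n with hW
  have hWt : W ≠ ⊤ := tsum_levelWeight_ne_top l₂ hb
  have hfin : A₁ * (W * (A₃ * (2 * A₂))) ≠ ⊤ := by finiteness
  obtain ⟨M, HM⟩ := luxemburg_le_of_lintegral_le h.one_le l₁ (A₁ * (W * (A₃ * (2 * A₂)))).toNNReal
  refine ⟨M, fun u k hu hk hi => HM _ _ k hk ?_⟩
  rw [ENNReal.coe_toNNReal hfin]
  have hk' : ENNReal.ofReal k ≠ 0 := by simpa using hk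
  set U : Boundary K → ℝ≥0∞ := fun ξ => ENNReal.ofReal |u ξ| / ENNReal.ofReal k with hU
  have hmean : ∀ w, ENNReal.ofReal |dyadicMean ν u w| / ENNReal.ofReal k ≤
      ⨍⁻ ζ in cylinder w, U ζ ∂ν := by
    intro w
    rw [hU, setLAverage_div _ _ _ hk']
    refine ENNReal.div_le_div_right ?_ _
    simpa using ofReal_abs_dyadicMean_sub_le ν hu (hν.measure_cylinder_ne_zero hK hε w) 0
  have hedge : ∀ (ξ : Boundary K) (n : ℕ), edgeIntegral (fun x => Phi p l₁
      (ENNReal.ofReal |interpolate ε (dyadicMean ν u) x| / ENNReal.ofReal k))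
        (prefixWord ξ (n + 1)) ≤
      A₃ * (Phi p l₁ (⨍⁻ ζ in cylinder (prefixWord ξ (n + 1)), U ζ ∂ν) +
        Phi p l₁ (⨍⁻ ζ in cylinder (prefixWord ξ n), U ζ ∂ν)) := by
    intro ξ n
    rw [edgeIntegral_prefixWord]
    refine (setLIntegral_mono' measurableSet_Ioc (g := fun _ =>
      A₃ * (Phi p l₁ (⨍⁻ ζ in cylinder (prefixWord ξ (n + 1)), U ζ ∂ν) +
        Phi p l₁ (⨍⁻ ζ in cylinder (prefixWord ξ n), U ζ ∂ν))) fun s hs => H₃ _ _ _ ?_).trans ?_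
    · rw [ENNReal.coe_one, one_mul]
      refine le_trans ?_ (add_le_add (hmean _) (hmean _))
      rw [← ENNReal.add_div, ← ENNReal.ofReal_add (abs_nonneg _) (abs_nonneg _)]
      exact ENNReal.div_le_div_right
        (ENNReal.ofReal_le_ofReal (abs_interpolate_ray_le _ ξ hs)) _
    · simp
  refine (H₁ _).trans (mul_le_mul_right ?_ _)
  rw [hW, ← ENNReal.tsum_mul_right]
  refine ENNReal.tsum_le_tsum fun n => mul_le_mul_right ?_ _
  refine (lintegral_mono fun ξ => hedge ξ n).trans ?_
  rw [lintegral_const_mul' _ _ ENNReal.coe_ne_top, lintegral_add_left (measurable_comp_prefixWord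
    (fun w => Phi p l₁ (⨍⁻ ζ in cylinder w, U ζ ∂ν)) (n + 1))]
  refine mul_le_mul_right ?_ _
  calc _ ≤ A₂ * ∫⁻ ξ, Phi p l₁ (U ξ) ∂ν + A₂ * ∫⁻ ξ, Phi p l₁ (U ξ) ∂ν :=
        add_le_add (H₂ ν _ _) (H₂ ν _ _)
    _ ≤ A₂ * 1 + A₂ * 1 := by gcongr
    _ = _ := by ring

/-- The gradient bound for the extension. -/
theorem luxemburg_edgeSlope_le (hK : 0 < K) (hε : 0 < ε) {β C p l₁ θ : ℝ} (l₂ : ℝ)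
    (hC : 0 < C) (hθ : ε * (1 - θ) * p = β - Real.log K) (h : Admissible p l₁)
    {ν : Measure (Boundary K)} (hν : IsAhlforsRegular ε ν) :
    ∃ M : ℝ≥0, ∀ (u : Boundary K → ℝ) (k : ℝ), 0 < k →
      dyadicEnergy ε θ p l₁ l₂ ν (fun ξ => u ξ / k) ≤ 1 →
      luxemburg p l₁ (treeMeasure K ε β C l₂) (edgeSlope (dyadicMean ν u)) ≤
        M * ENNReal.ofReal k := by
  obtain ⟨A₁, H₁⟩ := lintegral_treeMeasure_le hK hε β l₂ hC hν
  obtain ⟨A₂, H₂⟩ := Phi_mono h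
  obtain ⟨M, HM⟩ := luxemburg_le_of_lintegral_le h.one_le l₁ (A₁ * A₂)
  refine ⟨M, fun u k hk hi => HM _ _ k hk ?_⟩
  rw [dyadicEnergy_eq_tsum_lintegral hθ] at hi
  refine (H₁ _).trans ?_
  rw [ENNReal.coe_mul]
  refine mul_le_mul_right ?_ _
  calc _ ≤ ∑' n, levelWeight (β - Real.log K) l₂ n * (A₂ *
        ∫⁻ ξ, Phi p l₁ (oscillation ε ν (fun ξ => u ξ / k) (n + 1) (prefixWord ξ (n + 1))) ∂ν) := by
        refine ENNReal.tsum_le_tsum fun n => mul_le_mul_right ?_ _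
        rw [← lintegral_const_mul' _ _ ENNReal.coe_ne_top]
        refine lintegral_mono fun ξ => ?_
        simp only [edgeIntegral_prefixWord]
        refine (setLIntegral_mono' measurableSet_Ioc (g := fun _ => A₂ * Phi p l₁
          (oscillation ε ν (fun ξ => u ξ / k) (n + 1) (prefixWord ξ (n + 1))))
          fun s hs => H₂ _ _ ?_).trans ?_
        · rw [oscillation_div _ _ _ _ _ hk]
          exact ENNReal.div_le_div_right (edgeSlope_ray_le hε ν u ξ hs) _
        · simp
    _ = A₂ * ∑' n, levelWeight (β - Real.log K) l₂ n *
        ∫⁻ ξ, Phi p l₁ (oscillation ε ν (fun ξ => u ξ / k) (n + 1) (prefixWord ξ (n + 1))) ∂ν := by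
        rw [← ENNReal.tsum_mul_left]
        exact tsum_congr fun n => mul_left_comm _ _ _
    _ ≤ A₂ * 1 := by gcongr
    _ = _ := mul_one _

theorem sobolevNorm_dyadicExtension_le (hK : 0 < K) (hε : 0 < ε) {β C p l₁ θ : ℝ} (l₂ : ℝ)
    (hC : 0 < C) (hb : 0 < β - Real.log K) (hθ : ε * (1 - θ) * p = β - Real.log K)
    (h : Admissible p l₁) {ν : Measure (Boundary K)} (hν : IsAhlforsRegular ε ν) :
    ∃ M : ℝ≥0, ∀ u : Boundary K → ℝ, Integrable u ν →
      sobolevNorm p l₁ (treeMeasure K ε β C l₂) (dyadicExtension ε ν u) ≤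
        M * besovNorm ε θ p l₁ l₂ ν u := by
  obtain ⟨M₁, H₁⟩ := luxemburg_interpolate_le hK hε l₂ hC hb h hν
  obtain ⟨M₂, H₂⟩ := luxemburg_edgeSlope_le hK hε l₂ hC hθ h hν
  have hM : M₁ + M₂ + 1 ≠ 0 := by positivity
  refine ⟨M₁ + M₂ + 1, fun u hu => ?_⟩
  rw [besovNorm]
  refine le_mul_add_iInf hM fun k₂ => le_mul_add_iInf hM fun hk₂ =>
    le_mul_add_iInf hM fun hi₂ => ?_
  rw [add_comm (luxemburg _ _ _ _)]
  refine le_mul_add_iInf hM fun k₁ => le_mul_add_iInf hM fun hk₁ =>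
    le_mul_add_iInf hM fun hi₁ => ?_
  have h1 := H₁ u k₁ hu hk₁ hi₁
  have h2 := H₂ u k₂ hk₂ hi₂
  calc sobolevNorm p l₁ (treeMeasure K ε β C l₂) (dyadicExtension ε ν u)
      ≤ M₁ * ENNReal.ofReal k₁ + M₂ * ENNReal.ofReal k₂ :=
        add_le_add h1 ((iInf₂_le _ (isUpperGradient_edgeSlope hK _)).trans h2)
    _ ≤ (M₁ + M₂) * ENNReal.ofReal k₁ + (M₁ + M₂) * ENNReal.ofReal k₂ := by
        gcongr
        · exact le_self_add
        · exact le_add_self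
    _ = (M₁ + M₂) * (ENNReal.ofReal k₂ + ENNReal.ofReal k₁) := by ring
    _ ≤ _ := by
        push_cast
        exact mul_le_mul_left le_self_add _

/-! ### Elements of the Orlicz–Besov space as functions -/

theorem besovNorm_congr {θ p l₁ l₂ : ℝ} {ν : Measure (Boundary K)} {f g : Boundary K → ℝ}
    (hfg : f =ᵐ[ν] g) : besovNorm ε θ p l₁ l₂ ν f = besovNorm ε θ p l₁ l₂ ν g := by
  have h1 : ∀ k : ℝ, ∫⁻ ξ, Phi p l₁ (ENNReal.ofReal |f ξ| / ENNReal.ofReal k) ∂ν =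
      ∫⁻ ξ, Phi p l₁ (ENNReal.ofReal |g ξ| / ENNReal.ofReal k) ∂ν := fun k =>
    lintegral_congr_ae (hfg.mono fun ξ hξ => by simp only [hξ])
  have h2 : ∀ k : ℝ, dyadicMean ν (fun ξ => f ξ / k) = dyadicMean ν fun ξ => g ξ / k := fun k =>
    funext fun w => dyadicMean_congr (hfg.mono fun ξ hξ => by simp only [hξ]) w
  simp only [besovNorm, besovSeminorm, luxemburg, dyadicEnergy, oscillation, h1, h2]

theorem orliczBesov.integrable {p l₁ θ l₂ : ℝ} (hε : 0 < ε) (h : Admissible p l₁)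
    {ν : Measure (Boundary K)} (hν : IsAhlforsRegular ε ν) (u : orliczBesov hε h θ l₂ hν) :
    Integrable u.1 ν := by
  have := hν.isFiniteMeasure hε
  exact integrable_of_luxemburg h u.1.aestronglyMeasurable (ENNReal.add_ne_top.1 u.2).1

end

end RegularTree

open RegularTree in
theorem theorem1p1 (K : ℕ) (hK : 2 ≤ K) (ε β p l₁ l₂ C θ : ℝ) (hε : 0 < ε)
    (hp : Admissible p l₁)
    (hpos : 0 < (β - Real.log K) / ε) (hlt : (β - Real.log K) / ε < p)
    (hC : max (2 * |l₂| / (β - Real.log K)) (2 * Real.log 4 / ε) ≤ C)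
    (hθ : θ = 1 - (β - Real.log K) / (ε * p))
    (ν : Measure (Boundary K)) (hν : IsAhlforsRegular ε ν) :
    ∃ (T : orliczSobolev hp (treeMeasure K ε β C l₂) →ₗ[ℝ] orliczBesov hε hp θ l₂ hν)
      (E : orliczBesov hε hp θ l₂ hν →ₗ[ℝ] orliczSobolev hp (treeMeasure K ε β C l₂)),
      -- `T` is bounded
      (∃ M : ℝ≥0, ∀ f : orliczSobolev hp (treeMeasure K ε β C l₂),
        besovNorm ε θ p l₁ l₂ ν (T f).1 ≤ M * sobolevNorm p l₁ (treeMeasure K ε β C l₂) f.1) ∧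
      -- `E` is bounded
      (∃ M : ℝ≥0, ∀ u : orliczBesov hε hp θ l₂ hν,
        sobolevNorm p l₁ (treeMeasure K ε β C l₂) (E u).1 ≤ M * besovNorm ε θ p l₁ l₂ ν u.1) ∧
      -- `T ∘ E` is the identity
      T ∘ₗ E = LinearMap.id ∧
      -- `T f` is the limit of `f` along almost every geodesic ray
      (∀ f : orliczSobolev hp (treeMeasure K ε β C l₂),
        ∀ᵐ ξ ∂ν, Tendsto (fun s : ℝ => f.1 (ray ε ξ s)) atTop (𝓝 ((T f).1 ξ))) ∧
      -- `E u` interpolates the dyadic means of `u`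
      (∀ (u : orliczBesov hε hp θ l₂ hν) (x : Tree K ε), (E u).1 x = dyadicExtension ε ν u.1 x) := by
  have := hν.isFiniteMeasure hε
  have hK0 : 0 < K := by omega
  have hp0 : 0 < p := by linarith [hp.one_le]
  have hb : 0 < β - Real.log K := by rwa [div_pos_iff_of_pos_right hε] at hpos
  have hbp : β - Real.log K < ε * p := by rwa [div_lt_iff₀ hε, mul_comm] at hlt
  have hC0 : 0 < C := by
    have : 0 < 2 * Real.log 4 / ε := by
      have := Real.log_pos (by norm_num : (1 : ℝ) < 4)
      positivity
    exact this.trans_le ((le_max_right _ _).trans hC)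
  have hθ' : ε * (1 - θ) * p = β - Real.log K := by
    rw [hθ]; field_simp; ring
  obtain ⟨MT, HT⟩ := besovNorm_rayLimit_le hK0 hε l₂ hC0 hb hbp hθ' hp hν
  obtain ⟨ME, HE⟩ := sobolevNorm_dyadicExtension_le hK0 hε (C := C) l₂ hC0 hb hθ' hp hν
  have hlim : ∀ f : orliczSobolev hp (treeMeasure K ε β C l₂),
      ∀ᵐ ξ ∂ν, Tendsto (fun s : ℝ => f.1 (ray ε ξ s)) atTop (𝓝 (rayLimit f.1 ξ)) := by
    intro f
    obtain ⟨-, g, hg, hgt⟩ := sobolevNorm_ne_top.1 f.2.2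
    filter_upwards [ae_raySum_ne_top hK0 hε l₂ hC0 hb hbp hp hν hg.1 hgt] with ξ hξ
    exact hg.tendsto_rayLimit hε hξ
  have hmeas := fun f : orliczSobolev hp (treeMeasure K ε β C l₂) =>
    aestronglyMeasurable_rayLimit (hlim f)
  have hmem : ∀ f : orliczSobolev hp (treeMeasure K ε β C l₂),
      besovNorm ε θ p l₁ l₂ ν (AEEqFun.mk (rayLimit f.1) (hmeas f)) ≤
        MT * sobolevNorm p l₁ (treeMeasure K ε β C l₂) f.1 := fun f => by
    rw [besovNorm_congr (AEEqFun.coeFn_mk _ _)]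
    exact HT f.1 f.2.1
  let T : orliczSobolev hp (treeMeasure K ε β C l₂) →ₗ[ℝ] orliczBesov hε hp θ l₂ hν :=
    { toFun := fun f => ⟨AEEqFun.mk (rayLimit f.1) (hmeas f),
        ne_top_of_le_ne_top (ENNReal.mul_ne_top ENNReal.coe_ne_top f.2.2) (hmem f)⟩
      map_add' := fun f g => by
        refine Subtype.ext ?_
        change AEEqFun.mk _ _ = AEEqFun.mk _ _ + AEEqFun.mk _ _
        rw [AEEqFun.mk_add_mk, AEEqFun.mk_eq_mk]
        filter_upwards [hlim f, hlim g, hlim (f + g)] with ξ h1 h2 h3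
        exact tendsto_nhds_unique h3 (h1.add h2)
      map_smul' := fun a f => by
        refine Subtype.ext ?_
        change AEEqFun.mk _ _ = a • AEEqFun.mk _ _
        rw [AEEqFun.smul_mk, AEEqFun.mk_eq_mk]
        filter_upwards [hlim f, hlim (a • f)] with ξ h1 h2
        exact tendsto_nhds_unique h2 (h1.const_smul a) }
  have hadd : ∀ (u v : orliczBesov hε hp θ l₂ hν) (w : List (Fin K)),
      dyadicMean ν (u + v).1 w = dyadicMean ν u.1 w + dyadicMean ν v.1 w := fun u v w => by
    rw [← dyadicMean_add (orliczBesov.integrable hε hp hν u) (orliczBesov.integrable hε hp hν v)]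
    exact dyadicMean_congr (AEEqFun.coeFn_add u.1 v.1) w
  have hsmul : ∀ (a : ℝ) (u : orliczBesov hε hp θ l₂ hν) (w : List (Fin K)),
      dyadicMean ν (a • u).1 w = a * dyadicMean ν u.1 w := fun a u w => by
    rw [← dyadicMean_mul]
    exact dyadicMean_congr (AEEqFun.coeFn_smul a u.1) w
  let E : orliczBesov hε hp θ l₂ hν →ₗ[ℝ] orliczSobolev hp (treeMeasure K ε β C l₂) :=
    { toFun := fun u => ⟨dyadicExtension ε ν u.1, (measurable_interpolate _).aemeasurable,
        ne_top_of_le_ne_top (ENNReal.mul_ne_top ENNReal.coe_ne_top u.2)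
          (HE u.1 (orliczBesov.integrable hε hp hν u))⟩
      map_add' := fun u v => by
        refine Subtype.ext (funext fun x => ?_)
        change dyadicExtension ε ν (u + v).1 x =
          dyadicExtension ε ν u.1 x + dyadicExtension ε ν v.1 x
        simp only [dyadicExtension, hadd]
        ring
      map_smul' := fun a u => by
        refine Subtype.ext (funext fun x => ?_)
        change dyadicExtension ε ν (a • u).1 x = a * dyadicExtension ε ν u.1 x
        simp only [dyadicExtension, hsmul]
        ring }
  have hT : ∀ f, ((T f).1 : Boundary K → ℝ) =ᵐ[ν] rayLimit f.1 := fun f => AEEqFun.coeFn_mk _ _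
  refine ⟨T, E, ⟨MT, hmem⟩, ⟨ME, fun u => HE u.1 (orliczBesov.integrable hε hp hν u)⟩, ?_, ?_,
    fun u x => rfl⟩
  · refine LinearMap.ext fun u => Subtype.ext (AEEqFun.ext ?_)
    filter_upwards [hT (E u), hlim (E u), tendsto_dyadicMean ν (orliczBesov.integrable hε hp hν u)
      u.1.stronglyMeasurable] with ξ h1 h2 h3
    -- at the vertices of the ray the extension takes the values of the dyadic means
    refine h1.trans (tendsto_nhds_unique (h2.comp tendsto_natCast_atTop_atTop) (h3.congr fun n => ?_))
    change _ = interpolate ε (dyadicMean ν u.1) (ray ε ξ n)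
    rw [ray_natCast, interpolate_vertex]
  · intro f
    filter_upwards [hT f, hlim f] with ξ h1 h2
    rwa [h1]
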